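/- Let $U=\mathbf{C}s\oplus\mathbf{C}t$ be the two-dimensional space of linear functions on $\mathbf{P}^1$, with its action of $\mathrm{SL}_2(\mathbf{C})$. Let $g\ge 3$, and let $T\subseteq\mathbf{P}^g$ be the tangent developable surface of the rational normal curve $C$ of degree $g$, i.e. the union of the tangent lines to $$C=\{[s^g,s^{g-1}t,\ldots,st^{g-1},t^g]\}\subseteq\mathbf{P}^g .$$ Put $V=H^0(\mathbf{P}^g,\mathcal{O}(1))=S^gU$ and $S=\mathrm{Sym}\,V$. For $i\ge 1$ let $K_{i,1}(\mathcal{O}_T)$ be the space of minimal generators of degree $i+1$ of the $i$-th term of the minimal graded free resolution of the graded $S$-module $\bigoplus_q H^0(T,\mathcal{O}_T(q))$, i.e. the homology at the middle term of the Koszul complex $$\Lambda^{i+1}V\otimes H^0(\mathcal{O}_T)\longrightarrow\Lambda^{i}V\otimes H^0(\mathcal{O}_T(1))\longrightarrow\Lambda^{i-1}V\otimes H^0(\mathcal{O}_T(2)).$$ The Wahl map $\Lambda^2S^{i+1}U^*\to S^{2i}U^*$ sends $f\wedge h$ to $f_xh_y-f_yh_x$, where $x,y$ is the basis of $U^*$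 dual to $s,t$; its transpose (with respect to the canonical pairings between $S^nU$ and $S^nU^*$) is the co-Wahl map $S^{2i}U\to\Lambda^2S^{i+1}U$. For a vector space $W$, the Koszul differential $\Lambda^2W\otimes S^qW\to W\otimes S^{q+1}W$ is $v\wedge w\otimes f\mapsto w\otimes vf-v\otimes wf$. Let $$\gamma' : S^{2i}U\otimes S^{g-i-2}S^{i+1}U\longrightarrow S^{i+1}U\otimes S^{g-i-1}S^{i+1}U$$ be the composition of the map induced by the co-Wahl map with the Koszul differential for $W=S^{i+1}U$ and $q=g-i-2$ (symmetric powers with negative exponent being zero). **Theorem.** For all $g\ge 3$ and $i\ge 1$ there is an $\mathrm{SL}_2(\mathbf{C})$-equivariant linear isomorphism $$K_{i,1}(\mathcal{O}_T)\;\cong\;\ker\gamma' .$$ -/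

import Mathlib

open scoped TensorProduct

noncomputable section

namespace TangentDevelopable

/-! ## Symmetric powers -/

section SymmetricPowers

variable (V : Type*) [AddCommGroup V] [Module ℂ V]

/-- The symmetric power `S^n V`, as the degree `n` part of the symmetric algebra `Sym V`
(in the same way as Mathlib's `⋀[ℂ]^n V` is the degree `n` part of the exterior algebra). -/
abbrev symPow (n : ℕ) : Submodule ℂ (SymmetricAlgebra ℂ V) :=
  (LinearMap.range (SymmetricAlgebra.ι ℂ V)) ^ n

/-- The symmetric power `S^q V` for an integer `q`, equal to zero if `q < 0`. -/
def symPowZ : ℤ → Submodule ℂ (SymmetricAlgebra ℂ V)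
  | Int.ofNat n => symPow V n
  | Int.negSucc _ => ⊥

variable {V}

theorem ι_mul_mem_symPow (v : V) {n : ℕ} {x : SymmetricAlgebra ℂ V} (hx : x ∈ symPow V n) :
    SymmetricAlgebra.ι ℂ V v * x ∈ symPow V (n + 1) := by
  rw [symPow, pow_succ']
  exact Submodule.mul_mem_mul (LinearMap.mem_range_self _ v) hx

theorem ι_mul_mem_symPowZ (v : V) {q r : ℤ} (h : r = q + 1) {x : SymmetricAlgebra ℂ V}
    (hx : x ∈ symPowZ V q) : SymmetricAlgebra.ι ℂ V v * x ∈ symPowZ V r := by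
  subst h
  cases q with
  | ofNat n => exact ι_mul_mem_symPow v hx
  | negSucc n =>
    have hx0 : x = 0 := hx
    rw [hx0, mul_zero]
    exact Submodule.zero_mem _

/-- The multiplication map `V × S^q V → S^r V`, where `r = q + 1`. -/
def symMul {q r : ℤ} (h : r = q + 1) : V →ₗ[ℂ] symPowZ V q →ₗ[ℂ] symPowZ V r :=
  LinearMap.mk₂ ℂ (fun v x => ⟨SymmetricAlgebra.ι ℂ V v * x.1, ι_mul_mem_symPowZ v h x.2⟩)
    (fun _ _ _ => Subtype.ext (by simp [add_mul]))
    (fun _ _ _ => Subtype.ext (by simp))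
    (fun _ _ _ => Subtype.ext (by simp [mul_add]))
    (fun _ _ _ => Subtype.ext (by simp))

/-- The algebra endomorphism of `Sym V` induced by a linear endomorphism of `V`. -/
def symMap (φ : V →ₗ[ℂ] V) : SymmetricAlgebra ℂ V →ₐ[ℂ] SymmetricAlgebra ℂ V :=
  SymmetricAlgebra.lift (SymmetricAlgebra.ι ℂ V ∘ₗ φ)

theorem symMap_mem_symPow (φ : V →ₗ[ℂ] V) {n : ℕ} {x : SymmetricAlgebra ℂ V}
    (hx : x ∈ symPow V n) : symMap φ x ∈ symPow V n := by
  have h1 : (symPow V n).map (symMap φ).toLinearMap ≤ symPow V n := by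
    rw [symPow, Submodule.map_pow]
    refine pow_le_pow_left' ?_ n
    rintro _ ⟨_, ⟨v, rfl⟩, rfl⟩
    exact ⟨φ v, by simp [symMap]⟩
  exact h1 (Submodule.mem_map_of_mem hx)

theorem symMap_mem_symPowZ (φ : V →ₗ[ℂ] V) {q : ℤ} :
    ∀ x ∈ symPowZ V q, (symMap φ).toLinearMap x ∈ symPowZ V q := by
  intro x hx
  cases q with
  | ofNat n => exact symMap_mem_symPow φ hx
  | negSucc n =>
    have hx0 : x = 0 := hx
    rw [hx0, map_zero]
    exact Submodule.zero_mem _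

/-- The endomorphism `S^q φ` of `S^q V`. -/
def symPowMap (φ : V →ₗ[ℂ] V) (q : ℤ) : symPowZ V q →ₗ[ℂ] symPowZ V q :=
  (symMap φ).toLinearMap.restrict (symMap_mem_symPowZ φ)

end SymmetricPowers

/-! ## Koszul differentials and Koszul groups -/

section Subquotients

variable {E : Type*} [AddCommGroup E] [Module ℂ E]

/-- The subquotient `Z / (B ∩ Z)` of a vector space. -/
abbrev Subquotient (Z B : Submodule ℂ E) : Type _ := Z ⧸ B.submoduleOf Z

/-- The map of subquotients induced by a linear map. -/
def Subquotient.map (Z B : Submodule ℂ E) (f : E →ₗ[ℂ] E) (hZ : ∀ x ∈ Z, f x ∈ Z)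
    (hB : ∀ x ∈ B, f x ∈ B) : Subquotient Z B →ₗ[ℂ] Subquotient Z B :=
  Submodule.mapQ _ _ (f.restrict hZ) (fun x hx => hB x.1 hx)

end Subquotients

section Koszul

variable {V M N L : Type*} [AddCommGroup V] [Module ℂ V] [AddCommGroup M] [Module ℂ M]
  [AddCommGroup N] [Module ℂ N] [AddCommGroup L] [Module ℂ L]

variable (V) in
/-- The map sending `v` to the alternating map `(v₁, …, v_p) ↦ (v₁ ∧ ⋯ ∧ v_p) ⊗ v`. -/
def wedgeComulAux (p : ℕ) : V →ₗ[ℂ] (V [⋀^Fin p]→ₗ[ℂ] ((⋀[ℂ]^p V) ⊗[ℂ] V)) where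
  toFun v := ((TensorProduct.mk ℂ (⋀[ℂ]^p V) V).flip v).compAlternatingMap
    (exteriorPower.ιMulti ℂ p)
  map_add' _ _ := AlternatingMap.ext fun _ => by simp
  map_smul' _ _ := AlternatingMap.ext fun _ => by simp

variable (V) in
/-- The comultiplication `Λ^{p+1} V → Λ^p V ⊗ V`,
`v₀ ∧ ⋯ ∧ v_p ↦ ∑ₖ (-1)^k (v₀ ∧ ⋯ ∧ v̂ₖ ∧ ⋯ ∧ v_p) ⊗ vₖ`. -/
def wedgeComul (p : ℕ) : ⋀[ℂ]^(p + 1) V →ₗ[ℂ] (⋀[ℂ]^p V) ⊗[ℂ] V :=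
  exteriorPower.alternatingMapLinearEquiv (R := ℂ) (M := V) (N := (⋀[ℂ]^p V) ⊗[ℂ] V) (n := p + 1)
    (AlternatingMap.alternatizeUncurryFin (R := ℂ) (M := V) (N := (⋀[ℂ]^p V) ⊗[ℂ] V) (n := p)
      (wedgeComulAux V p))

theorem wedgeComul_ιMulti (p : ℕ) (v : Fin (p + 1) → V) :
    wedgeComul V p (exteriorPower.ιMulti ℂ (p + 1) v) =
      ∑ k : Fin (p + 1),
        (-1 : ℤ) ^ (k : ℕ) • (exteriorPower.ιMulti ℂ p (fun j => v (k.succAbove j)) ⊗ₜ[ℂ] v k) := by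
  simp [wedgeComul, wedgeComulAux, AlternatingMap.alternatizeUncurryFin_apply]
  rfl

/-- The Koszul differential `Λ^{p+1} V ⊗ M → Λ^p V ⊗ N` attached to a bilinear multiplication
`V × M → N`:
`v₀ ∧ ⋯ ∧ v_p ⊗ m ↦ ∑ₖ (-1)^k (v₀ ∧ ⋯ ∧ v̂ₖ ∧ ⋯ ∧ v_p) ⊗ vₖ m`. -/
def koszulD (μ : V →ₗ[ℂ] M →ₗ[ℂ] N) (p : ℕ) :
    (⋀[ℂ]^(p + 1) V) ⊗[ℂ] M →ₗ[ℂ] (⋀[ℂ]^p V) ⊗[ℂ] N :=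
  (TensorProduct.lift μ).lTensor (⋀[ℂ]^p V) ∘ₗ
    (TensorProduct.assoc ℂ (⋀[ℂ]^p V) V M).toLinearMap ∘ₗ
      (wedgeComul V p).rTensor M

theorem koszulD_ιMulti (μ : V →ₗ[ℂ] M →ₗ[ℂ] N) (p : ℕ) (v : Fin (p + 1) → V) (m : M) :
    koszulD μ p (exteriorPower.ιMulti ℂ (p + 1) v ⊗ₜ[ℂ] m) =
      ∑ k : Fin (p + 1), (-1 : ℤ) ^ (k : ℕ) •
        (exteriorPower.ιMulti ℂ p (fun j => v (k.succAbove j)) ⊗ₜ[ℂ] μ (v k) m) := by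
  simp [koszulD, wedgeComul_ιMulti, TensorProduct.sum_tmul, TensorProduct.smul_tmul']

/-- The Koszul cycles: the kernel of the Koszul differential `Λ^i V ⊗ M → Λ^{i-1} V ⊗ N`
(everything if `i = 0`). -/
def koszulCycles (μ : V →ₗ[ℂ] M →ₗ[ℂ] N) : (i : ℕ) → Submodule ℂ ((⋀[ℂ]^i V) ⊗[ℂ] M)
  | 0 => ⊤
  | p + 1 => LinearMap.ker (koszulD μ p)

/-- The Koszul boundaries: the image of the Koszul differential `Λ^{i+1} V ⊗ L → Λ^i V ⊗ M`. -/
def koszulBoundaries (ν : V →ₗ[ℂ] L →ₗ[ℂ] M) (i : ℕ) : Submodule ℂ ((⋀[ℂ]^i V) ⊗[ℂ] M) :=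
  LinearMap.range (koszulD ν i)

/-- The Koszul group: the homology of `Λ^{i+1} V ⊗ L → Λ^i V ⊗ M → Λ^{i-1} V ⊗ N` at the middle
term.  When `L`, `M`, `N` are the pieces of degrees `q - 1`, `q`, `q + 1` of a graded module `E` over
`S = Sym V`, this is the group of syzygies `K_{i,q}(E) = Tor_i^S(E, ℂ)_{i+q}`, the space of minimal
generators of degree `i + q` of the `i`-th term of the minimal graded free resolution of `E`. -/
def KoszulGroup (ν : V →ₗ[ℂ] L →ₗ[ℂ] M) (μ : V →ₗ[ℂ] M →ₗ[ℂ] N) (i : ℕ) : Type _ :=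
  Subquotient (E := (⋀[ℂ]^i V) ⊗[ℂ] M) (koszulCycles μ i) (koszulBoundaries ν i)

instance (ν : V →ₗ[ℂ] L →ₗ[ℂ] M) (μ : V →ₗ[ℂ] M →ₗ[ℂ] N) (i : ℕ) :
    AddCommGroup (KoszulGroup ν μ i) :=
  inferInstanceAs (AddCommGroup
    (Subquotient (E := (⋀[ℂ]^i V) ⊗[ℂ] M) (koszulCycles μ i) (koszulBoundaries ν i)))

instance (ν : V →ₗ[ℂ] L →ₗ[ℂ] M) (μ : V →ₗ[ℂ] M →ₗ[ℂ] N) (i : ℕ) :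
    Module ℂ (KoszulGroup ν μ i) :=
  inferInstanceAs (Module ℂ
    (Subquotient (E := (⋀[ℂ]^i V) ⊗[ℂ] M) (koszulCycles μ i) (koszulBoundaries ν i)))

theorem koszulD_map (μ : V →ₗ[ℂ] M →ₗ[ℂ] N) (p : ℕ) (φ : V →ₗ[ℂ] V) (α : M →ₗ[ℂ] M)
    (β : N →ₗ[ℂ] N) (h : ∀ v m, μ (φ v) (α m) = β (μ v m)) (x : (⋀[ℂ]^(p + 1) V) ⊗[ℂ] M) :
    koszulD μ p (TensorProduct.map (exteriorPower.map (p + 1) φ) α x) =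
      TensorProduct.map (exteriorPower.map p φ) β (koszulD μ p x) := by
  induction x using TensorProduct.induction_on with
  | zero => simp only [map_zero]
  | add x y hx hy => simp only [map_add, hx, hy]
  | tmul ω m =>
    have hω : ω ∈ Submodule.span ℂ (Set.range (exteriorPower.ιMulti ℂ (p + 1) (M := V))) := by
      rw [exteriorPower.ιMulti_span]
      exact Submodule.mem_top
    induction hω using Submodule.span_induction with
    | mem ω hω =>
      obtain ⟨v, rfl⟩ := hω
      simp only [TensorProduct.map_tmul, exteriorPower.map_apply_ιMulti, koszulD_ιMulti,
        map_sum, map_zsmul, Function.comp_def, h]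
    | zero => simp only [TensorProduct.zero_tmul, map_zero]
    | add ω ω' _ _ h₁ h₂ => simp only [TensorProduct.add_tmul, map_add, h₁, h₂]
    | smul c ω _ h₁ =>
      simp only [← TensorProduct.smul_tmul', map_smul, h₁]

theorem koszulCycles_map (μ : V →ₗ[ℂ] M →ₗ[ℂ] N) (i : ℕ) (φ : V →ₗ[ℂ] V) (α : M →ₗ[ℂ] M)
    (β : N →ₗ[ℂ] N) (h : ∀ v m, μ (φ v) (α m) = β (μ v m)) :
    ∀ x ∈ koszulCycles μ i,
      TensorProduct.map (exteriorPower.map i φ) α x ∈ koszulCycles μ i := by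
  intro x hx
  cases i with
  | zero => exact Submodule.mem_top
  | succ p =>
    have hx' : koszulD μ p x = 0 := hx
    change koszulD μ p _ = 0
    rw [koszulD_map μ p φ α β h, hx', map_zero]

/-- The endomorphism of a Koszul group induced by compatible endomorphisms `φ` of `V` and
`γ`, `α`, `β` of `L`, `M`, `N`. -/
def koszulGroupMap (ν : V →ₗ[ℂ] L →ₗ[ℂ] M) (μ : V →ₗ[ℂ] M →ₗ[ℂ] N) (i : ℕ)
    (φ : V →ₗ[ℂ] V) (γ : L →ₗ[ℂ] L) (α : M →ₗ[ℂ] M) (β : N →ₗ[ℂ] N)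
    (hν : ∀ v l, ν (φ v) (γ l) = α (ν v l)) (hμ : ∀ v m, μ (φ v) (α m) = β (μ v m)) :
    KoszulGroup ν μ i →ₗ[ℂ] KoszulGroup ν μ i :=
  Subquotient.map (E := (⋀[ℂ]^i V) ⊗[ℂ] M) (koszulCycles μ i) (koszulBoundaries ν i)
    (TensorProduct.map (exteriorPower.map i φ) α) (koszulCycles_map μ i φ α β hμ)
    (by
      rintro _ ⟨y, rfl⟩
      exact ⟨TensorProduct.map (exteriorPower.map (i + 1) φ) γ y, koszulD_map ν i φ γ α hν y⟩)

end Koszul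

/-! ## Binary forms -/

/-- The polynomial ring `ℂ[s, t]`, with `s = X 0` and `t = X 1`. -/
abbrev BinPoly : Type := MvPolynomial (Fin 2) ℂ

/-- `S^n U`, where `U = ℂ s ⊕ ℂ t` is the space of linear functions on `ℙ¹`: the space of binary
forms of degree `n`. -/
abbrev Forms (n : ℕ) : Submodule ℂ BinPoly := MvPolynomial.homogeneousSubmodule (Fin 2) ℂ n

/-- The group `SL₂(ℂ)`. -/
abbrev SL2 : Type := Matrix.SpecialLinearGroup (Fin 2) ℂ

/-- The action of `A` on `ℂ[s, t]` by linear substitution: `A` acts on `U` in the standard way with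
respect to the basis `s, t`, and this action is extended multiplicatively. -/
def binSubst (A : SL2) : BinPoly →ₐ[ℂ] BinPoly :=
  MvPolynomial.aeval (fun j : Fin 2 => ∑ i : Fin 2, MvPolynomial.C (A.1 i j) * MvPolynomial.X i)

theorem binSubst_mem (A : SL2) (n : ℕ) :
    ∀ F ∈ Forms n, (binSubst A).toLinearMap F ∈ Forms n := by
  intro F hF
  have h := MvPolynomial.IsHomogeneous.aeval
    (n := 1) ((MvPolynomial.mem_homogeneousSubmodule n F).1 hF)
    (fun j : Fin 2 =>
      ∑ i : Fin 2, MvPolynomial.C (A.1 i j) * (MvPolynomial.X i : BinPoly))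
    (fun j => MvPolynomial.IsHomogeneous.sum _ _ _
      (fun i _ => MvPolynomial.isHomogeneous_C_mul_X _ i))
  rw [one_mul] at h
  exact h

/-- The action of `SL₂(ℂ)` on `S^n U`. -/
def formAct (A : SL2) (n : ℕ) : Forms n →ₗ[ℂ] Forms n :=
  (binSubst A).toLinearMap.restrict (binSubst_mem A n)

theorem binSubst_mul_apply (A B : SL2) (F : BinPoly) :
    binSubst A (binSubst B F) = binSubst (A * B) F := by
  suffices h : (binSubst A).comp (binSubst B) = binSubst (A * B) from DFunLike.congr_fun h F
  refine MvPolynomial.algHom_ext fun j => ?_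
  simp [binSubst, Matrix.mul_apply, Fin.sum_univ_two]
  ring

theorem binSubst_one_apply (F : BinPoly) : binSubst 1 F = F := by
  suffices h : binSubst 1 = AlgHom.id ℂ BinPoly from DFunLike.congr_fun h F
  refine MvPolynomial.algHom_ext fun j => ?_
  fin_cases j <;> simp [binSubst, Matrix.one_apply]

theorem formAct_inv (A : SL2) (n : ℕ) (F : Forms n) : formAct A n (formAct A⁻¹ n F) = F := by
  apply Subtype.ext
  change binSubst A (binSubst A⁻¹ F.1) = F.1
  rw [binSubst_mul_apply, mul_inv_cancel, binSubst_one_apply]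

/-! ## The tangent developable surface and its structure sheaf

The ambient projective space `ℙ^g` is the projective space of one-dimensional quotients of `S^g U`:
its affine cone is the dual of `S^g U`, a point `x` of this cone has the coordinates
`Z_j = x (s^{g-j} t^j)`, and `V = S^g U` is the space of linear forms on `ℙ^g`.  The homogeneous
coordinate ring of `ℙ^g` is `Sym V`. -/

/-- The value of a polynomial `P` on `ℙ^g` (an element of `Sym (S^g U)`) at a point of the affine
cone over `ℙ^g`. -/
def evalAt {g : ℕ} (x : Module.Dual ℂ (Forms g)) (P : SymmetricAlgebra ℂ (Forms g)) : ℂ :=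
  SymmetricAlgebra.lift x P

/-- The point `[u v] · Jac(μ)` of the affine cone over `ℙ^g`, where `p = (s, t)`, `w = (u, v)` and
`μ = (s^g, s^{g-1} t, …, t^g)`: its coordinates are `Z_j = u ∂_s(s^{g-j} t^j) + v ∂_t(s^{g-j} t^j)`.
For fixed `p ≠ 0` these points sweep out the (cone over the) embedded tangent line to the rational
normal curve at `μ(p)`. -/
def tangentPoint (g : ℕ) (p w : Fin 2 → ℂ) : Module.Dual ℂ (Forms g) :=
  (∑ i : Fin 2, w i • ((MvPolynomial.aeval p).toLinearMap ∘ₗ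
    (MvPolynomial.pderiv (R := ℂ) i).toLinearMap)) ∘ₗ (Forms g).subtype

/-- The punctured affine cone over the tangent developable `T ⊆ ℙ^g` of the rational normal curve
of degree `g`. -/
def tangentCone (g : ℕ) : Set (Module.Dual ℂ (Forms g)) :=
  {x | x ≠ 0 ∧ ∃ p w : Fin 2 → ℂ, p ≠ 0 ∧ x = tangentPoint g p w}

/-- The space `H⁰(T, 𝒪_T(q))`: functions on the punctured affine cone over `T` which Zariski-locally
are quotients `P / Q` of homogeneous polynomials with `deg P = deg Q + q`. -/
def sections (g q : ℕ) : Submodule ℂ (tangentCone g → ℂ) where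
  carrier := {f | ∀ x : tangentCone g, ∃ d : ℕ, ∃ Q ∈ symPow (Forms g) d,
    ∃ P ∈ symPow (Forms g) (d + q), evalAt x.1 Q ≠ 0 ∧
      ∀ y : tangentCone g, evalAt y.1 Q ≠ 0 → f y = evalAt y.1 P / evalAt y.1 Q}
  zero_mem' := fun x => ⟨0, 1, by simp [symPow, Submodule.one_le.1 le_rfl],
    0, Submodule.zero_mem _, by simp [evalAt], by simp [evalAt]⟩
  add_mem' := by
    intro f₁ f₂ h₁ h₂ x
    obtain ⟨d₁, Q₁, hQ₁, P₁, hP₁, hx₁, hf₁⟩ := h₁ x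
    obtain ⟨d₂, Q₂, hQ₂, P₂, hP₂, hx₂, hf₂⟩ := h₂ x
    refine ⟨d₁ + d₂, Q₁ * Q₂, ?_, P₁ * Q₂ + Q₁ * P₂, ?_, ?_, ?_⟩
    · rw [symPow, pow_add]; exact Submodule.mul_mem_mul hQ₁ hQ₂
    · refine Submodule.add_mem _ ?_ ?_
      · rw [symPow, add_right_comm, pow_add]; exact Submodule.mul_mem_mul hP₁ hQ₂
      · rw [symPow, add_assoc, pow_add]; exact Submodule.mul_mem_mul hQ₁ hP₂
    · simpa [evalAt] using ⟨hx₁, hx₂⟩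
    · intro y hy
      simp only [evalAt, map_mul, ne_eq, mul_eq_zero, not_or] at hy
      have e₁ := hf₁ y hy.1
      have e₂ := hf₂ y hy.2
      simp only [evalAt] at e₁ e₂
      simp only [evalAt, Pi.add_apply, map_add, map_mul, e₁, e₂]
      rw [div_add_div _ _ hy.1 hy.2]
  smul_mem' := by
    intro c f h x
    obtain ⟨d, Q, hQ, P, hP, hx, hf⟩ := h x
    refine ⟨d, Q, hQ, c • P, Submodule.smul_mem _ c hP, hx, fun y hy => ?_⟩
    have e := hf y hy
    simp only [evalAt] at e
    simp [evalAt, e, mul_div_assoc]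

theorem linear_mul_mem_sections {g q : ℕ} (v : Forms g) {f : tangentCone g → ℂ}
    (hf : f ∈ sections g q) : (fun x => x.1 v * f x) ∈ sections g (q + 1) := by
  intro x
  obtain ⟨d, Q, hQ, P, hP, hx, h⟩ := hf x
  refine ⟨d, Q, hQ, SymmetricAlgebra.ι ℂ (Forms g) v * P, ι_mul_mem_symPow v hP, hx,
    fun y hy => ?_⟩
  have e := h y hy
  simp only [evalAt] at e
  simp [evalAt, e, mul_div_assoc]

/-- The multiplication `V × H⁰(T, 𝒪_T(q)) → H⁰(T, 𝒪_T(q + 1))` by linear forms on `ℙ^g`. -/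
def sectionsMul (g q : ℕ) : Forms g →ₗ[ℂ] sections g q →ₗ[ℂ] sections g (q + 1) :=
  LinearMap.mk₂ ℂ (fun v f => ⟨fun x => x.1 v * f.1 x, linear_mul_mem_sections v f.2⟩)
    (fun _ _ _ => Subtype.ext (funext fun _ => by simp [add_mul]))
    (fun _ _ _ => Subtype.ext (funext fun _ => by simp [mul_assoc]))
    (fun _ _ _ => Subtype.ext (funext fun _ => by simp [mul_add]))
    (fun _ _ _ => Subtype.ext (funext fun _ => by simp [mul_left_comm]))

/-- The Koszul group `K_{i,1}(𝒪_T)`: the weight one syzygies of the graded `Sym V`-module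
`⨁_q H⁰(T, 𝒪_T(q))`, that is, the homology of
`Λ^{i+1} V ⊗ H⁰(𝒪_T) → Λ^i V ⊗ H⁰(𝒪_T(1)) → Λ^{i-1} V ⊗ H⁰(𝒪_T(2))`. -/
abbrev KT (g i : ℕ) : Type := KoszulGroup (sectionsMul g 0) (sectionsMul g 1) i

/-! ### The action of `SL₂(ℂ)` on the Koszul groups of `T` -/

theorem eval_binSubst (A : SL2) (p : Fin 2 → ℂ) (F : BinPoly) :
    MvPolynomial.aeval p (binSubst A F) = MvPolynomial.aeval (Matrix.vecMul p A.1) F := by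
  suffices h : (MvPolynomial.aeval p).comp (binSubst A) =
      MvPolynomial.aeval (R := ℂ) (Matrix.vecMul p A.1) from DFunLike.congr_fun h F
  refine MvPolynomial.algHom_ext fun j => ?_
  simp [binSubst, Matrix.vecMul, dotProduct, mul_comm]

theorem deriv_binSubst (A : SL2) (p w : Fin 2 → ℂ) (F : BinPoly) :
    ∑ i : Fin 2, w i * MvPolynomial.aeval p (MvPolynomial.pderiv i (binSubst A F)) =
      ∑ i : Fin 2, Matrix.vecMul w A.1 i *
        MvPolynomial.aeval (Matrix.vecMul p A.1) (MvPolynomial.pderiv i F) := by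
  induction F using MvPolynomial.induction_on with
  | C a => simp [binSubst]
  | add F G hF hG => simp only [map_add, mul_add, Finset.sum_add_distrib, hF, hG]
  | mul_X F j hF =>
    have hX : ∑ i : Fin 2, w i *
        MvPolynomial.aeval p (MvPolynomial.pderiv i (binSubst A (MvPolynomial.X j))) =
          Matrix.vecMul w A.1 j := by
      simp [binSubst, Matrix.vecMul, dotProduct, Fin.sum_univ_two, MvPolynomial.pderiv_X,
        Pi.single_apply]
    have hX' : ∀ i : Fin 2, MvPolynomial.aeval (R := ℂ) (Matrix.vecMul p A.1)
        (MvPolynomial.pderiv i (MvPolynomial.X j)) = if j = i then (1 : ℂ) else 0 := by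
      intro i
      by_cases h : j = i <;> simp [MvPolynomial.pderiv_X, h]
    simp only [map_mul, Derivation.leibniz, smul_eq_mul, map_add, eval_binSubst, mul_add,
      Finset.sum_add_distrib, hX', MvPolynomial.aeval_X]
    have e1 : ∀ (a : ℂ) (f : Fin 2 → ℂ), ∑ i, w i * (a * f i) = a * ∑ i, w i * f i := by
      intro a f
      rw [Finset.mul_sum]
      exact Finset.sum_congr rfl fun _ _ => by ring
    rw [e1, e1, hX, hF, ← MvPolynomial.aeval_X (R := ℂ) (Matrix.vecMul p A.1) j,
      ← eval_binSubst, Finset.mul_sum]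
    congr 1
    · simp [mul_comm]
    · refine Finset.sum_congr rfl fun _ _ => ?_
      simp only [MvPolynomial.aeval_X]
      ring

theorem tangentPoint_comp (g : ℕ) (A : SL2) (p w : Fin 2 → ℂ) :
    tangentPoint g p w ∘ₗ formAct A g =
      tangentPoint g (Matrix.vecMul p A.1) (Matrix.vecMul w A.1) := by
  ext F
  simpa [tangentPoint, formAct] using deriv_binSubst A p w F.1

theorem tangentCone_comp {g : ℕ} (A : SL2) {x : Module.Dual ℂ (Forms g)}
    (hx : x ∈ tangentCone g) : x ∘ₗ formAct A g ∈ tangentCone g := by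
  obtain ⟨hx0, p, w, hp, rfl⟩ := hx
  refine ⟨fun h => hx0 ?_, Matrix.vecMul p A.1, Matrix.vecMul w A.1, fun h => hp ?_,
    tangentPoint_comp g A p w⟩
  · ext F
    rw [← formAct_inv A g F]
    exact LinearMap.congr_fun h _
  · have h2 : Matrix.vecMul (Matrix.vecMul p A.1) (A⁻¹).1 = p := by
      rw [Matrix.vecMul_vecMul, ← Matrix.SpecialLinearGroup.coe_mul, mul_inv_cancel]
      simp
    rw [← h2, h, Matrix.zero_vecMul]

/-- The action of `SL₂(ℂ)` on the affine cone over `T`, contragredient to the action on `V`. -/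
def coneAct {g : ℕ} (A : SL2) (x : tangentCone g) : tangentCone g :=
  ⟨x.1 ∘ₗ formAct A g, tangentCone_comp A x.2⟩

theorem evalAt_comp {g : ℕ} (φ : Forms g →ₗ[ℂ] Forms g) (x : Module.Dual ℂ (Forms g))
    (P : SymmetricAlgebra ℂ (Forms g)) : evalAt (x ∘ₗ φ) P = evalAt x (symMap φ P) := by
  suffices h : SymmetricAlgebra.lift (x ∘ₗ φ) = (SymmetricAlgebra.lift x).comp (symMap φ) from
    DFunLike.congr_fun h P
  refine SymmetricAlgebra.algHom_ext ?_
  ext v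
  simp [symMap]

theorem coneAct_mem_sections {g q : ℕ} (A : SL2) :
    ∀ f ∈ sections g q, LinearMap.funLeft ℂ ℂ (coneAct A) f ∈ sections g q := by
  intro f hf x
  obtain ⟨d, Q, hQ, P, hP, hx, h⟩ := hf (coneAct A x)
  refine ⟨d, symMap (formAct A g) Q, symMap_mem_symPow _ hQ, symMap (formAct A g) P,
    symMap_mem_symPow _ hP, ?_, fun y hy => ?_⟩
  · rw [← evalAt_comp]; exact hx
  · rw [← evalAt_comp] at hy
    rw [← evalAt_comp, ← evalAt_comp]
    exact h (coneAct A y) hy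

/-- The action of `SL₂(ℂ)` on `H⁰(T, 𝒪_T(q))`. -/
def sectionsAct (A : SL2) (g q : ℕ) : sections g q →ₗ[ℂ] sections g q :=
  (LinearMap.funLeft ℂ ℂ (coneAct A)).restrict (coneAct_mem_sections A)

theorem sectionsMul_act (A : SL2) (g q : ℕ) (v : Forms g) (f : sections g q) :
    sectionsMul g q (formAct A g v) (sectionsAct A g q f) =
      sectionsAct A g (q + 1) (sectionsMul g q v f) := rfl

/-- The action of `SL₂(ℂ)` on `K_{i,1}(𝒪_T)`. -/
def KTAct (A : SL2) (g i : ℕ) : KT g i →ₗ[ℂ] KT g i :=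
  koszulGroupMap (sectionsMul g 0) (sectionsMul g 1) i (formAct A g)
    (sectionsAct A g 0) (sectionsAct A g 1) (sectionsAct A g 2)
    (sectionsMul_act A g 0) (sectionsMul_act A g 1)

/-! ## The Wahl map, the co-Wahl map, and the map `γ'`

The dual space `U*` has the basis `x, y` dual to `s, t`.  Binary forms in `x, y` are again
represented by elements of `Forms n`; thus `Forms n` stands for `S^n U` or for `S^n U*` according
to whether its variables are read as `s, t` or as `x, y`. -/

theorem jacobian_mem {n : ℕ} (f h : Forms (n + 1)) :
    MvPolynomial.pderiv 0 f.1 * MvPolynomial.pderiv 1 h.1 -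
      MvPolynomial.pderiv 1 f.1 * MvPolynomial.pderiv 0 h.1 ∈ Forms (2 * n) := by
  have hd : ∀ (i : Fin 2) (k : Forms (n + 1)), (MvPolynomial.pderiv i k.1).IsHomogeneous n :=
    fun i k => MvPolynomial.IsHomogeneous.pderiv
      ((MvPolynomial.mem_homogeneousSubmodule _ _).1 k.2)
  rw [two_mul]
  exact Submodule.sub_mem _ ((hd 0 f).mul (hd 1 h)) ((hd 1 f).mul (hd 0 h))

/-- The Jacobian determinant `(f, h) ↦ f_x h_y - f_y h_x` as a bilinear map. -/
def jacobian (n : ℕ) : Forms (n + 1) →ₗ[ℂ] Forms (n + 1) →ₗ[ℂ] Forms (2 * n) :=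
  LinearMap.mk₂ ℂ (fun f h => ⟨_, jacobian_mem f h⟩)
    (fun _ _ _ => Subtype.ext (by simp; ring))
    (fun _ _ _ => Subtype.ext (by simp [smul_sub]))
    (fun _ _ _ => Subtype.ext (by simp; ring))
    (fun _ _ _ => Subtype.ext (by simp [smul_sub]))

/-- An alternating bilinear map, as an alternating map of two variables. -/
def altOfBilin {E F : Type*} [AddCommGroup E] [Module ℂ E] [AddCommGroup F] [Module ℂ F]
    (B : E →ₗ[ℂ] E →ₗ[ℂ] F) (hB : ∀ x, B x x = 0) : E [⋀^Fin 2]→ₗ[ℂ] F where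
  toFun v := B (v 0) (v 1)
  map_update_add' := by
    intro _ m i a b
    fin_cases i <;> simp
  map_update_smul' := by
    intro _ m i c a
    fin_cases i <;> simp
  map_eq_zero_of_eq' := by
    intro v i j hv hij
    have h01 : v 0 = v 1 := by
      fin_cases i <;> fin_cases j <;> simp_all
    rw [h01, hB]

theorem jacobian_self (n : ℕ) (f : Forms (n + 1)) : jacobian n f f = 0 := by
  apply Subtype.ext
  change MvPolynomial.pderiv 0 f.1 * MvPolynomial.pderiv 1 f.1 -
    MvPolynomial.pderiv 1 f.1 * MvPolynomial.pderiv 0 f.1 = 0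
  ring

/-- The Wahl (or Gaussian) map `Λ² S^{n+1} U* → S^{2n} U*`, `f ∧ h ↦ f_x h_y - f_y h_x`. -/
def wahl (n : ℕ) : ⋀[ℂ]^2 (Forms (n + 1)) →ₗ[ℂ] Forms (2 * n) :=
  exteriorPower.alternatingMapLinearEquiv (R := ℂ) (M := Forms (n + 1)) (N := Forms (2 * n))
    (n := 2) (altOfBilin (jacobian n) (jacobian_self n))

theorem wahl_ιMulti (n : ℕ) (v : Fin 2 → Forms (n + 1)) :
    (wahl n (exteriorPower.ιMulti ℂ 2 v) : BinPoly) =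
      MvPolynomial.pderiv 0 (v 0).1 * MvPolynomial.pderiv 1 (v 1).1 -
        MvPolynomial.pderiv 1 (v 0).1 * MvPolynomial.pderiv 0 (v 1).1 := by
  simp [wahl, jacobian, altOfBilin]

/-- The exponent of the monomial `s^a t^b` (or `x^a y^b`), where `ab = (a, b)`. -/
def expo (ab : ℕ × ℕ) : Fin 2 →₀ ℕ := Finsupp.single 0 ab.1 + Finsupp.single 1 ab.2

/-- The canonical pairing `S^n U × S^n U* → ℂ`, under which products `u₁ ⋯ uₙ` and `w₁ ⋯ wₙ` of
linear forms pair to `∑_σ ∏_k ⟨u_k, w_{σ(k)}⟩`: the monomials `s^a t^b` and `x^a y^b` pair to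
`a! b!`, and distinct monomials are orthogonal. -/
def apolar (n : ℕ) : Forms n →ₗ[ℂ] Module.Dual ℂ (Forms n) :=
  LinearMap.mk₂ ℂ (fun F G => ∑ ab ∈ Finset.HasAntidiagonal.antidiagonal n,
      (ab.1.factorial * ab.2.factorial : ℂ) *
        (MvPolynomial.coeff (expo ab) F.1 * MvPolynomial.coeff (expo ab) G.1))
    (fun _ _ _ => by simp [add_mul, mul_add, Finset.sum_add_distrib])
    (fun _ _ _ => by
      simp only [Submodule.coe_smul, MvPolynomial.coeff_smul, smul_eq_mul, Finset.mul_sum]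
      exact Finset.sum_congr rfl fun _ _ => by ring)
    (fun _ _ _ => by simp [mul_add, Finset.sum_add_distrib])
    (fun _ _ _ => by
      simp only [Submodule.coe_smul, MvPolynomial.coeff_smul, smul_eq_mul, Finset.mul_sum]
      exact Finset.sum_congr rfl fun _ _ => by ring)

instance (n : ℕ) : FiniteDimensional ℂ (Forms n) :=
  Module.Finite.iff_fg.2 (MvPolynomial.homogeneousSubmodule_fg (Fin 2) ℂ n)

theorem expo_injective : Function.Injective expo := by
  intro a b h
  have h0 := DFunLike.congr_fun h 0
  have h1 := DFunLike.congr_fun h 1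
  simp [expo] at h0 h1
  exact Prod.ext h0 h1

theorem apolar_injective (n : ℕ) : Function.Injective (apolar n) := by
  rw [injective_iff_map_eq_zero]
  intro F hF
  have key : ∀ ab ∈ Finset.HasAntidiagonal.antidiagonal n, MvPolynomial.coeff (expo ab) F.1 = 0 := by
    intro ab hab
    have hmem : MvPolynomial.monomial (expo ab) (1 : ℂ) ∈ Forms n := by
      refine MvPolynomial.isHomogeneous_monomial _ ?_
      rw [expo, map_add, Finsupp.degree_single, Finsupp.degree_single]
      exact Finset.HasAntidiagonal.mem_antidiagonal.1 hab
    have h := LinearMap.congr_fun hF ⟨_, hmem⟩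
    rw [LinearMap.zero_apply] at h
    simp only [apolar, LinearMap.mk₂_apply, MvPolynomial.coeff_monomial,
      expo_injective.eq_iff] at h
    rw [Finset.sum_eq_single ab (fun b _ hb => by simp [Ne.symm hb]) (fun h' => absurd hab h')] at h
    simpa [Nat.factorial_ne_zero] using h
  apply Subtype.ext
  ext d
  by_contra hne
  have hdeg := (MvPolynomial.mem_homogeneousSubmodule n F.1).1 F.2 (by simpa using hne)
  have hd : d = expo (d 0, d 1) := by
    ext i
    fin_cases i <;> simp [expo]
  apply hne
  rw [hd]
  simp only [ZeroMemClass.coe_zero, MvPolynomial.coeff_zero]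
  apply key
  rw [Finset.HasAntidiagonal.mem_antidiagonal]
  rw [hd, Finsupp.weight_apply] at hdeg
  simpa [Finsupp.sum_fintype, expo] using hdeg

/-- The identification `S^n U ≃ (S^n U*)*` given by the canonical pairing. -/
def apolarEquiv (n : ℕ) : Forms n ≃ₗ[ℂ] Module.Dual ℂ (Forms n) :=
  LinearEquiv.ofInjectiveOfFinrankEq (apolar n) (apolar_injective n)
    Subspace.dual_finrank_eq.symm

theorem pairingDual_injective (E : Type*) [AddCommGroup E] [Module ℂ E] [FiniteDimensional ℂ E]
    (n : ℕ) : Function.Injective (exteriorPower.pairingDual ℂ E n) := by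
  let b := Module.finBasis ℂ E
  have hfin : Module.finrank ℂ (⋀[ℂ]^n (Module.Dual ℂ E)) =
      Module.finrank ℂ (Module.Dual ℂ (⋀[ℂ]^n E)) := by
    rw [Subspace.dual_finrank_eq, exteriorPower.finrank_eq, exteriorPower.finrank_eq,
      Subspace.dual_finrank_eq]
  rw [LinearMap.injective_iff_surjective_of_finrank_eq_finrank hfin, ← LinearMap.range_eq_top,
    eq_top_iff, ← (b.exteriorPower n).dualBasis.span_eq, Submodule.span_le]
  rintro _ ⟨s, rfl⟩
  refine ⟨exteriorPower.ιMulti_family ℂ n b.coord s, ?_⟩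
  rw [Module.Basis.coe_dualBasis, exteriorPower.basis_coord]
  rfl

/-- The identification `Λ² S^n U ≃ (Λ² S^n U*)*` given by the canonical pairings:
`⟨f₀ ∧ f₁, h₀ ∧ h₁⟩ = det ⟨f_j, h_i⟩`. -/
def wedgeApolarEquiv (n : ℕ) :
    ⋀[ℂ]^2 (Forms n) ≃ₗ[ℂ] Module.Dual ℂ (⋀[ℂ]^2 (Forms n)) :=
  LinearEquiv.ofInjectiveOfFinrankEq
    (exteriorPower.pairingDual ℂ (Forms n) 2 ∘ₗ exteriorPower.map 2 (apolar n))
    ((pairingDual_injective (Forms n) 2).comp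
      (exteriorPower.map_injective_field (apolar_injective n)))
    Subspace.dual_finrank_eq.symm

/-- The co-Wahl map `S^{2n} U → Λ² S^{n+1} U`, the transpose of the Wahl map
`Λ² S^{n+1} U* → S^{2n} U*`. -/
def coWahl (n : ℕ) : Forms (2 * n) →ₗ[ℂ] ⋀[ℂ]^2 (Forms (n + 1)) :=
  (wedgeApolarEquiv (n + 1)).symm.toLinearMap ∘ₗ (wahl n).dualMap ∘ₗ
    (apolarEquiv (2 * n)).toLinearMap

theorem coWahl_pairing (n : ℕ) (F : Forms (2 * n)) (ω : ⋀[ℂ]^2 (Forms (n + 1))) :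
    wedgeApolarEquiv (n + 1) (coWahl n F) ω = apolarEquiv (2 * n) F (wahl n ω) := by
  simp [coWahl]

/-- The Koszul differential `Λ² V ⊗ S^q V → V ⊗ S^r V`, where `r = q + 1`:
`v₀ ∧ v₁ ⊗ f ↦ v₁ ⊗ v₀ f - v₀ ⊗ v₁ f`. -/
def koszulSym (V : Type*) [AddCommGroup V] [Module ℂ V] {q r : ℤ} (h : r = q + 1) :
    (⋀[ℂ]^2 V) ⊗[ℂ] symPowZ V q →ₗ[ℂ] V ⊗[ℂ] symPowZ V r :=
  (exteriorPower.oneEquiv ℂ V).toLinearMap.rTensor (symPowZ V r) ∘ₗ koszulD (symMul h) 1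

/-- The map `γ' : S^{2i} U ⊗ S^{g-i-2} S^{i+1} U → S^{i+1} U ⊗ S^{g-i-1} S^{i+1} U`, the pull-back of
the Koszul differential along the co-Wahl map. -/
def gammaPrime (g i : ℕ) :
    (Forms (2 * i)) ⊗[ℂ] symPowZ (Forms (i + 1)) ((g : ℤ) - i - 2) →ₗ[ℂ]
      (Forms (i + 1)) ⊗[ℂ] symPowZ (Forms (i + 1)) ((g : ℤ) - i - 1) :=
  koszulSym (Forms (i + 1)) (by ring) ∘ₗ (coWahl i).rTensor _

/-- The action of `SL₂(ℂ)` on `S^{2i} U ⊗ S^{g-i-2} S^{i+1} U`. -/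
def sourceAct (A : SL2) (g i : ℕ) :
    (Forms (2 * i)) ⊗[ℂ] symPowZ (Forms (i + 1)) ((g : ℤ) - i - 2) →ₗ[ℂ]
      (Forms (2 * i)) ⊗[ℂ] symPowZ (Forms (i + 1)) ((g : ℤ) - i - 2) :=
  TensorProduct.map (formAct A (2 * i)) (symPowMap (formAct A (i + 1)) _)

end TangentDevelopable

end

/-! Write i = m + 1. Regular functions on the cone over T pull back along (p, w) ↦ `tangentPoint g p
w` to polynomials. Homogeneity makes those of degree 0 constant. In degree 1, the parametrization
has zero derivative in one direction at each point of the curve, and this forces a section to be a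
linear form. Hence H⁰(𝒪_T) = ℂ and H⁰(𝒪_T(1)) = V (`sections_zero_const`, `sections_one_linear`),
and K_{i,1} is the space of cycles in Λ^i V ⊗ V modulo the image of Λ^{i+1} V.

An element of Λ^i V ⊗ V is determined by its values at m + 2 points of the rational normal curve,
which are antisymmetric in the last m + 1 points. Symmetrizing in the first two points (`symEval`)
kills exactly Λ^{i+1} V (`mem_koszulBoundaries_iff`). For a cycle, the symmetric bilinear form in
the first two arguments vanishes on tangent lines, so in affine coordinates the symmetrized function
is divisible by (z_0 - z_1)³ (`symEval_pow_dvd`). It follows that the values are the Vandermonde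
product times a polynomial σ, symmetric in all but the first variable. If σ_a denotes σ with z_a as
the distinguished variable, then (z_a - z_b)³ divides σ_a - σ_b, and the symmetrization is the
Vandermonde product times σ_0 - σ_1 (`exists_quotient_vandPoly`).

An element G of the source of γ' is a polynomial map P ↦ l_P from S^{i+1} U* to the dual of S^{2i}
U*, and γ'(G) = 0 means that l_P kills every Jacobian of P with a form f (`mem_ker_gammaPrime_iff`).
For P = ∏ ℓ_j with distinct roots, l_P is then determined by its values on the test forms P² / (ℓ_a
ℓ_b) (`dual_eq_zero_of_test`). Multiplied by the discriminant and by the bracket [a b], these values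
become an additive cocycle in (a, b), by the Plücker relation (`testEval_add`). Its value at (0, 1)
is `formEval`, which is therefore injective on ker γ'. The isomorphism results because `symEval` on
cycles and `formEval` on ker γ' have the same image.

From G to a cycle: averaging writes the cocycle as a difference, which yields ω
(`exists_symEval_eq`). It is a cycle because the discriminant, the bracket and the value of l_P at
the test form all vanish when the two points coincide, the test form then being proportional to a
Jacobian or zero. From a cycle to G: put l(h) = Σ_c (σ_a - σ_c) Res_{z_c}(h / P²). This kills
Jacobians, since their quotients by P² are multiples of (f / P)'; it has the right values at test
forms, and it does not depend on a. Varying a removes all poles in the points (`exists_interpPoly`),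
and a symmetric polynomial of degree at most q in each variable comes from S^q S^{i+1} U
(`exists_evalForm_eq`). Equivariance holds because both evaluations turn the action of SL₂ into
moving the points. -/

noncomputable section

namespace TangentDevelopable

open MvPolynomial

/-! ## Regular functions on the tangent developable -/

/-- The coordinate ring `ℂ[p, w]` of the parameter space of the cone over the tangent
developable. -/
abbrev ParamPoly : Type := MvPolynomial (Fin 2 ⊕ Fin 2) ℂ

/-- Pull-back of polynomials on `ℙ^g` along the parametrization `(p, w) ↦ tangentPoint g p w`. -/
def pullParam (g : ℕ) : SymmetricAlgebra ℂ (Forms g) →ₐ[ℂ] ParamPoly :=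
  SymmetricAlgebra.lift ((∑ i : Fin 2, LinearMap.mulLeft ℂ (X (Sum.inr i) : ParamPoly) ∘ₗ
    (rename Sum.inl : BinPoly →ₐ[ℂ] ParamPoly).toLinearMap ∘ₗ
      (pderiv (R := ℂ) i).toLinearMap) ∘ₗ (Forms g).subtype)

theorem tangentPoint_apply (g : ℕ) (p w : Fin 2 → ℂ) (F : Forms g) :
    tangentPoint g p w F = ∑ i, w i * eval p (pderiv i F.1) := by
  simp [tangentPoint, aeval_eq_eval]

theorem eval_pullParam (g : ℕ) (p w : Fin 2 → ℂ) (Q : SymmetricAlgebra ℂ (Forms g)) :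
    eval (Sum.elim p w) (pullParam g Q) = evalAt (tangentPoint g p w) Q := by
  suffices h : (aeval (Sum.elim p w)).comp (pullParam g) =
      SymmetricAlgebra.lift (tangentPoint g p w) from
    by
      simpa [aeval_eq_eval, evalAt] using DFunLike.congr_fun h Q
  refine SymmetricAlgebra.algHom_ext ?_
  ext F
  simp [pullParam, tangentPoint_apply, aeval_eq_eval, eval_rename]

/-- A nonzero polynomial is nonzero at some point with nonzero `p` and `w`. -/
theorem paramPoly_eq_zero {F : ParamPoly}
    (h : ∀ p w : Fin 2 → ℂ, p ≠ 0 → w ≠ 0 → eval (Sum.elim p w) F = 0) : F = 0 := by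
  have h1 : F * (X (Sum.inl 0) * X (Sum.inr 0)) = 0 := by
    refine MvPolynomial.funext fun v => ?_
    obtain ⟨p, w, rfl⟩ : ∃ p w, v = Sum.elim p w :=
      ⟨v ∘ Sum.inl, v ∘ Sum.inr, (Sum.elim_comp_inl_inr v).symm⟩
    simp only [map_mul, eval_X, Sum.elim_inl, Sum.elim_inr, map_zero]
    by_cases hp : p = 0
    · simp [hp]
    by_cases hw : w = 0
    · simp [hw]
    rw [h p w hp hw, zero_mul]
  have hX : (X (Sum.inl 0) * X (Sum.inr 0) : ParamPoly) ≠ 0 := mul_ne_zero (X_ne_zero _)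
    (X_ne_zero _)
  exact (mul_eq_zero.1 h1).resolve_right hX

/-- A polynomial without zeros with `p ≠ 0` and `w ≠ 0` is constant. -/
theorem paramPoly_eq_C {Q : ParamPoly}
    (h : ∀ p w : Fin 2 → ℂ, p ≠ 0 → w ≠ 0 → eval (Sum.elim p w) Q ≠ 0) :
    ∃ c : ℂ, c ≠ 0 ∧ Q = C c := by
  set u : Fin 2 ⊕ Fin 2 → ℂ := Sum.elim ![1, 0] ![1, 0] with hu
  refine ⟨eval u Q, h _ _ (fun h => by simpa using congrFun h 0)
    (fun h => by simpa using congrFun h 0), ?_⟩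
  by_contra hne
  -- The extra factors provide a point v whose second coordinates are nonzero both in p and in w.
  -- The line joining u to v then avoids p = 0 and w = 0: the second coordinates vanish only at u,
  -- where the first ones are 1. A nonconstant restriction of Q to this line has a root.
  have hne' : (Q - C (eval u Q)) * (X (Sum.inl 1) * X (Sum.inr 1)) ≠ 0 :=
    mul_ne_zero (sub_ne_zero.2 hne) (mul_ne_zero (X_ne_zero _) (X_ne_zero _))
  obtain ⟨v, hv⟩ : ∃ v, eval v ((Q - C (eval u Q)) * (X (Sum.inl 1) * X (Sum.inr 1))) ≠ 0 := by
    by_contra hcon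
    push Not at hcon
    exact hne' (MvPolynomial.funext fun v => by rw [hcon v, map_zero])
  simp only [map_mul, map_sub, eval_C, eval_X, ne_eq, mul_eq_zero, not_or] at hv
  obtain ⟨hv0, hv1, hv2⟩ := hv
  let r : Polynomial ℂ := aeval (fun s => Polynomial.C (u s) + Polynomial.X *
    Polynomial.C (v s - u s)) Q
  have hr : ∀ z, r.eval z = eval (fun s => u s + z * (v s - u s)) Q := by
    intro z
    have : (Polynomial.aeval z).comp (aeval (fun s => Polynomial.C (u s) + Polynomial.X *
        Polynomial.C (v s - u s))) = aeval (R := ℂ) (fun s => u s + z * (v s - u s)) := by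
      ext s
      simp
    have h2 := DFunLike.congr_fun this Q
    simpa [r, aeval_eq_eval, Polynomial.coe_aeval_eq_eval] using h2
  have hdeg : r.degree ≠ 0 := by
    intro hd
    rw [Polynomial.eq_C_of_degree_eq_zero hd] at hr
    have h0 := hr 0
    have h1 := hr 1
    simp only [Polynomial.eval_C] at h0 h1
    rw [h0] at h1
    apply hv0
    simp only [zero_mul, add_zero, one_mul, add_sub_cancel] at h1
    exact sub_eq_zero.2 h1.symm
  obtain ⟨z, hz⟩ := IsAlgClosed.exists_root r hdeg
  have hz' : r.eval z = 0 := hz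
  rw [hr, show (fun s => u s + z * (v s - u s)) = Sum.elim
    (fun j => u (Sum.inl j) + z * (v (Sum.inl j) - u (Sum.inl j)))
    (fun j => u (Sum.inr j) + z * (v (Sum.inr j) - u (Sum.inr j))) by
      ext s; cases s <;> rfl] at hz'
  refine h _ _ ?_ ?_ hz'
  · intro h0
    have e1 := congrFun h0 1
    have e0 := congrFun h0 0
    simp [hu, hv1] at e1
    simp [hu, e1] at e0
  · intro h0
    have e1 := congrFun h0 1
    have e0 := congrFun h0 0
    simp [hu, hv2] at e1
    simp [hu, e1] at e0

/-- If p_0 ≠ 0, the coordinate s^g of the point is g p_0^{g-1} w_0. Once w_0 = 0, the coordinate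
s^{g-1} t is p_0^{g-1} w_1, so both entries of w can be read off. The case p_1 ≠ 0 is symmetric. -/
theorem tangentPoint_ne_zero {g : ℕ} (hg : 2 ≤ g) {p w : Fin 2 → ℂ} (hp : p ≠ 0) (hw : w ≠ 0) :
    tangentPoint g p w ≠ 0 := by
  obtain ⟨d, rfl⟩ := Nat.exists_eq_add_of_le hg
  intro h0
  have h1 : ∀ (F : BinPoly), F.IsHomogeneous (2 + d) → ∑ i, w i * eval p (pderiv i F) = 0 := by
    intro F hF
    rw [← tangentPoint_apply (2 + d) p w ⟨F, hF⟩, h0, LinearMap.zero_apply]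
  have e1 : (2 : ℂ) + d ≠ 0 := by norm_cast; omega
  have hp' : p 0 ≠ 0 ∨ p 1 ≠ 0 := by
    by_contra hcon
    push Not at hcon
    exact hp (funext fun j => by fin_cases j <;> simp [hcon.1, hcon.2])
  apply hw
  rcases hp' with h | h
  · have a1 := h1 (X 0 ^ (2 + d)) (isHomogeneous_X_pow _ _)
    have a2 := h1 (X 0 ^ (1 + d) * X 1) (by
      have := (isHomogeneous_X_pow (R := ℂ) (0 : Fin 2) (1 + d)).mul (isHomogeneous_X ℂ (1 : Fin 2))
      rwa [show 1 + d + 1 = 2 + d by ring] at this)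
    simp [pderiv_X, Pi.single_apply, Fin.sum_univ_two, h, e1] at a1
    simp [pderiv_X, Pi.single_apply, Fin.sum_univ_two, h, a1] at a2
    funext j
    fin_cases j <;> simp [a1, a2]
  · have a1 := h1 (X 1 ^ (2 + d)) (isHomogeneous_X_pow _ _)
    have a2 := h1 (X 1 ^ (1 + d) * X 0) (by
      have := (isHomogeneous_X_pow (R := ℂ) (1 : Fin 2) (1 + d)).mul (isHomogeneous_X ℂ (0 : Fin 2))
      rwa [show 1 + d + 1 = 2 + d by ring] at this)
    simp [pderiv_X, Pi.single_apply, Fin.sum_univ_two, h, e1] at a1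
    simp [pderiv_X, Pi.single_apply, Fin.sum_univ_two, h, a1] at a2
    funext j
    fin_cases j <;> simp [a1, a2]

/-- A point of the cone over the tangent developable, given by parameters. -/
def conePoint {g : ℕ} (hg : 2 ≤ g) {p w : Fin 2 → ℂ} (hp : p ≠ 0) (hw : w ≠ 0) : tangentCone g :=
  ⟨tangentPoint g p w, tangentPoint_ne_zero hg hp hw, p, w, hp, rfl⟩

theorem exists_conePoint {g : ℕ} (hg : 2 ≤ g) (x : tangentCone g) :
    ∃ (p w : Fin 2 → ℂ) (hp : p ≠ 0) (hw : w ≠ 0), x = conePoint hg hp hw := by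
  obtain ⟨x, hx, p, w, hp, rfl⟩ := x
  refine ⟨p, w, hp, fun hw => hx ?_, rfl⟩
  ext F
  simp [tangentPoint_apply, hw]

/-- Regular functions on the cone over the tangent developable are polynomials in the parameters,
compatibly with local presentations as quotients. -/
theorem exists_paramPoly {g q : ℕ} (hg : 2 ≤ g) {f : tangentCone g → ℂ} (hf : f ∈ sections g q) :
    ∃ φ : ParamPoly, (∀ (p w : Fin 2 → ℂ) (hp : p ≠ 0) (hw : w ≠ 0),
      eval (Sum.elim p w) φ = f (conePoint hg hp hw)) ∧
      ∀ p w : Fin 2 → ℂ, p ≠ 0 → w ≠ 0 → ∃ P Q : SymmetricAlgebra ℂ (Forms g),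
        evalAt (tangentPoint g p w) Q ≠ 0 ∧ φ * pullParam g Q = pullParam g P := by
  have loc : ∀ (p w : Fin 2 → ℂ) (hp : p ≠ 0) (hw : w ≠ 0), ∃ P Q : SymmetricAlgebra ℂ (Forms g),
      evalAt (tangentPoint g p w) Q ≠ 0 ∧ ∀ y : tangentCone g, evalAt y.1 Q ≠ 0 →
        f y = evalAt y.1 P / evalAt y.1 Q := by
    intro p w hp hw
    obtain ⟨d, Q, hQ, P, hP, h1, h2⟩ := hf (conePoint hg hp hw)
    exact ⟨P, Q, h1, h2⟩
  have e0 : (![1, 0] : Fin 2 → ℂ) ≠ 0 := fun h => by simpa using congrFun h 0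
  obtain ⟨P₀, Q₀, hQ₀, h₀⟩ := loc ![1, 0] ![1, 0] e0 e0
  have hQ0 : pullParam g Q₀ ≠ 0 := fun h => hQ₀ (by rw [← eval_pullParam, h, map_zero])
  -- One local quotient is put in lowest terms a / b in the factorial ring of parameters. Every
  -- other local presentation P / Q satisfies P b = Q a, so b divides each pulled-back denominator.
  obtain ⟨a, b, c, hab, ha, hb⟩ :=
    UniqueFactorizationMonoid.exists_reduced_factors' (pullParam g P₀) (pullParam g Q₀) hQ0
  have hc : c ≠ 0 := fun h => hQ0 (by rw [← hb, h, zero_mul])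
  have cross : ∀ P Q : SymmetricAlgebra ℂ (Forms g),
      (∀ y : tangentCone g, evalAt y.1 Q ≠ 0 → f y = evalAt y.1 P / evalAt y.1 Q) →
      pullParam g Q ≠ 0 → pullParam g P * b = pullParam g Q * a := by
    intro P Q h hQ
    have h3 : (pullParam g P * pullParam g Q₀ - pullParam g Q * pullParam g P₀) *
        (pullParam g Q * pullParam g Q₀) = 0 := by
      refine paramPoly_eq_zero fun p w hp hw => ?_
      simp only [map_mul, map_sub, eval_pullParam]
      by_cases h1 : evalAt (tangentPoint g p w) Q = 0
      · rw [h1]; ring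
      by_cases h2 : evalAt (tangentPoint g p w) Q₀ = 0
      · rw [h2]; ring
      have e := (h (conePoint hg hp hw) h1).symm.trans (h₀ (conePoint hg hp hw) h2)
      simp only [conePoint] at e
      rw [div_eq_div_iff h1 h2] at e
      rw [e]; ring
    have h4 := (mul_eq_zero.1 h3).resolve_right (mul_ne_zero hQ hQ0)
    apply mul_left_cancel₀ hc
    rw [← ha, ← hb] at h4
    linear_combination h4
  have ne0 : ∀ (p w : Fin 2 → ℂ) (Q : SymmetricAlgebra ℂ (Forms g)),
      evalAt (tangentPoint g p w) Q ≠ 0 → pullParam g Q ≠ 0 := fun p w Q hQ h =>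
    hQ (by rw [← eval_pullParam, h, map_zero])
  -- Near each point with p, w ≠ 0 some denominator divisible by b does not vanish, so b has no
  -- zeros there and is constant.
  have hbu : ∃ c : ℂ, c ≠ 0 ∧ b = C c := by
    refine paramPoly_eq_C fun p w hp hw hb0 => ?_
    obtain ⟨P, Q, hQ, h⟩ := loc p w hp hw
    have h1 : b ∣ pullParam g Q := hab.symm.dvd_of_dvd_mul_right
      ⟨pullParam g P, by rw [← cross P Q h (ne0 p w Q hQ), mul_comm]⟩
    obtain ⟨r, hr⟩ := h1
    apply hQ
    rw [← eval_pullParam, hr, map_mul, hb0, zero_mul]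
  obtain ⟨k, hk, rfl⟩ := hbu
  have key : ∀ P Q : SymmetricAlgebra ℂ (Forms g),
      (∀ y : tangentCone g, evalAt y.1 Q ≠ 0 → f y = evalAt y.1 P / evalAt y.1 Q) →
      pullParam g Q ≠ 0 → (C k⁻¹ * a) * pullParam g Q = pullParam g P := by
    intro P Q h hQ
    have h1 := cross P Q h hQ
    have h2 : (C k⁻¹ * C k : ParamPoly) = 1 := by rw [← C_mul, inv_mul_cancel₀ hk, C_1]
    linear_combination (-C k⁻¹) * h1 + pullParam g P * h2
  refine ⟨C k⁻¹ * a, fun p w hp hw => ?_, fun p w hp hw => ?_⟩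
  · obtain ⟨P, Q, hQ, h⟩ := loc p w hp hw
    have h1 := congrArg (eval (Sum.elim p w)) (key P Q h (ne0 p w Q hQ))
    rw [map_mul, eval_pullParam, eval_pullParam] at h1
    rw [h (conePoint hg hp hw) hQ]
    exact (eq_div_iff hQ).2 h1
  · obtain ⟨P, Q, hQ, h⟩ := loc p w hp hw
    exact ⟨P, Q, hQ, key P Q h (ne0 p w Q hQ)⟩

/-! ### Directional derivatives, homogeneity, and the sections of degrees zero and one -/

theorem HasDerivAt.unique_of_eq {f h : ℂ → ℂ} {a b z : ℂ} (hf : HasDerivAt f a z)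
    (hh : HasDerivAt h b z) (e : ∀ t, f t = h t) : a = b := by
  rw [show f = h from funext e] at hf
  exact hf.unique hh

theorem hasDerivAt_eval {σ : Type*} [Fintype σ] [DecidableEq σ] (F : MvPolynomial σ ℂ)
    (c : ℂ → σ → ℂ) (c' : σ → ℂ) (z : ℂ) (hc : ∀ s, HasDerivAt (fun t => c t s) (c' s) z) :
    HasDerivAt (fun t => eval (c t) F) (∑ s, c' s * eval (c z) (pderiv s F)) z := by
  induction F using MvPolynomial.induction_on with
  | C a => simpa using hasDerivAt_const z a
  | add F G hF hG =>
    simp only [map_add, mul_add, Finset.sum_add_distrib]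
    exact hF.add hG
  | mul_X F j hF =>
    simp only [map_mul, eval_X]
    refine (hF.mul (hc j)).congr_deriv (Eq.symm ?_)
    simp only [Derivation.leibniz, smul_eq_mul, map_add, map_mul, eval_X, mul_add,
      Finset.sum_add_distrib, pderiv_X, Finset.sum_mul]
    rw [add_comm]
    congr 1
    · exact Finset.sum_congr rfl fun s _ => by ring
    · rw [Finset.sum_eq_single j]
      · simp [mul_comm]
      · intro b _ hb
        simp [hb.symm]
      · simp

theorem eval_smul_of_isHomogeneous {σ : Type*} {F : MvPolynomial σ ℂ} {n : ℕ}
    (hF : F.IsHomogeneous n) (c : ℂ) (v : σ → ℂ) : eval (c • v) F = c ^ n * eval v F := by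
  rw [eval_eq, eval_eq, Finset.mul_sum]
  refine Finset.sum_congr rfl fun s hs => ?_
  have hd := hF (mem_support_iff.1 hs)
  simp only [Pi.smul_apply, smul_eq_mul, mul_pow, Finset.prod_mul_distrib,
    Finset.prod_pow_eq_pow_sum]
  rw [show ∑ i ∈ s.support, s i = n by
    rw [← hd, Finsupp.weight_apply, Finsupp.sum]; simp]
  ring

/-- Scaling by 2 multiplies the coefficients of degree k by 2^k, and these factors are distinct for
distinct k, so a single scalar detects the degree. -/
theorem isHomogeneous_of_eval {σ : Type*} {F : MvPolynomial σ ℂ} {n : ℕ}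
    (h : ∀ v : σ → ℂ, eval ((2 : ℂ) • v) F = 2 ^ n * eval v F) : F.IsHomogeneous n := by
  have hco : ∀ (F : MvPolynomial σ ℂ) (s : σ →₀ ℕ),
      coeff s (aeval (fun i => C (2 : ℂ) * X i) F : MvPolynomial σ ℂ) =
        2 ^ (s.degree) * coeff s F := by
    intro F s
    induction F using MvPolynomial.induction_on' with
    | monomial u a =>
      have : (aeval (fun i => C (2 : ℂ) * X i) (monomial u a) : MvPolynomial σ ℂ) =
          C (2 ^ u.degree) * monomial u a := by
        rw [aeval_monomial, monomial_eq, Finsupp.prod, Finsupp.prod]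
        simp only [mul_pow, Finset.prod_mul_distrib, Finset.prod_pow_eq_pow_sum, map_pow,
          algebraMap_eq, Finsupp.degree_apply]
        ring
      classical
      rw [this, coeff_C_mul, coeff_monomial]
      split_ifs with hu
      · rw [hu]
      · simp
    | add p q hp hq => rw [map_add, coeff_add, hp, hq, coeff_add, mul_add]
  have h1 : (aeval (fun i => C (2 : ℂ) * X i) F : MvPolynomial σ ℂ) = C (2 ^ n) * F := by
    refine MvPolynomial.funext fun v => ?_
    rw [map_mul, eval_C, ← h v]
    have : (aeval v).comp (aeval (fun i => C (2 : ℂ) * X i) :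
        MvPolynomial σ ℂ →ₐ[ℂ] MvPolynomial σ ℂ) = aeval (R := ℂ) ((2 : ℂ) • v) := by
      ext s
      simp
    simpa [aeval_eq_eval] using DFunLike.congr_fun this F
  intro s hs
  have h2 := hco F s
  rw [h1, coeff_C_mul] at h2
  have h3 := mul_right_cancel₀ hs h2
  have h4 : (2 : ℕ) ^ n = 2 ^ s.degree := by exact_mod_cast h3
  have h5 := Nat.pow_right_injective le_rfl h4
  rw [h5, Finsupp.degree_eq_weight_one]
  rfl

theorem evalAt_smul {g d : ℕ} (c : ℂ) (x : Module.Dual ℂ (Forms g))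
    {Q : SymmetricAlgebra ℂ (Forms g)} (hQ : Q ∈ symPow (Forms g) d) :
    evalAt (c • x) Q = c ^ d * evalAt x Q := by
  induction d generalizing Q with
  | zero =>
    obtain ⟨a, rfl⟩ : ∃ a : ℂ, algebraMap ℂ _ a = Q := by
      simpa [symPow, Submodule.mem_one] using hQ
    simp [evalAt]
  | succ d ih =>
    rw [symPow, pow_succ'] at hQ
    induction hQ using Submodule.mul_induction_on' with
    | mem_mul_mem y hy z hz =>
      obtain ⟨v, rfl⟩ := hy
      have h := ih hz
      simp only [evalAt, map_mul, SymmetricAlgebra.lift_ι_apply, LinearMap.smul_apply,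
        smul_eq_mul] at h ⊢
      rw [h]
      ring
    | add y _ z _ hy hz =>
      simp only [evalAt, map_add, mul_add] at hy hz ⊢
      rw [hy, hz]

theorem sections_smul {g q : ℕ} {f : tangentCone g → ℂ} (hf : f ∈ sections g q) {c : ℂ}
    (hc : c ≠ 0) {x y : tangentCone g} (hxy : y.1 = c • x.1) : f y = c ^ q * f x := by
  obtain ⟨d, Q, hQ, P, hP, h1, h2⟩ := hf x
  have h3 : evalAt y.1 Q ≠ 0 := by
    rw [hxy, evalAt_smul c x.1 hQ]
    exact mul_ne_zero (pow_ne_zero _ hc) h1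
  rw [h2 x h1, h2 y h3, hxy, evalAt_smul c x.1 hQ, evalAt_smul c x.1 hP, pow_add]
  field_simp

theorem isHomogeneous_pderiv {F : BinPoly} {g : ℕ} (hF : F.IsHomogeneous g) (i : Fin 2) :
    (pderiv i F).IsHomogeneous (g - 1) :=
  hF.pderiv

theorem tangentPoint_smul (g : ℕ) (a b : ℂ) (p w : Fin 2 → ℂ) :
    tangentPoint g (a • p) (b • w) = (a ^ (g - 1) * b) • tangentPoint g p w := by
  ext F
  simp only [tangentPoint_apply, LinearMap.smul_apply, smul_eq_mul, Pi.smul_apply, Finset.mul_sum]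
  refine Finset.sum_congr rfl fun i _ => ?_
  rw [eval_smul_of_isHomogeneous (isHomogeneous_pderiv F.2 i)]
  ring

/-- Scaling relations hold at all parameters once they hold for nonzero `p` and `w`. -/
theorem paramPoly_scaling {φ : ParamPoly} {a b c : ℂ}
    (h : ∀ p w : Fin 2 → ℂ, p ≠ 0 → w ≠ 0 →
      eval (Sum.elim (a • p) (b • w)) φ = c * eval (Sum.elim p w) φ) (p w : Fin 2 → ℂ) :
    eval (Sum.elim (a • p) (b • w)) φ = c * eval (Sum.elim p w) φ := by
  let ψ : ParamPoly := aeval (Sum.elim (fun i => C a * X (Sum.inl i) : Fin 2 → ParamPoly)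
    (fun i => C b * X (Sum.inr i))) φ
  have hψ : ∀ p w : Fin 2 → ℂ,
      eval (Sum.elim p w) ψ = eval (Sum.elim (a • p) (b • w)) φ := by
    intro p w
    have : (aeval (Sum.elim p w)).comp (aeval (Sum.elim (fun i => C a * X (Sum.inl i) :
        Fin 2 → ParamPoly) (fun i => C b * X (Sum.inr i)))) =
          aeval (R := ℂ) (Sum.elim (a • p) (b • w)) := by
      ext s
      rcases s with s | s <;> simp
    simpa [aeval_eq_eval, ψ] using DFunLike.congr_fun this φ
  have h0 : ψ - C c * φ = 0 := paramPoly_eq_zero fun p w hp hw => by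
    rw [map_sub, hψ, map_mul, eval_C, h p w hp hw, sub_self]
  rw [← hψ, sub_eq_zero.1 h0, map_mul, eval_C]

theorem sections_scaling {g q : ℕ} (hg : 2 ≤ g) {f : tangentCone g → ℂ} (hf : f ∈ sections g q)
    {φ : ParamPoly} (hφ : ∀ (p w : Fin 2 → ℂ) (hp : p ≠ 0) (hw : w ≠ 0),
      eval (Sum.elim p w) φ = f (conePoint hg hp hw)) {a b : ℂ} (ha : a ≠ 0) (hb : b ≠ 0)
    (p w : Fin 2 → ℂ) :
    eval (Sum.elim (a • p) (b • w)) φ = (a ^ (g - 1) * b) ^ q * eval (Sum.elim p w) φ := by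
  refine paramPoly_scaling (fun p w hp hw => ?_) p w
  rw [hφ p w hp hw, hφ _ _ (smul_ne_zero ha hp) (smul_ne_zero hb hw)]
  exact sections_smul hf (mul_ne_zero (pow_ne_zero _ ha) hb) (tangentPoint_smul g a b p w)

/-- Regular functions of degree zero on the tangent developable are constant. -/
theorem sections_zero_const {g : ℕ} (hg : 2 ≤ g) {f : tangentCone g → ℂ} (hf : f ∈ sections g 0) :
    ∃ c : ℂ, f = fun _ => c := by
  obtain ⟨φ, hφ, -⟩ := exists_paramPoly hg hf
  have hom : φ.IsHomogeneous 0 := by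
    refine isHomogeneous_of_eval fun v => ?_
    have h := sections_scaling hg hf hφ two_ne_zero two_ne_zero (v ∘ Sum.inl) (v ∘ Sum.inr)
    rw [pow_zero, one_mul, Sum.elim_comp_inl_inr] at h
    rw [pow_zero, one_mul, ← h]
    congr 1
    congr 1
    ext s
    rcases s with s | s <;> rfl
  have hC := totalDegree_eq_zero_iff_eq_C.1 ((totalDegree_zero_iff_isHomogeneous _).2 hom)
  refine ⟨coeff 0 φ, funext fun x => ?_⟩
  obtain ⟨p, w, hp, hw, rfl⟩ := exists_conePoint hg x
  rw [← hφ, hC]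
  simp

theorem eval_linear_of_isHomogeneous {F : BinPoly} (hF : F.IsHomogeneous 1) :
    ∃ c : Fin 2 → ℂ, ∀ v, eval v F = ∑ i, c i * v i := by
  have h1 : ∀ i, pderiv i F = C (coeff 0 (pderiv i F)) := fun i =>
    totalDegree_eq_zero_iff_eq_C.1 ((totalDegree_zero_iff_isHomogeneous _).2 hF.pderiv)
  refine ⟨fun i => coeff 0 (pderiv i F), fun v => ?_⟩
  have h2 := congrArg (eval v) hF.sum_X_mul_pderiv
  simp only [one_smul, map_sum, map_mul, eval_X] at h2
  rw [← h2]
  refine Finset.sum_congr rfl fun i _ => ?_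
  rw [h1 i, eval_C, mul_comm]

theorem pderiv_comm (i j : Fin 2) (F : BinPoly) :
    pderiv i (pderiv j F) = pderiv j (pderiv i F) := by
  have h : ⁅pderiv (R := ℂ) i, pderiv (R := ℂ) j⁆ = (0 : Derivation ℂ BinPoly BinPoly) := by
    refine MvPolynomial.derivation_ext fun k => ?_
    simp [Derivation.commutator_apply, pderiv_X, Pi.single_apply, apply_ite]
  have h2 := DFunLike.congr_fun h F
  rw [Derivation.commutator_apply] at h2
  exact sub_eq_zero.1 h2

/-- At points of the rational normal curve, the parametrization of the tangent developable
is not immersive. -/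
theorem hasDerivAt_tangentPoint {g : ℕ} (p v : Fin 2 → ℂ) (F : Forms (g + 1)) :
    HasDerivAt (fun z : ℂ => tangentPoint (g + 1) (p + z • v) (p - ((g : ℂ) * z) • v) F) 0 0 := by
  simp only [tangentPoint_apply]
  have hp : ∀ s, HasDerivAt (fun z : ℂ => (p + z • v) s) (v s) 0 := fun s => by
    simpa using ((hasDerivAt_id (0 : ℂ)).mul_const (v s)).const_add (p s)
  have hw : ∀ s, HasDerivAt (fun z : ℂ => (p - ((g : ℂ) * z) • v) s) (-((g : ℂ) * v s)) 0 :=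
    fun s => by
      simpa using (((hasDerivAt_id (0 : ℂ)).const_mul (g : ℂ)).mul_const (v s)).const_sub (p s)
  refine (HasDerivAt.fun_sum fun i _ =>
    (hw i).mul (hasDerivAt_eval (pderiv i F.1) (fun z => p + z • v) v 0 hp)).congr_deriv ?_
  -- Euler's relation for the derivatives of F, which have degree g. The velocity -g v of the second
  -- parameter is chosen so that its contribution cancels the one from moving p.
  have hE : ∀ j, ∑ i, p i * eval p (pderiv j (pderiv i F.1)) = g * eval p (pderiv j F.1) := by
    intro j
    have h1 := congrArg (eval p) (isHomogeneous_pderiv F.2 j).sum_X_mul_pderiv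
    simp only [map_sum, map_mul, eval_X, nsmul_eq_mul, Nat.add_sub_cancel] at h1
    rw [map_natCast] at h1
    rw [← h1]
    exact Finset.sum_congr rfl fun i _ => by rw [pderiv_comm]
  have h0 := hE 0
  have h1 := hE 1
  simp only [Fin.sum_univ_two] at h0 h1 ⊢
  simp only [zero_smul, mul_zero, add_zero, sub_zero]
  linear_combination v 0 * h0 + v 1 * h1

theorem hasDerivAt_evalAt {g : ℕ} (x : ℂ → Module.Dual ℂ (Forms g))
    (h : ∀ F, HasDerivAt (fun z => x z F) 0 0) (Q : SymmetricAlgebra ℂ (Forms g)) :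
    HasDerivAt (fun z => evalAt (x z) Q) 0 0 := by
  induction Q using SymmetricAlgebra.induction with
  | algebraMap r => simpa [evalAt] using hasDerivAt_const (0 : ℂ) r
  | ι F => simpa [evalAt] using h F
  | mul a b ha hb =>
    simp only [evalAt, map_mul] at ha hb ⊢
    exact (ha.mul hb).congr_deriv (by ring)
  | add a b ha hb =>
    simp only [evalAt, map_add] at ha hb ⊢
    exact (ha.add hb).congr_deriv (by ring)

/-- Regular functions of degree one on the tangent developable are linear forms. -/
theorem sections_one_linear {g : ℕ} (hg : 2 ≤ g) {f : tangentCone g → ℂ} (hf : f ∈ sections g 1) :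
    ∃ v : Forms g, f = fun x => x.1 v := by
  obtain ⟨φ, hφ, hloc⟩ := exists_paramPoly hg hf
  obtain ⟨d, rfl⟩ := Nat.exists_eq_add_of_le' (Nat.one_le_of_lt hg)
  -- the restriction to the diagonal
  let G : BinPoly := C (((d : ℂ) + 1)⁻¹) * aeval (Sum.elim X X) φ
  have hd : (d : ℂ) + 1 ≠ 0 := by norm_cast
  have hGev : ∀ p, eval p G = ((d : ℂ) + 1)⁻¹ * eval (Sum.elim p p) φ := by
    intro p
    have : (aeval p).comp (aeval (Sum.elim X X : Fin 2 ⊕ Fin 2 → BinPoly)) =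
        aeval (R := ℂ) (Sum.elim p p) := by
      ext s
      rcases s with s | s <;> simp
    have h2 := DFunLike.congr_fun this φ
    simp only [G, map_mul, eval_C]
    congr 1
  have hGhom : G.IsHomogeneous (d + 1) := by
    refine isHomogeneous_of_eval fun p => ?_
    rw [hGev, hGev, sections_scaling hg hf hφ two_ne_zero two_ne_zero]
    simp only [Nat.add_sub_cancel]
    ring
  -- linearity in the direction
  have hlin : ∀ p, ∃ c : Fin 2 → ℂ, ∀ w, eval (Sum.elim p w) φ = ∑ i, c i * w i := by
    intro p
    let ψ : BinPoly := aeval (Sum.elim (fun i => C (p i)) X) φ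
    have hψ : ∀ w, eval w ψ = eval (Sum.elim p w) φ := by
      intro w
      have : (aeval w).comp (aeval (Sum.elim (fun i => C (p i)) X : Fin 2 ⊕ Fin 2 → BinPoly)) =
          aeval (R := ℂ) (Sum.elim p w) := by
        ext s
        rcases s with s | s <;> simp
      simpa [aeval_eq_eval, ψ] using DFunLike.congr_fun this φ
    have hom : ψ.IsHomogeneous 1 := isHomogeneous_of_eval fun w => by
      have h := sections_scaling hg hf hφ one_ne_zero two_ne_zero p w
      rw [hψ, hψ]
      simpa using h
    obtain ⟨c, hc⟩ := eval_linear_of_isHomogeneous hom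
    exact ⟨c, fun w => by rw [← hψ, hc]⟩
  refine ⟨⟨G, hGhom⟩, funext fun x => ?_⟩
  obtain ⟨p, w, hp, hw, rfl⟩ := exists_conePoint hg x
  rw [← hφ p w hp hw]
  change _ = tangentPoint (d + 1) p w _
  rw [tangentPoint_apply]
  -- three directional derivatives at `(p, p)`
  set Dp := ∑ j, w j * eval (Sum.elim p p) (pderiv (Sum.inl j) φ) with hDp
  set Dw := ∑ j, w j * eval (Sum.elim p p) (pderiv (Sum.inr j) φ) with hDw
  have curve : ∀ a b : ℂ, HasDerivAt
      (fun z : ℂ => eval (Sum.elim (p + (a * z) • w) (p + (b * z) • w)) φ) (a * Dp + b * Dw) 0 := by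
    intro a b
    have hc : ∀ (a : ℂ) s, HasDerivAt (fun z : ℂ => (p + (a * z) • w) s) (a * w s) 0 :=
      fun a s => by
      simpa using (((hasDerivAt_id (0 : ℂ)).const_mul a).mul_const (w s)).const_add (p s)
    refine (hasDerivAt_eval φ (fun z => Sum.elim (p + (a * z) • w) (p + (b * z) • w))
      (Sum.elim (fun s => a * w s) (fun s => b * w s)) 0 ?_).congr_deriv ?_
    · rintro (s | s)
      · exact hc a s
      · exact hc b s
    · simp [Fintype.sum_sum_type, hDp, hDw]
      ring
  -- For fixed p the polynomial φ is linear in w, so its derivative in the direction w is its value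
  -- at w.
  have e1 : Dw = eval (Sum.elim p w) φ := by
    obtain ⟨c, hc⟩ := hlin p
    have h1 := curve 0 1
    have h2 : HasDerivAt (fun z : ℂ => ∑ i, c i * p i + z * ∑ i, c i * w i)
        (∑ i, c i * w i) 0 := by
      simpa using ((hasDerivAt_id (0 : ℂ)).mul_const (∑ i, c i * w i)).const_add (∑ i, c i * p i)
    have h3 := HasDerivAt.unique_of_eq h1 h2 fun z => by
      simp only [hc, zero_mul, zero_smul, add_zero, one_mul, Fin.sum_univ_two, Pi.add_apply,
        Pi.smul_apply, smul_eq_mul]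
      ring
    rw [hc w, ← h3]
    ring
  -- The point with parameters (p, p) is (d + 1) times evaluation at p, so φ(p, p) must be (d + 1)
  -- times the sought form at p; this explains the normalization of `G`. The identity is
  -- differentiated along the diagonal.
  have e2 : Dp + Dw = (d + 1) * ∑ j, w j * eval p (pderiv j G) := by
    have h1 := curve 1 1
    have h2 : HasDerivAt (fun z : ℂ => ((d : ℂ) + 1) * eval (p + z • w) G)
        ((d + 1) * ∑ j, w j * eval p (pderiv j G)) 0 := by
      have := hasDerivAt_eval G (fun z : ℂ => p + z • w) w 0 (fun s => by
        simpa using ((hasDerivAt_id (0 : ℂ)).mul_const (w s)).const_add (p s))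
      simpa using this.const_mul ((d : ℂ) + 1)
    rw [← HasDerivAt.unique_of_eq h1 h2 fun z => by
      rw [hGev, mul_inv_cancel_left₀ hd, one_mul]]
    ring
  -- Here the cuspidal singularity enters. Pull-backs of polynomials on projective space have zero
  -- derivative in the direction (w, -d w) at (p, p). Since φ Q = P with Q nonzero at that point, φ
  -- has zero derivative too. With `e1` and `e2` this gives φ(p, w) = Σ w_j ∂_j G(p).
  have e3 : Dp - d * Dw = 0 := by
    obtain ⟨P, Q, hQ, hPQ⟩ := hloc p p hp hp
    have h1 := curve 1 (-d)
    have hx := hasDerivAt_evalAt (fun z : ℂ => tangentPoint (d + 1) (p + z • w)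
      (p - ((d : ℂ) * z) • w))
      (hasDerivAt_tangentPoint p w)
    have h2 := h1.mul (hx Q)
    have h4 := HasDerivAt.unique_of_eq h2 (hx P) fun z => by
      rw [Pi.mul_apply, ← eval_pullParam, ← eval_pullParam, ← hPQ, map_mul, one_mul, neg_mul,
        neg_smul, ← sub_eq_add_neg]
    simp only [zero_smul, mul_zero, add_zero, sub_zero, mul_eq_zero, hQ, or_false] at h4
    linear_combination h4
  have e4 : (d + 1) * ∑ j, w j * eval p (pderiv j G) = (d + 1) * eval (Sum.elim p w) φ := by
    linear_combination e3 - e2 + (d + 1) * e1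
  exact (mul_left_cancel₀ hd e4).symm

/-! ## Pairings with exterior powers and tensor products -/

section Pairings

variable {V M N A B : Type*} [AddCommGroup V] [Module ℂ V] [AddCommGroup M] [Module ℂ M]
  [AddCommGroup N] [Module ℂ N] [AddCommGroup A] [Module ℂ A] [AddCommGroup B] [Module ℂ B]

/-- The linear form `φ₁ ∧ ⋯ ∧ φ_p` on `Λ^p V`. -/
def wedgePair {p : ℕ} (φ : Fin p → Module.Dual ℂ V) : Module.Dual ℂ (⋀[ℂ]^p V) :=
  exteriorPower.pairingDual ℂ V p (exteriorPower.ιMulti ℂ p φ)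

theorem wedgePair_ιMulti {p : ℕ} (φ : Fin p → Module.Dual ℂ V) (v : Fin p → V) :
    wedgePair φ (exteriorPower.ιMulti ℂ p v) = Matrix.det (.of fun i j => φ j (v i)) :=
  exteriorPower.pairingDual_ιMulti_ιMulti φ v

theorem wedgePair_cons {p : ℕ} (ψ : Module.Dual ℂ V) (φ : Fin p → Module.Dual ℂ V)
    (v : Fin (p + 1) → V) :
    wedgePair (Fin.cons ψ φ) (exteriorPower.ιMulti ℂ (p + 1) v) =
      ∑ k : Fin (p + 1), (-1) ^ (k : ℕ) * ψ (v k) *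
        wedgePair φ (exteriorPower.ιMulti ℂ p fun j => v (k.succAbove j)) := by
  rw [wedgePair_ιMulti, Matrix.det_succ_column_zero]
  refine Finset.sum_congr rfl fun k _ => ?_
  rw [wedgePair_ιMulti]
  rfl

theorem wedgePair_map {p : ℕ} (φ : Fin p → Module.Dual ℂ V) (f : V →ₗ[ℂ] V) (x : ⋀[ℂ]^p V) :
    wedgePair φ (exteriorPower.map p f x) = wedgePair (fun j => φ j ∘ₗ f) x := by
  suffices h : wedgePair φ ∘ₗ exteriorPower.map p f = wedgePair (fun j => φ j ∘ₗ f) from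
    LinearMap.congr_fun h x
  ext v
  simp [wedgePair_ιMulti]

/-- The linear form `α ⊗ β` on `A ⊗ B`. -/
def tensorPair (α : Module.Dual ℂ A) (β : Module.Dual ℂ B) : Module.Dual ℂ (A ⊗[ℂ] B) :=
  TensorProduct.dualDistrib ℂ A B (α ⊗ₜ β)

@[simp]
theorem tensorPair_tmul (α : Module.Dual ℂ A) (β : Module.Dual ℂ B) (a : A) (b : B) :
    tensorPair α β (a ⊗ₜ b) = α a * β b :=
  TensorProduct.dualDistrib_apply α β a b

theorem tensorPair_map (α : Module.Dual ℂ A) (β : Module.Dual ℂ B) {A' B' : Type*}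
    [AddCommGroup A'] [Module ℂ A'] [AddCommGroup B'] [Module ℂ B'] (f : A' →ₗ[ℂ] A)
    (h : B' →ₗ[ℂ] B) (x : A' ⊗[ℂ] B') :
    tensorPair α β (TensorProduct.map f h x) = tensorPair (α ∘ₗ f) (β ∘ₗ h) x := by
  suffices e : tensorPair α β ∘ₗ TensorProduct.map f h = tensorPair (α ∘ₗ f) (β ∘ₗ h) from
    LinearMap.congr_fun e x
  ext a b
  simp

theorem tensorPair_eq (α : Module.Dual ℂ A) (β : Module.Dual ℂ B) (x : A ⊗[ℂ] B) :
    tensorPair α β x = β (TensorProduct.lid ℂ B (α.rTensor B x)) := by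
  suffices e : tensorPair α β = β ∘ₗ (TensorProduct.lid ℂ B).toLinearMap ∘ₗ α.rTensor B from
    LinearMap.congr_fun e x
  ext a b
  simp

/-- Linear forms on the left factor of a tensor product separate its elements. -/
theorem eq_zero_of_rTensor [FiniteDimensional ℂ A] {x : A ⊗[ℂ] B}
    (h : ∀ α : Module.Dual ℂ A, TensorProduct.lid ℂ B (α.rTensor B x) = 0) : x = 0 := by
  let b := Module.finBasis ℂ A
  have e : (∑ k, TensorProduct.mk ℂ A B (b k) ∘ₗ (TensorProduct.lid ℂ B).toLinearMap ∘ₗ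
      (b.coord k).rTensor B) = LinearMap.id := by
    ext a c
    simp only [TensorProduct.AlgebraTensorModule.curry_apply, TensorProduct.curry_apply,
      LinearMap.restrictScalars_self, LinearMap.coe_sum, Finset.sum_apply, LinearMap.comp_apply,
      LinearMap.rTensor_tmul, LinearEquiv.coe_coe, TensorProduct.lid_tmul, TensorProduct.mk_apply,
      LinearMap.id_apply, TensorProduct.tmul_smul, TensorProduct.smul_tmul']
    rw [← TensorProduct.sum_tmul]
    congr 1
    exact b.sum_repr a
  rw [← LinearMap.id_apply (R := ℂ) x, ← e]
  simp [LinearMap.sum_apply, h]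

theorem eq_zero_of_tensorPair [FiniteDimensional ℂ A] {S : Set (Module.Dual ℂ A)}
    (hS : Submodule.span ℂ S = ⊤) {Y : Set (Module.Dual ℂ B)}
    (hY : ∀ b : B, (∀ y ∈ Y, y b = 0) → b = 0) {x : A ⊗[ℂ] B}
    (h : ∀ α ∈ S, ∀ y ∈ Y, tensorPair α y x = 0) : x = 0 := by
  refine eq_zero_of_rTensor fun α => hY _ fun y hy => ?_
  rw [← tensorPair_eq]
  have hα : α ∈ Submodule.span ℂ S := hS ▸ Submodule.mem_top
  induction hα using Submodule.span_induction with
  | mem α hα => exact h α hα y hy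
  | zero => simp [tensorPair]
  | add a b _ _ ha hb =>
    simp only [tensorPair, TensorProduct.add_tmul, map_add, LinearMap.add_apply] at ha hb ⊢
    rw [ha, hb, add_zero]
  | smul c a _ ha =>
    simp only [tensorPair, ← TensorProduct.smul_tmul', map_smul, LinearMap.smul_apply] at ha ⊢
    rw [ha, smul_zero]

theorem span_eq_top_of_separating [FiniteDimensional ℂ V] {S : Set (Module.Dual ℂ V)}
    (hS : ∀ v : V, (∀ φ ∈ S, φ v = 0) → v = 0) : Submodule.span ℂ S = ⊤ := by
  by_contra hne
  obtain ⟨f, hf, hle⟩ := Submodule.exists_le_ker_of_lt_top _ (lt_top_iff_ne_top.2 hne)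
  apply hf
  have h := hS ((Module.evalEquiv ℂ V).symm f) fun φ hφ => by
    rw [Module.apply_evalEquiv_symm_apply]
    exact hle (Submodule.subset_span hφ)
  exact (LinearEquiv.map_eq_zero_iff _).1 h

theorem pairingDual_surjective [FiniteDimensional ℂ V] (n : ℕ) :
    Function.Surjective (exteriorPower.pairingDual ℂ V n) := by
  refine (LinearMap.injective_iff_surjective_of_finrank_eq_finrank ?_).1
    (pairingDual_injective V n)
  rw [Subspace.dual_finrank_eq, exteriorPower.finrank_eq, exteriorPower.finrank_eq,
    Subspace.dual_finrank_eq]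

theorem span_wedgePair [FiniteDimensional ℂ V] {S : Set (Module.Dual ℂ V)}
    (hS : Submodule.span ℂ S = ⊤) (p : ℕ) :
    Submodule.span ℂ {α | ∃ φ : Fin p → Module.Dual ℂ V, (∀ j, φ j ∈ S) ∧ α = wedgePair φ} = ⊤ := by
  rw [← LinearMap.range_eq_top.2 (pairingDual_surjective (V := V) p), LinearMap.range_eq_map,
    ← exteriorPower.ιMulti_span_of_span ℂ p _ hS, Submodule.map_span]
  congr 1
  ext α
  constructor
  · rintro ⟨φ, hφ, rfl⟩
    exact ⟨_, ⟨φ, Set.range_subset_iff.2 hφ, rfl⟩, rfl⟩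
  · rintro ⟨_, ⟨φ, hφ, rfl⟩, rfl⟩
    exact ⟨φ, Set.range_subset_iff.1 hφ, rfl⟩

/-- Evaluation of a Koszul differential at points where multiplication is multiplication of
values. -/
theorem tensorPair_koszulD (μ : V →ₗ[ℂ] M →ₗ[ℂ] N) {p : ℕ} (φ : Fin p → Module.Dual ℂ V)
    {y : Module.Dual ℂ N} {ψ : Module.Dual ℂ V} {χ : Module.Dual ℂ M}
    (h : ∀ v m, y (μ v m) = ψ v * χ m) (x : (⋀[ℂ]^(p + 1) V) ⊗[ℂ] M) :
    tensorPair (wedgePair φ) y (koszulD μ p x) =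
      tensorPair (wedgePair (Fin.cons ψ φ)) χ x := by
  suffices e : tensorPair (wedgePair φ) y ∘ₗ koszulD μ p =
      tensorPair (wedgePair (Fin.cons ψ φ)) χ from LinearMap.congr_fun e x
  refine TensorProduct.ext ?_
  refine exteriorPower.linearMap_ext ?_
  ext v m
  change tensorPair (wedgePair φ) y (koszulD μ p (exteriorPower.ιMulti ℂ (p + 1) v ⊗ₜ m)) =
    tensorPair (wedgePair (Fin.cons ψ φ)) χ (exteriorPower.ιMulti ℂ (p + 1) v ⊗ₜ m)
  rw [koszulD_ιMulti, tensorPair_tmul, wedgePair_cons, map_sum, Finset.sum_mul]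
  refine Finset.sum_congr rfl fun k _ => ?_
  rw [map_zsmul, tensorPair_tmul, h]
  simp only [zsmul_eq_mul, Int.cast_pow, Int.cast_neg, Int.cast_one]
  ring

/-- The value of `ω ∈ Λ^p V ⊗ V` at linear forms: the form `φ 0` is applied to the factor `V`,
and the exterior product of the others to `Λ^p V`. -/
def wedgeEval {p : ℕ} (ω : (⋀[ℂ]^p V) ⊗[ℂ] V) (φ : Fin (p + 1) → Module.Dual ℂ V) : ℂ :=
  tensorPair (wedgePair (Fin.tail φ)) (φ 0) ω

theorem wedgeEval_cons {p : ℕ} (ω : (⋀[ℂ]^p V) ⊗[ℂ] V) (ψ : Module.Dual ℂ V)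
    (φ : Fin p → Module.Dual ℂ V) :
    wedgeEval ω (Fin.cons ψ φ) = tensorPair (wedgePair φ) ψ ω := by
  simp [wedgeEval]

theorem wedgeEval_map {p : ℕ} (f : V →ₗ[ℂ] V) (ω : (⋀[ℂ]^p V) ⊗[ℂ] V)
    (φ : Fin (p + 1) → Module.Dual ℂ V) :
    wedgeEval (TensorProduct.map (exteriorPower.map p f) f ω) φ =
      wedgeEval ω fun j => φ j ∘ₗ f := by
  rw [wedgeEval, tensorPair_map, wedgeEval]
  congr 2
  exact LinearMap.ext fun x => wedgePair_map _ f x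

/-- `wedgeEval` as a linear form in the first argument, with values in alternating maps of the
others. -/
def wedgeEvalAlt {p : ℕ} (ω : (⋀[ℂ]^p V) ⊗[ℂ] V) :
    Module.Dual ℂ V →ₗ[ℂ] (Module.Dual ℂ V) [⋀^Fin p]→ₗ[ℂ] ℂ where
  toFun y := ((LinearMap.applyₗ ω ∘ₗ TensorProduct.dualDistrib ℂ _ _ ∘ₗ
    (TensorProduct.mk ℂ _ _).flip y) ∘ₗ
      exteriorPower.pairingDual ℂ V p).compAlternatingMap (exteriorPower.ιMulti ℂ p)
  map_add' y z := by
    ext φ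
    simp
  map_smul' c y := by
    ext φ
    simp

theorem wedgeEvalAlt_apply {p : ℕ} (ω : (⋀[ℂ]^p V) ⊗[ℂ] V) (ψ : Module.Dual ℂ V)
    (φ : Fin p → Module.Dual ℂ V) : wedgeEvalAlt ω ψ φ = wedgeEval ω (Fin.cons ψ φ) := by
  rw [wedgeEval_cons]
  rfl

/-- This is the Laplace expansion of a determinant along the column belonging to `φ 0`. -/
theorem wedgeEval_wedgeComul {p : ℕ} (η : ⋀[ℂ]^(p + 1) V) (φ : Fin (p + 1) → Module.Dual ℂ V) :
    wedgeEval (wedgeComul V p η) φ = wedgePair φ η := by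
  suffices e : tensorPair (wedgePair (Fin.tail φ)) (φ 0) ∘ₗ wedgeComul V p = wedgePair φ from
    LinearMap.congr_fun e η
  refine exteriorPower.linearMap_ext ?_
  ext v
  simp only [LinearMap.compAlternatingMap_apply, LinearMap.comp_apply, wedgeComul_ιMulti]
  conv_rhs => rw [← Fin.cons_self_tail φ, wedgePair_cons]
  simp only [map_sum, map_zsmul, tensorPair_tmul, zsmul_eq_mul, Int.cast_pow, Int.cast_neg,
    Int.cast_one]
  exact Finset.sum_congr rfl fun k _ => by ring

/-- The determinant pairing of Λ^n V* with Λ^n V is perfect, so alternating forms on V* are elements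
of Λ^n V. -/
theorem exists_wedgePair_eq [FiniteDimensional ℂ V] {n : ℕ}
    (f : (Module.Dual ℂ V) [⋀^Fin n]→ₗ[ℂ] ℂ) : ∃ η : ⋀[ℂ]^n V, ∀ φ, wedgePair φ η = f φ := by
  let e := LinearEquiv.ofBijective (exteriorPower.pairingDual ℂ V n)
    ⟨pairingDual_injective V n, pairingDual_surjective n⟩
  let F : Module.Dual ℂ (Module.Dual ℂ (⋀[ℂ]^n V)) :=
    exteriorPower.alternatingMapLinearEquiv f ∘ₗ e.symm.toLinearMap
  refine ⟨(Module.evalEquiv ℂ _).symm F, fun φ => ?_⟩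
  rw [Module.apply_evalEquiv_symm_apply]
  have : wedgePair φ = e (exteriorPower.ιMulti ℂ n φ) := rfl
  simp [F, this]

end Pairings

/-! ## Functions which are antisymmetric in all arguments -/

/-- Adjacent transpositions generate the symmetric group. -/
theorem antisymmetric_of_swap {T : Type*} {n : ℕ} {H : (Fin (n + 1) → T) → ℂ}
    (h : ∀ (i : Fin n) x, H (x ∘ Equiv.swap i.castSucc i.succ) = -H x)
    (π : Equiv.Perm (Fin (n + 1))) (x : Fin (n + 1) → T) :
    H (x ∘ π) = (Equiv.Perm.sign π : ℤ) * H x := by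
  have hπ : π ∈ Submonoid.closure (Set.range fun i : Fin n => Equiv.swap i.castSucc i.succ) := by
    rw [Equiv.Perm.mclosure_swap_castSucc_succ]
    exact Submonoid.mem_top π
  induction hπ using Submonoid.closure_induction generalizing x with
  | mem π hπ =>
    obtain ⟨i, rfl⟩ := hπ
    rw [h, Equiv.Perm.sign_swap (Fin.castSucc_lt_succ).ne]
    simp
  | one => simp
  | mul π ρ _ _ h₁ h₂ =>
    rw [Equiv.Perm.coe_mul, ← Function.comp_assoc, h₂, h₁, Equiv.Perm.sign_mul]
    push_cast
    ring

section Pairings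

variable {V : Type*} [AddCommGroup V] [Module ℂ V]

theorem wedgeEval_swap {p : ℕ} (ω : (⋀[ℂ]^p V) ⊗[ℂ] V) {i j : Fin (p + 1)} (hi : i ≠ 0)
    (hj : j ≠ 0) (hij : i ≠ j) (φ : Fin (p + 1) → Module.Dual ℂ V) :
    wedgeEval ω (φ ∘ Equiv.swap i j) = -wedgeEval ω φ := by
  obtain ⟨i, rfl⟩ := Fin.exists_succ_eq.2 hi
  obtain ⟨j, rfl⟩ := Fin.exists_succ_eq.2 hj
  have hij' : i ≠ j := fun h => hij (by rw [h])
  have h := (wedgeEvalAlt ω (φ 0)).map_swap (Fin.tail φ) hij'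
  rw [wedgeEvalAlt_apply, wedgeEvalAlt_apply, Fin.cons_self_tail] at h
  rw [← h]
  congr 1
  funext k
  refine Fin.cases ?_ (fun k => ?_) k
  · rw [Function.comp_apply, Equiv.swap_apply_of_ne_of_ne (Fin.succ_ne_zero i).symm
      (Fin.succ_ne_zero j).symm, Fin.cons_zero]
  · rw [Function.comp_apply, Fin.cons_succ, Function.comp_apply, Fin.tail]
    congr 1
    exact ((Fin.succ_injective p).swap_apply i j k)

/-- An element of `Λ^{m+1} V ⊗ V` comes from `Λ^{m+2} V` as soon as its values at tuples from a
spanning set of linear forms are antisymmetric in the first two arguments. -/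
theorem mem_range_wedgeComul [FiniteDimensional ℂ V] {ι : Type*} {ev : ι → Module.Dual ℂ V}
    (hev : Submodule.span ℂ (Set.range ev) = ⊤) {m : ℕ} {ω : (⋀[ℂ]^(m + 1) V) ⊗[ℂ] V}
    (h : ∀ p : Fin (m + 2) → ι,
      wedgeEval ω (fun j => ev (p (Equiv.swap 0 1 j))) = -wedgeEval ω (fun j => ev (p j))) :
    ω ∈ LinearMap.range (wedgeComul V (m + 1)) := by
  -- The candidate preimage is the alternatization of ω. Since ω is already antisymmetric, its m + 2
  -- summands turn out to be equal, whence the factor (m + 2)⁻¹ below.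
  obtain ⟨η, hη⟩ := exists_wedgePair_eq (AlternatingMap.alternatizeUncurryFin (wedgeEvalAlt ω))
  have hanti := antisymmetric_of_swap (H := fun p : Fin (m + 2) → ι =>
    wedgeEval ω (fun j => ev (p j))) (by
      intro i p
      refine Fin.cases ?_ (fun i => ?_) i
      · exact h p
      · exact wedgeEval_swap ω (by simp [Fin.ext_iff]) (by simp [Fin.ext_iff])
          (Fin.castSucc_lt_succ).ne (fun j => ev (p j)))
  have hc : ((m : ℂ) + 2) ≠ 0 := by norm_cast
  refine ⟨((m : ℂ) + 2)⁻¹ • η, ?_⟩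
  rw [← sub_eq_zero]
  refine eq_zero_of_tensorPair (span_wedgePair hev (m + 1)) (Y := Set.range ev) (fun v hv => ?_) ?_
  · rw [← Module.forall_dual_apply_eq_zero_iff ℂ v]
    intro φ
    have hφ : φ ∈ Submodule.span ℂ (Set.range ev) := hev ▸ Submodule.mem_top
    induction hφ using Submodule.span_induction with
    | mem α hα => exact hv α hα
    | zero => simp
    | add a b _ _ ha hb => simp [ha, hb]
    | smul c a _ ha => simp [ha]
  · rintro _ ⟨φ, hφ, rfl⟩ _ ⟨q, rfl⟩
    choose p hp using hφ
    obtain rfl : φ = fun j => ev (p j) := funext fun j => (hp j).symm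
    have e : (fun j => ev (Fin.cons (α := fun _ => ι) q p j)) =
        Fin.cons (α := fun _ => Module.Dual ℂ V) (ev q) (fun j => ev (p j)) := by
      funext j
      refine Fin.cases rfl (fun j => rfl) j
    rw [map_sub, ← wedgeEval_cons, ← wedgeEval_cons, ← e, wedgeEval_wedgeComul, map_smul, hη,
      AlternatingMap.alternatizeUncurryFin_apply, sub_eq_zero]
    -- Moving the k-th argument to the front is an inverse cycle of sign (-1)^k, which cancels the
    -- sign in the alternatization.
    have hk : ∀ k : Fin (m + 2), ((-1 : ℤ) ^ (k : ℕ)) • (wedgeEvalAlt ω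
        (ev (Fin.cons (α := fun _ => ι) q p k)))
          (k.removeNth fun j => ev (Fin.cons (α := fun _ => ι) q p j)) =
        wedgeEval ω (fun j => ev (Fin.cons (α := fun _ => ι) q p j)) := by
      intro k
      have h1 := hanti (Fin.cycleRange k).symm (Fin.cons (α := fun _ => ι) q p)
      rw [wedgeEvalAlt_apply]
      have e2 : (Fin.cons (α := fun _ => Module.Dual ℂ V)
          (ev (Fin.cons (α := fun _ => ι) q p k))
          (k.removeNth fun j => ev (Fin.cons (α := fun _ => ι) q p j)) :
            Fin (m + 2) → Module.Dual ℂ V) =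
          fun j => ev ((Fin.cons (α := fun _ => ι) q p ∘ (Fin.cycleRange k).symm) j) := by
        funext j
        refine Fin.cases ?_ (fun j => ?_) j
        · simp
        · simp [Fin.removeNth]
      rw [e2, h1, Equiv.Perm.sign_symm, Fin.sign_cycleRange]
      simp only [Units.val_pow_eq_pow_val, Units.val_neg, Units.val_one, zsmul_eq_mul,
        Int.cast_pow, Int.cast_neg, Int.cast_one]
      rw [← mul_assoc, ← pow_add, ← two_mul, pow_mul, neg_one_sq, one_pow, one_mul]
    rw [Finset.sum_congr rfl fun k _ => hk k, Finset.sum_const, Finset.card_univ, Fintype.card_fin,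
      nsmul_eq_mul, smul_eq_mul]
    push_cast
    rw [inv_mul_cancel_left₀ hc]

end Pairings

/-! ## Koszul cycles and boundaries on the tangent developable -/

/-- Evaluation of binary forms at a point. -/
def evForm (n : ℕ) (p : Fin 2 → ℂ) : Module.Dual ℂ (Forms n) :=
  (aeval p).toLinearMap ∘ₗ (Forms n).subtype

theorem evForm_apply (n : ℕ) (p : Fin 2 → ℂ) (F : Forms n) : evForm n p F = eval p F.1 := by
  simp [evForm, aeval_eq_eval]

theorem evForm_comp (n : ℕ) (p : Fin 2 → ℂ) (A : SL2) :
    evForm n p ∘ₗ formAct A n = evForm n (Matrix.vecMul p A.1) :=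
  LinearMap.ext fun F => eval_binSubst A p F.1

theorem forms_eq_zero {n : ℕ} {F : Forms n} (h : ∀ p, evForm n p F = 0) : F = 0 :=
  Subtype.ext (MvPolynomial.funext fun p => by simpa [evForm_apply] using h p)

theorem span_evForm (n : ℕ) : Submodule.span ℂ (Set.range (evForm n)) = ⊤ :=
  span_eq_top_of_separating fun _ hv => forms_eq_zero fun p => hv _ ⟨p, rfl⟩

theorem tangentPoint_self (g : ℕ) (p : Fin 2 → ℂ) : tangentPoint g p p = (g : ℂ) • evForm g p := by
  ext F
  have h := congrArg (eval p) (F.2 : F.1.IsHomogeneous g).sum_X_mul_pderiv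
  simp only [map_sum, map_mul, eval_X, nsmul_eq_mul, map_natCast] at h
  rw [tangentPoint_apply, LinearMap.smul_apply, evForm_apply, smul_eq_mul, h]

theorem const_mem_sections (g : ℕ) (c : ℂ) : (fun _ => c) ∈ sections g 0 := fun x =>
  ⟨0, 1, by simp [symPow, Submodule.one_le.1 le_rfl], algebraMap ℂ _ c, by
    simp [symPow, Submodule.mem_one], by simp [evalAt], by simp [evalAt]⟩

/-- Linear forms on `ℙ^g` as sections of `𝒪_T(1)`. -/
def linSection (g : ℕ) : Forms g →ₗ[ℂ] sections g 1 :=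
  (sectionsMul g 0).flip ⟨fun _ => 1, const_mem_sections g 1⟩

theorem linSection_apply {g : ℕ} (v : Forms g) (x : tangentCone g) :
    (linSection g v).1 x = x.1 v :=
  mul_one _

/-- Injectivity: at (p, p) the parametrization gives g times evaluation at p, so a linear form
vanishing on T is a binary form without nonzero values. Surjectivity is `sections_one_linear`. -/
theorem linSection_bijective {g : ℕ} (hg : 2 ≤ g) : Function.Bijective (linSection g) := by
  constructor
  · rw [injective_iff_map_eq_zero]
    intro v hv
    refine forms_eq_zero fun p => ?_
    have h1 : ∀ p : Fin 2 → ℂ, p ≠ 0 → evForm g p v = 0 := by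
      intro p hp
      have h := congrFun (congrArg Subtype.val hv) (conePoint hg hp hp)
      rw [linSection_apply] at h
      change tangentPoint g p p v = 0 at h
      rw [tangentPoint_self, LinearMap.smul_apply, smul_eq_mul] at h
      exact (mul_eq_zero.1 h).resolve_left (by norm_cast; omega)
    by_cases hp : p = 0
    · subst hp
      have h2 := eval_smul_of_isHomogeneous (v.2 : v.1.IsHomogeneous g) 0 ![1, 0]
      rw [zero_smul, zero_pow (by omega), zero_mul] at h2
      rw [evForm_apply, h2]
    · exact h1 p hp
  · rintro ⟨f, hf⟩
    obtain ⟨v, rfl⟩ := sections_one_linear hg hf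
    exact ⟨v, Subtype.ext (funext fun x => linSection_apply v x)⟩

/-- The identification of `V` with `H⁰(T, 𝒪_T(1))`. -/
def linEquiv {g : ℕ} (hg : 2 ≤ g) : Forms g ≃ₗ[ℂ] sections g 1 :=
  LinearEquiv.ofBijective (linSection g) (linSection_bijective hg)

/-- The identification of `Λ^i V ⊗ V` with `Λ^i V ⊗ H⁰(T, 𝒪_T(1))`. -/
def wedgeLinEquiv {g : ℕ} (hg : 2 ≤ g) (i : ℕ) :
    (⋀[ℂ]^i (Forms g)) ⊗[ℂ] Forms g ≃ₗ[ℂ] (⋀[ℂ]^i (Forms g)) ⊗[ℂ] sections g 1 :=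
  (linEquiv hg).lTensor _

theorem wedgeLinEquiv_apply {g : ℕ} (hg : 2 ≤ g) (i : ℕ)
    (ω : (⋀[ℂ]^i (Forms g)) ⊗[ℂ] Forms g) :
    wedgeLinEquiv hg i ω = (linSection g).lTensor (⋀[ℂ]^i (Forms g)) ω := rfl

theorem wedgeLinEquiv_map {g : ℕ} (hg : 2 ≤ g) (i : ℕ) (A : SL2)
    (ω : (⋀[ℂ]^i (Forms g)) ⊗[ℂ] Forms g) :
    TensorProduct.map (exteriorPower.map i (formAct A g)) (sectionsAct A g 1)
        (wedgeLinEquiv hg i ω) =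
      wedgeLinEquiv hg i
        (TensorProduct.map (exteriorPower.map i (formAct A g)) (formAct A g) ω) := by
  induction ω using TensorProduct.induction_on with
  | zero => simp only [map_zero]
  | add x y hx hy => simp only [map_add, hx, hy]
  | tmul x v =>
    simp only [wedgeLinEquiv, LinearEquiv.lTensor_tmul, TensorProduct.map_tmul]
    rfl

theorem tensorPair_wedgeLinEquiv {g : ℕ} (hg : 2 ≤ g) (i : ℕ)
    (α : Module.Dual ℂ (⋀[ℂ]^i (Forms g))) (β : Module.Dual ℂ (sections g 1))
    (ω : (⋀[ℂ]^i (Forms g)) ⊗[ℂ] Forms g) :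
    tensorPair α β (wedgeLinEquiv hg i ω) = tensorPair α (β ∘ₗ linSection g) ω :=
  tensorPair_map α β LinearMap.id (linSection g) ω

/-- Evaluation of sections at a point of the cone. -/
def evSection (g q : ℕ) (x : tangentCone g) : Module.Dual ℂ (sections g q) :=
  LinearMap.proj x ∘ₗ (sections g q).subtype

/-- Multiplication of sections is multiplication of values, so evaluating the differential of ω at a
point x inserts x into both of the first two slots. In the other m slots points of the curve
suffice, since they span the dual of V. -/
theorem mem_koszulCycles_iff {g : ℕ} (hg : 2 ≤ g) (m : ℕ)
    (ω : (⋀[ℂ]^(m + 1) (Forms g)) ⊗[ℂ] Forms g) :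
    wedgeLinEquiv hg (m + 1) ω ∈ koszulCycles (sectionsMul g 1) (m + 1) ↔
      ∀ (p w : Fin 2 → ℂ), p ≠ 0 → w ≠ 0 → ∀ r : Fin m → Fin 2 → ℂ,
        wedgeEval ω (Fin.cons (tangentPoint g p w) (Fin.cons (tangentPoint g p w)
          fun j => evForm g (r j))) = 0 := by
  have key : ∀ (x : tangentCone g) (r : Fin m → Fin 2 → ℂ),
      tensorPair (wedgePair fun j => evForm g (r j)) (evSection g 2 x)
        (koszulD (sectionsMul g 1) m (wedgeLinEquiv hg (m + 1) ω)) =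
      wedgeEval ω (Fin.cons x.1 (Fin.cons x.1 fun j => evForm g (r j))) := by
    intro x r
    rw [tensorPair_koszulD (sectionsMul g 1) _ (ψ := x.1) (χ := evSection g 1 x) (fun _ _ => rfl),
      tensorPair_wedgeLinEquiv, wedgeEval_cons]
    congr 2
    exact LinearMap.ext fun v => linSection_apply v x
  constructor
  · intro h p w hp hw r
    refine (key (conePoint hg hp hw) r).symm.trans ?_
    rw [show koszulD (sectionsMul g 1) m _ = 0 from h, map_zero]
  · intro h
    refine eq_zero_of_tensorPair (span_wedgePair (span_evForm g) m)
      (Y := Set.range (evSection g 2)) (fun f hf => ?_) ?_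
    · exact Subtype.ext (funext fun x => hf _ ⟨x, rfl⟩)
    · rintro _ ⟨φ, hφ, rfl⟩ _ ⟨x, rfl⟩
      choose r hr using hφ
      obtain rfl : φ = fun j => evForm g (r j) := funext fun j => (hr j).symm
      obtain ⟨p, w, hp, hw, rfl⟩ := exists_conePoint hg x
      exact (key _ r).trans (h p w hp hw r)

theorem koszulD_tmul {V M N : Type*} [AddCommGroup V] [Module ℂ V] [AddCommGroup M] [Module ℂ M]
    [AddCommGroup N] [Module ℂ N] (μ : V →ₗ[ℂ] M →ₗ[ℂ] N) (p : ℕ) (η : ⋀[ℂ]^(p + 1) V) (m : M) :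
    koszulD μ p (η ⊗ₜ m) = (μ.flip m).lTensor (⋀[ℂ]^p V) (wedgeComul V p η) := by
  simp only [koszulD, LinearMap.comp_apply, LinearMap.rTensor_tmul]
  induction wedgeComul V p η using TensorProduct.induction_on with
  | zero => simp
  | add x y hx hy => rw [map_add, ← hx, ← hy, TensorProduct.add_tmul, map_add, map_add]
  | tmul x v => simp

/-- Since degree zero sections are constant, boundaries are the image of Λ^{m+2} V under
comultiplication. The values of ω are antisymmetric in the last m + 1 arguments anyway, so
antisymmetry in the first two is the only remaining condition. -/
theorem mem_koszulBoundaries_iff {g : ℕ} (hg : 2 ≤ g) (m : ℕ)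
    (ω : (⋀[ℂ]^(m + 1) (Forms g)) ⊗[ℂ] Forms g) :
    wedgeLinEquiv hg (m + 1) ω ∈ koszulBoundaries (sectionsMul g 0) (m + 1) ↔
      ∀ p : Fin (m + 2) → Fin 2 → ℂ,
        wedgeEval ω (fun j => evForm g (p j)) +
          wedgeEval ω (fun j => evForm g (p (Equiv.swap 0 1 j))) = 0 := by
  have key : ∀ η : ⋀[ℂ]^(m + 2) (Forms g), wedgeLinEquiv hg (m + 1) (wedgeComul _ (m + 1) η) =
      koszulD (sectionsMul g 0) (m + 1) (η ⊗ₜ ⟨fun _ => 1, const_mem_sections g 1⟩) := by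
    intro η
    rw [koszulD_tmul, wedgeLinEquiv_apply]
    rfl
  constructor
  · rintro ⟨y, hy⟩ p
    have hω : ∃ η, ω = wedgeComul (Forms g) (m + 1) η := by
      suffices h : ∀ y : (⋀[ℂ]^(m + 2) (Forms g)) ⊗[ℂ] sections g 0, ∃ η,
          koszulD (sectionsMul g 0) (m + 1) y =
            wedgeLinEquiv hg (m + 1) (wedgeComul (Forms g) (m + 1) η) by
        obtain ⟨η, hη⟩ := h y
        exact ⟨η, (wedgeLinEquiv hg (m + 1)).injective (hy.symm.trans hη)⟩
      intro y
      induction y using TensorProduct.induction_on with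
      | zero => exact ⟨0, by simp⟩
      | add x y hx hy =>
        obtain ⟨a, ha⟩ := hx
        obtain ⟨b, hb⟩ := hy
        exact ⟨a + b, by rw [map_add, ha, hb, map_add, map_add]⟩
      | tmul η f =>
        obtain ⟨f, hf⟩ := f
        obtain ⟨c, rfl⟩ := sections_zero_const hg hf
        refine ⟨c • η, ?_⟩
        rw [key, TensorProduct.smul_tmul]
        congr 2
        exact Subtype.ext (funext fun x => (mul_one c).symm)
    obtain ⟨η, rfl⟩ := hω
    rw [wedgeEval_wedgeComul, wedgeEval_wedgeComul]
    have h := AlternatingMap.map_swap (exteriorPower.ιMulti ℂ (m + 2))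
      (fun j => evForm g (p j)) (i := 0) (j := 1) (by simp)
    simp only [wedgePair]
    rw [show (fun j => evForm g (p (Equiv.swap 0 1 j))) =
      (fun j => evForm g (p j)) ∘ Equiv.swap 0 1 from rfl, h, map_neg, LinearMap.neg_apply,
      add_neg_cancel]
  · intro h
    obtain ⟨η, rfl⟩ := mem_range_wedgeComul (span_evForm g) (ω := ω) fun p =>
      eq_neg_of_add_eq_zero_right (h p)
    rw [key]
    exact ⟨_, rfl⟩

/-! ### Comparing a subquotient with a submodule through functions of points -/

/-- The class of an element of `Z` in the subquotient `Z / (B ∩ Z)`. -/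
def subquotientClass {E : Type*} [AddCommGroup E] [Module ℂ E] (Z B : Submodule ℂ E) (z : E)
    (hz : z ∈ Z) : Subquotient Z B :=
  Submodule.Quotient.mk ⟨z, hz⟩

/-- A linear isomorphism from a subquotient to a submodule constructed from two linear maps with
the same image. -/
theorem exists_subquotient_equiv {E W F : Type*} [AddCommGroup E] [Module ℂ E] [AddCommGroup W]
    [Module ℂ W] [AddCommGroup F] [Module ℂ F] (Z B : Submodule ℂ E) (N : Submodule ℂ W)
    (a : E →ₗ[ℂ] F) (b : W →ₗ[ℂ] F) (ha : ∀ z ∈ Z, a z = 0 ↔ z ∈ B)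
    (hb : ∀ n ∈ N, b n = 0 → n = 0) (hab : ∀ z ∈ Z, ∃ n ∈ N, a z = b n)
    (hba : ∀ n ∈ N, ∃ z ∈ Z, a z = b n) :
    ∃ e : Subquotient Z B ≃ₗ[ℂ] N, ∀ z hz, a z = b (e (subquotientClass Z B z hz)) := by
  let a' : Subquotient Z B →ₗ[ℂ] F := (B.submoduleOf Z).liftQ (a ∘ₗ Z.subtype)
    fun z hz => (ha z.1 z.2).2 hz
  have ha' : Function.Injective a' := by
    rw [injective_iff_map_eq_zero]
    intro x hx
    obtain ⟨z, rfl⟩ := Submodule.Quotient.mk_surjective _ x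
    exact (Submodule.Quotient.mk_eq_zero _).2 ((ha z.1 z.2).1 hx)
  have hb' : Function.Injective (b ∘ₗ N.subtype) := by
    rw [injective_iff_map_eq_zero]
    exact fun n hn => Subtype.ext (hb n.1 n.2 hn)
  have hr : LinearMap.range a' = LinearMap.range (b ∘ₗ N.subtype) := by
    apply le_antisymm
    · rintro _ ⟨x, rfl⟩
      obtain ⟨z, rfl⟩ := Submodule.Quotient.mk_surjective _ x
      obtain ⟨n, hn, h⟩ := hab z.1 z.2
      exact ⟨⟨n, hn⟩, h.symm⟩
    · rintro _ ⟨n, rfl⟩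
      obtain ⟨z, hz, h⟩ := hba n.1 n.2
      exact ⟨Submodule.Quotient.mk ⟨z, hz⟩, h⟩
  let e₁ := LinearEquiv.ofInjective a' ha'
  let e₂ := LinearEquiv.ofInjective (b ∘ₗ N.subtype) hb'
  refine ⟨e₁.trans ((LinearEquiv.ofEq _ _ hr).trans e₂.symm), fun z hz => ?_⟩
  have h : ∀ y : LinearMap.range (b ∘ₗ N.subtype), b (e₂.symm y).1 = y.1 := fun y =>
    congrArg Subtype.val (e₂.apply_symm_apply y)
  exact (h (LinearEquiv.ofEq _ _ hr (e₁ (subquotientClass Z B z hz)))).symm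

/-- The value of an element of `Λ^i V ⊗ V` at points of the rational normal curve, symmetrized in
the first two points. -/
def symEval (g m : ℕ) : (⋀[ℂ]^(m + 1) (Forms g)) ⊗[ℂ] Forms g →ₗ[ℂ]
    ((Fin (m + 2) → Fin 2 → ℂ) → ℂ) where
  toFun ω p := wedgeEval ω (fun j => evForm g (p j)) +
    wedgeEval ω (fun j => evForm g (p (Equiv.swap 0 1 j)))
  map_add' x y := by
    funext p
    simp [wedgeEval]
    ring
  map_smul' c x := by
    funext p
    simp [wedgeEval]
    ring

theorem symEval_map (g m : ℕ) (A : SL2) (ω : (⋀[ℂ]^(m + 1) (Forms g)) ⊗[ℂ] Forms g)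
    (p : Fin (m + 2) → Fin 2 → ℂ) :
    symEval g m (TensorProduct.map (exteriorPower.map _ (formAct A g)) (formAct A g) ω) p =
      symEval g m ω (fun j => Matrix.vecMul (p j) A.1) := by
  simp only [symEval, LinearMap.coe_mk, AddHom.coe_mk, wedgeEval_map, evForm_comp]

/-! ## Linear forms and apolarity -/

/-- The linear form `p₀ x + p₁ y`. -/
def linPoly (p : Fin 2 → ℂ) : BinPoly := ∑ i, C (p i) * X i

theorem linPoly_isHomogeneous (p : Fin 2 → ℂ) : (linPoly p).IsHomogeneous 1 :=
  IsHomogeneous.sum _ _ _ fun i _ => isHomogeneous_C_mul_X _ i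

theorem eval_linPoly (p q : Fin 2 → ℂ) : eval q (linPoly p) = ∑ i, p i * q i := by
  simp [linPoly]

/-- The transposed substitution moves the coefficient vector of a linear form exactly as A moves
evaluation points. It thus represents the adjoint action on forms in the dual variables. -/
theorem binSubst_transpose_linPoly (A : SL2) (p : Fin 2 → ℂ) :
    binSubst A.transpose (linPoly p) = linPoly (Matrix.vecMul p A.1) := by
  simp only [linPoly, binSubst, map_mul, aeval_X, Fin.sum_univ_two,
    Matrix.SpecialLinearGroup.coe_transpose, Matrix.transpose_apply, Matrix.vecMul, dotProduct,
    algHom_C, algebraMap_eq, map_add]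
  ring

/-- The product of powers of linear forms `∏ ℓ_j ^ e_j`. -/
def powForm {n N : ℕ} (e : Fin n → ℕ) (h : ∑ j, e j = N) (p : Fin n → Fin 2 → ℂ) : Forms N :=
  ⟨∏ j, linPoly (p j) ^ e j, by
    have := IsHomogeneous.prod Finset.univ (fun j => linPoly (p j) ^ e j) e fun j _ => by
      simpa using (linPoly_isHomogeneous (p j)).pow (e j)
    rwa [h] at this⟩

theorem formAct_powForm {n N : ℕ} (e : Fin n → ℕ) (h : ∑ j, e j = N) (p : Fin n → Fin 2 → ℂ)
    (A : SL2) :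
    formAct A.transpose N (powForm e h p) = powForm e h fun j => Matrix.vecMul (p j) A.1 := by
  apply Subtype.ext
  change binSubst A.transpose (∏ j, linPoly (p j) ^ e j) = ∏ j, linPoly _ ^ e j
  simp [map_prod, binSubst_transpose_linPoly]

/-- The `n`-th power of a linear form. -/
def linPow (n : ℕ) (p : Fin 2 → ℂ) : Forms n :=
  ⟨linPoly p ^ n, by simpa using (linPoly_isHomogeneous p).pow n⟩

theorem expo_surjective (d : Fin 2 →₀ ℕ) : d = expo (d 0, d 1) := by
  ext i
  fin_cases i <;> simp [expo]

theorem forms_eq_sum {n : ℕ} (F : Forms n) :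
    F.1 = ∑ ab ∈ Finset.HasAntidiagonal.antidiagonal n,
      monomial (expo ab) (coeff (expo ab) F.1) := by
  ext d
  rw [coeff_sum]
  simp only [coeff_monomial]
  by_cases hd : coeff d F.1 = 0
  · rw [hd, Finset.sum_eq_zero]
    intro ab _
    split_ifs with h
    · rw [h, hd]
    · rfl
  · have h1 : d.degree = n := by
      have := F.2 hd
      rwa [Finsupp.degree_eq_weight_one]
    rw [expo_surjective d] at h1 ⊢
    rw [Finset.sum_eq_single (d 0, d 1)]
    · simp
    · intro b _ hb
      rw [if_neg fun h => hb (expo_injective h)]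
    · intro h
      exfalso
      apply h
      rw [expo, map_add, Finsupp.degree_single, Finsupp.degree_single] at h1
      exact Finset.HasAntidiagonal.mem_antidiagonal.2 h1

theorem eval_forms {n : ℕ} (F : Forms n) (p : Fin 2 → ℂ) :
    eval p F.1 = ∑ ab ∈ Finset.HasAntidiagonal.antidiagonal n,
      coeff (expo ab) F.1 * (p 0 ^ ab.1 * p 1 ^ ab.2) := by
  conv_lhs => rw [forms_eq_sum F, map_sum]
  refine Finset.sum_congr rfl fun ab _ => ?_
  rw [eval_monomial, expo, Finsupp.prod_add_index' (by simp) (by intros; rw [pow_add])]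
  simp

theorem coeff_linPow (n : ℕ) (p : Fin 2 → ℂ) {ab : ℕ × ℕ}
    (hab : ab ∈ Finset.HasAntidiagonal.antidiagonal n) :
    coeff (expo ab) (linPow n p).1 = n.choose ab.1 * (p 0 ^ ab.1 * p 1 ^ ab.2) := by
  have h : (linPow n p).1 = ∑ cd ∈ Finset.HasAntidiagonal.antidiagonal n,
      monomial (expo cd) (n.choose cd.1 * (p 0 ^ cd.1 * p 1 ^ cd.2) : ℂ) := by
    change linPoly p ^ n = _
    rw [linPoly, Fin.sum_univ_two, (Commute.all _ _).add_pow']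
    refine Finset.sum_congr rfl fun cd _ => ?_
    have hm : monomial (expo cd) (1 : ℂ) = X 0 ^ cd.1 * X 1 ^ cd.2 := by
      rw [X_pow_eq_monomial, X_pow_eq_monomial, monomial_mul, one_mul, expo]
    rw [← mul_one (n.choose cd.1 * (p 0 ^ cd.1 * p 1 ^ cd.2) : ℂ), ← C_mul_monomial, hm,
      nsmul_eq_mul]
    simp only [map_mul, map_pow, map_natCast]
    ring
  rw [h, coeff_sum, Finset.sum_eq_single ab]
  · simp
  · intro b _ hb
    rw [coeff_monomial, if_neg fun h => hb (expo_injective h)]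
  · exact fun h => absurd hab h

theorem apolar_comm (n : ℕ) (F G : Forms n) : apolar n F G = apolar n G F := by
  simp only [apolar, LinearMap.mk₂_apply]
  exact Finset.sum_congr rfl fun _ _ => by ring

theorem apolar_linPow (n : ℕ) (F : Forms n) (p : Fin 2 → ℂ) :
    apolar n F (linPow n p) = n.factorial * eval p F.1 := by
  rw [eval_forms]
  simp only [apolar, LinearMap.mk₂_apply]
  rw [Finset.mul_sum]
  refine Finset.sum_congr rfl fun ab hab => ?_
  rw [coeff_linPow n p hab]
  have h : n.choose ab.1 * ab.1.factorial * ab.2.factorial = n.factorial := by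
    rw [← Finset.HasAntidiagonal.mem_antidiagonal.1 hab]
    rw [Nat.choose_symm_add]
    exact Nat.add_choose_mul_factorial_mul_factorial ab.1 ab.2
  have h' : (n.choose ab.1 * ab.1.factorial * ab.2.factorial : ℂ) = n.factorial := by
    exact_mod_cast h
  rw [← h']
  ring

/-- Apolar pairing with the n-th power of the linear form of p is n! times evaluation at p, and
evaluations span the dual space. -/
theorem span_linPow (n : ℕ) : Submodule.span ℂ (Set.range (linPow n)) = ⊤ := by
  have h : Submodule.map (apolar n) (Submodule.span ℂ (Set.range (linPow n))) = ⊤ := by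
    rw [eq_top_iff, ← span_evForm n, Submodule.span_le]
    rintro _ ⟨p, rfl⟩
    refine ⟨(n.factorial : ℂ)⁻¹ • linPow n p,
      Submodule.smul_mem _ _ (Submodule.subset_span ⟨p, rfl⟩), ?_⟩
    ext F
    have hn : (n.factorial : ℂ) ≠ 0 := by exact_mod_cast n.factorial_ne_zero
    rw [map_smul, LinearMap.smul_apply, apolar_comm, apolar_linPow, smul_eq_mul,
      inv_mul_cancel_left₀ hn, evForm_apply]
  rw [eq_top_iff]
  intro x _
  have hx : apolar n x ∈ Submodule.map (apolar n) (Submodule.span ℂ (Set.range (linPow n))) :=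
    h ▸ Submodule.mem_top
  obtain ⟨y, hy, e⟩ := hx
  rwa [← apolar_injective n e]

/-- It suffices to test on powers of linear forms, where both sides are n! times the value of F at
the moved point. -/
theorem apolar_formAct (n : ℕ) (A : SL2) (F G : Forms n) :
    apolar n (formAct A n F) G = apolar n F (formAct A.transpose n G) := by
  have hG : G ∈ Submodule.span ℂ (Set.range (linPow n)) := span_linPow n ▸ Submodule.mem_top
  induction hG using Submodule.span_induction with
  | mem G hG =>
    obtain ⟨p, rfl⟩ := hG
    have : formAct A.transpose n (linPow n p) = linPow n (Matrix.vecMul p A.1) := by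
      apply Subtype.ext
      change binSubst A.transpose (linPoly p ^ n) = linPoly _ ^ n
      rw [map_pow, binSubst_transpose_linPoly]
    rw [this, apolar_linPow, apolar_linPow]
    congr 1
    exact LinearMap.congr_fun (evForm_comp n p A) F
  | zero => simp
  | add a b _ _ ha hb => simp only [map_add, ha, hb]
  | smul c a _ ha => simp only [map_smul, ha]

theorem forms_eq_zero_of_affine {n : ℕ} {F : BinPoly} (hF : F.IsHomogeneous n)
    (h : ∀ z : ℂ, eval ![1, z] F = 0) : F = 0 := by
  have h1 : F * X 0 = 0 := by
    refine MvPolynomial.funext fun p => ?_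
    rw [map_mul, eval_X, map_zero]
    by_cases hp : p 0 = 0
    · rw [hp, mul_zero]
    · have e : p = p 0 • ![1, p 1 / p 0] := by
        funext j
        fin_cases j
        · simp
        · simp [mul_div_cancel₀ _ hp]
      rw [e, eval_smul_of_isHomogeneous hF, h, mul_zero, zero_mul]
  exact (mul_eq_zero.1 h1).resolve_right (X_ne_zero _)

theorem exists_eq_prod_linear {n : ℕ} {f : Polynomial ℂ} (hf : f.natDegree ≤ n) :
    ∃ (c : ℂ) (p : Fin n → Fin 2 → ℂ), ∀ z, f.eval z = c * ∏ j, (p j 0 + p j 1 * z) := by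
  induction n generalizing f with
  | zero =>
    refine ⟨f.coeff 0, Fin.elim0, fun z => ?_⟩
    rw [Polynomial.eq_C_of_natDegree_le_zero hf]
    simp
  | succ n ih =>
    by_cases hn : f.natDegree ≤ n
    · obtain ⟨c, p, h⟩ := ih hn
      -- When the degree bound is not attained, the constant factor 1 fills the vacant place; it
      -- corresponds to a root at infinity.
      refine ⟨c, Fin.cons ![1, 0] p, fun z => ?_⟩
      rw [h, Fin.prod_univ_succ]
      simp
    · have hd : f.degree ≠ 0 := fun h => hn (by
        rw [Polynomial.natDegree_eq_zero_iff_degree_le_zero.2 h.le]; exact n.zero_le)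
      obtain ⟨r, hr⟩ := IsAlgClosed.exists_root f hd
      obtain ⟨g, rfl⟩ := Polynomial.dvd_iff_isRoot.2 hr
      have hg0 : g ≠ 0 := fun h => hn (by simp [h])
      rw [Polynomial.natDegree_mul (Polynomial.X_sub_C_ne_zero r) hg0,
        Polynomial.natDegree_X_sub_C] at hf
      obtain ⟨c, p, h⟩ := ih (f := g) (by omega)
      refine ⟨c, Fin.cons ![-r, 1] p, fun z => ?_⟩
      rw [Polynomial.eval_mul, h, Fin.prod_univ_succ]
      simp
      ring

/-- Every binary form is a multiple of a product of linear forms. -/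
theorem exists_eq_prod_linPoly {n : ℕ} (F : Forms n) :
    ∃ (c : ℂ) (p : Fin n → Fin 2 → ℂ), F.1 = C c * ∏ j, linPoly (p j) := by
  let f : Polynomial ℂ := ∑ ab ∈ Finset.HasAntidiagonal.antidiagonal n,
    Polynomial.C (coeff (expo ab) F.1) * Polynomial.X ^ ab.2
  have hf : f.natDegree ≤ n := by
    refine Polynomial.natDegree_sum_le_of_forall_le _ _ fun ab hab => ?_
    refine (Polynomial.natDegree_C_mul_X_pow_le _ _).trans ?_
    have := Finset.HasAntidiagonal.mem_antidiagonal.1 hab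
    omega
  obtain ⟨c, p, h⟩ := exists_eq_prod_linear hf
  refine ⟨c, p, ?_⟩
  rw [← sub_eq_zero]
  have hp := IsHomogeneous.prod Finset.univ (fun j => linPoly (p j)) (fun _ => 1) fun j _ =>
    linPoly_isHomogeneous (p j)
  rw [Finset.sum_const, Finset.card_univ, Fintype.card_fin, smul_eq_mul, mul_one] at hp
  refine forms_eq_zero_of_affine (n := n)
    (Submodule.sub_mem (Forms n) F.2 (by
      rw [← smul_eq_C_mul]; exact Submodule.smul_mem (Forms n) c hp)) fun z => ?_
  have h1 := h z
  rw [map_sub, eval_forms, map_mul, eval_C, map_prod, sub_eq_zero]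
  simp only [f, Polynomial.eval_finsetSum, Polynomial.eval_mul, Polynomial.eval_C,
    Polynomial.eval_pow, Polynomial.eval_X] at h1
  simpa [eval_linPoly] using h1

/-! ## Evaluation of symmetric powers -/

/-- Polynomial functions separate the elements of the symmetric algebra. -/
theorem symmetricAlgebra_eq_zero {n : ℕ} {x : SymmetricAlgebra ℂ (Forms n)}
    (h : ∀ φ : Module.Dual ℂ (Forms n), evalAt φ x = 0) : x = 0 := by
  let b := Module.finBasis ℂ (Forms n)
  let e := SymmetricAlgebra.equivMvPolynomial b
  rw [← map_eq_zero_iff e e.injective]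
  refine MvPolynomial.funext fun c => ?_
  have : (aeval c).comp e.toAlgHom = SymmetricAlgebra.lift (b.constr ℂ c) := by
    refine SymmetricAlgebra.algHom_ext (b.ext fun i => ?_)
    simp [e]
  have h2 := DFunLike.congr_fun this x
  rw [map_zero, ← h (b.constr ℂ c), evalAt, ← h2]
  simp [aeval_eq_eval]

/-- Every functional on binary forms is apolar pairing with some form, and over ℂ that form is a
scalar multiple of a product of linear forms. The scalar is harmless because x is homogeneous. -/
theorem symPow_eq_zero {n q : ℕ} {x : SymmetricAlgebra ℂ (Forms n)} (hx : x ∈ symPow (Forms n) q)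
    (h : ∀ p, evalAt ((apolar n).flip (powForm (n := n) (fun _ => 1) (by simp) p)) x = 0) :
    x = 0 := by
  refine symmetricAlgebra_eq_zero fun φ => ?_
  obtain ⟨P, rfl⟩ : ∃ P, φ = (apolar n).flip P := by
    refine ⟨(apolarEquiv n).symm φ, ?_⟩
    ext F
    rw [LinearMap.flip_apply, apolar_comm]
    exact (LinearMap.congr_fun ((apolarEquiv n).apply_symm_apply φ) F).symm
  obtain ⟨c, p, hP⟩ := exists_eq_prod_linPoly P
  obtain rfl : P = c • powForm (fun _ => 1) (by simp) p := by
    apply Subtype.ext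
    rw [hP, Submodule.coe_smul, smul_eq_C_mul]
    simp [powForm]
  rw [map_smul, evalAt_smul c _ hx, h, mul_zero]

/-! ## The kernel of `γ'` -/

theorem symPowZ_eq_zero {n : ℕ} {q : ℤ} {x : SymmetricAlgebra ℂ (Forms n)}
    (hx : x ∈ symPowZ (Forms n) q)
    (h : ∀ p, evalAt ((apolar n).flip (powForm (n := n) (fun _ => 1) (by simp) p)) x = 0) :
    x = 0 := by
  cases q with
  | ofNat q => exact symPow_eq_zero hx h
  | negSucc q => exact hx

/-- Evaluation of elements of a symmetric power of `S^n U` at a form in `S^n U*`. -/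
def evalForm {n : ℕ} (P : Forms n) (q : ℤ) : Module.Dual ℂ (symPowZ (Forms n) q) :=
  (SymmetricAlgebra.lift ((apolar n).flip P)).toLinearMap ∘ₗ (symPowZ (Forms n) q).subtype

theorem evalForm_apply {n : ℕ} (P : Forms n) (q : ℤ) (x : symPowZ (Forms n) q) :
    evalForm P q x = evalAt ((apolar n).flip P) x.1 := rfl

theorem evalForm_symMul {n : ℕ} (P : Forms n) {q r : ℤ} (h : r = q + 1) (v : Forms n)
    (x : symPowZ (Forms n) q) : evalForm P r (symMul h v x) = apolar n v P * evalForm P q x := by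
  change SymmetricAlgebra.lift _ (SymmetricAlgebra.ι ℂ _ v * x.1) = _
  rw [map_mul, SymmetricAlgebra.lift_ι_apply]
  rfl

theorem evalForm_symPowMap {n : ℕ} (P : Forms n) (q : ℤ) (A : SL2) (x : symPowZ (Forms n) q) :
    evalForm P q (symPowMap (formAct A n) q x) = evalForm (formAct A.transpose n P) q x := by
  rw [evalForm_apply, evalForm_apply]
  have e : (apolar n).flip (formAct A.transpose n P) = (apolar n).flip P ∘ₗ formAct A n := by
    ext F
    rw [LinearMap.comp_apply, LinearMap.flip_apply, LinearMap.flip_apply, apolar_formAct]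
  have h : SymmetricAlgebra.lift ((apolar n).flip P ∘ₗ formAct A n) =
      (SymmetricAlgebra.lift ((apolar n).flip P)).comp (symMap (formAct A n)) := by
    refine SymmetricAlgebra.algHom_ext ?_
    ext v
    simp [symMap]
  rw [e, evalAt, evalAt, h]
  rfl

/-- Elements of `S^a U ⊗ S^q S^n U` as polynomial functions on `S^n U*` with values in the dual of
`S^a U*`. -/
def pairForm {a n : ℕ} {q : ℤ} (P : Forms n) (h : Forms a) :
    Module.Dual ℂ (Forms a ⊗[ℂ] symPowZ (Forms n) q) :=
  tensorPair ((apolar a).flip h) (evalForm P q)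

theorem pairForm_tmul {a n : ℕ} {q : ℤ} (P : Forms n) (h F : Forms a) (x : symPowZ (Forms n) q) :
    pairForm P h (F ⊗ₜ x) = apolar a F h * evalForm P q x :=
  tensorPair_tmul _ _ _ _

/-- `pairForm` as a linear form in its second argument. -/
def pairFormLin {a n : ℕ} {q : ℤ} (G : Forms a ⊗[ℂ] symPowZ (Forms n) q) (P : Forms n) :
    Module.Dual ℂ (Forms a) :=
  LinearMap.applyₗ G ∘ₗ TensorProduct.dualDistrib ℂ _ _ ∘ₗ
    (TensorProduct.mk ℂ _ _).flip (evalForm P q) ∘ₗ (apolar a).flip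

theorem pairFormLin_apply {a n : ℕ} {q : ℤ} (G : Forms a ⊗[ℂ] symPowZ (Forms n) q) (P : Forms n)
    (h : Forms a) : pairFormLin G P h = pairForm P h G := rfl

theorem pairForm_map {a n : ℕ} {q : ℤ} (P : Forms n) (h : Forms a) (A : SL2)
    (G : Forms a ⊗[ℂ] symPowZ (Forms n) q) :
    pairForm P h (TensorProduct.map (formAct A a) (symPowMap (formAct A n) q) G) =
      pairForm (formAct A.transpose n P) (formAct A.transpose a h) G := by
  rw [pairForm, tensorPair_map, pairForm]
  congr 2
  · ext F
    exact apolar_formAct a A F h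
  · ext x
    exact evalForm_symPowMap P q A x

theorem flip_apolar_span (n : ℕ) : Submodule.span ℂ (Set.range ((apolar n).flip)) = ⊤ :=
  span_eq_top_of_separating fun F hF => apolar_injective n (by
    ext G
    rw [map_zero, LinearMap.zero_apply]
    exact hF _ ⟨G, rfl⟩)

theorem eq_zero_of_pairForm {a n : ℕ} {q : ℤ} {G : Forms a ⊗[ℂ] symPowZ (Forms n) q}
    (hG : ∀ (p : Fin n → Fin 2 → ℂ) (h : Forms a),
      pairForm (powForm (fun _ => 1) (by simp) p) h G = 0) : G = 0 := by
  refine eq_zero_of_tensorPair (flip_apolar_span a) (Y := Set.range fun p : Fin n → Fin 2 → ℂ =>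
    evalForm (powForm (fun _ => 1) (by simp) p) q) (fun x hx => ?_) ?_
  · exact Subtype.ext (symPowZ_eq_zero x.2 fun p => hx _ ⟨p, rfl⟩)
  · rintro _ ⟨h, rfl⟩ _ ⟨p, rfl⟩
    exact hG p h

theorem wedgeApolarEquiv_ιMulti (n : ℕ) (v w : Fin 2 → Forms n) :
    wedgeApolarEquiv n (exteriorPower.ιMulti ℂ 2 v) (exteriorPower.ιMulti ℂ 2 w) =
      apolar n (v 0) (w 0) * apolar n (v 1) (w 1) -
        apolar n (v 1) (w 0) * apolar n (v 0) (w 1) := by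
  change exteriorPower.pairingDual ℂ (Forms n) 2 (exteriorPower.map 2 (apolar n) _) _ = _
  rw [exteriorPower.map_apply_ιMulti, exteriorPower.pairingDual_ιMulti_ιMulti, Matrix.det_fin_two]
  simp

/-- Evaluated at P and paired with f, the Koszul differential becomes contraction with P ∧ f.
Composition with the co-Wahl map then produces the Jacobian of P and f by transposition. -/
theorem tensorPair_koszulSym {n : ℕ} {q r : ℤ} (hr : r = q + 1) (P f : Forms n)
    (ω : ⋀[ℂ]^2 (Forms n)) (x : symPowZ (Forms n) q) :
    tensorPair ((apolar n).flip f) (evalForm P r) (koszulSym (Forms n) hr (ω ⊗ₜ x)) =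
      wedgeApolarEquiv n ω (exteriorPower.ιMulti ℂ 2 ![P, f]) * evalForm P q x := by
  suffices h : tensorPair ((apolar n).flip f) (evalForm P r) ∘ₗ koszulSym (Forms n) hr ∘ₗ
      (TensorProduct.mk ℂ _ _).flip x = evalForm P q x •
        (LinearMap.applyₗ (exteriorPower.ιMulti ℂ 2 ![P, f]) ∘ₗ
          (wedgeApolarEquiv n).toLinearMap) by
    have h2 := LinearMap.congr_fun h ω
    rw [mul_comm]
    exact h2
  refine exteriorPower.linearMap_ext ?_
  ext v
  simp only [LinearMap.compAlternatingMap_apply, LinearMap.comp_apply, LinearMap.flip_apply,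
    TensorProduct.mk_apply, LinearMap.smul_apply, LinearMap.applyₗ_apply_apply,
    LinearEquiv.coe_coe, smul_eq_mul]
  rw [wedgeApolarEquiv_ιMulti, koszulSym, LinearMap.comp_apply, koszulD_ιMulti, Fin.sum_univ_two]
  simp only [map_add, map_zsmul, LinearMap.rTensor_tmul, LinearEquiv.coe_coe,
    exteriorPower.oneEquiv_ιMulti, tensorPair_tmul, evalForm_symMul, LinearMap.flip_apply]
  simp
  ring

theorem tensorPair_gammaPrime (g i : ℕ) (P f : Forms (i + 1))
    (G : Forms (2 * i) ⊗[ℂ] symPowZ (Forms (i + 1)) ((g : ℤ) - i - 2)) :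
    tensorPair ((apolar (i + 1)).flip f) (evalForm P _) (gammaPrime g i G) =
      pairForm P (jacobian i P f) G := by
  induction G using TensorProduct.induction_on with
  | zero => simp
  | add x y hx hy => rw [map_add, map_add, hx, hy, map_add]
  | tmul F x =>
    rw [gammaPrime, LinearMap.comp_apply, LinearMap.rTensor_tmul, tensorPair_koszulSym,
      coWahl_pairing, pairForm_tmul]
    congr 2
    simp [wahl, altOfBilin]

/-- By `tensorPair_gammaPrime`, the value of γ'(G) at P paired with f is the functional attached to
P applied to the Jacobian. Products of linear forms are enough because they separate symmetric
powers. -/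
theorem mem_ker_gammaPrime_iff (g i : ℕ)
    (G : Forms (2 * i) ⊗[ℂ] symPowZ (Forms (i + 1)) ((g : ℤ) - i - 2)) :
    G ∈ LinearMap.ker (gammaPrime g i) ↔ ∀ (p : Fin (i + 1) → Fin 2 → ℂ) (f : Forms (i + 1)),
      pairForm (powForm (fun _ => 1) (by simp) p)
        (jacobian i (powForm (fun _ => 1) (by simp) p) f) G = 0 := by
  constructor
  · intro h p f
    rw [← tensorPair_gammaPrime, LinearMap.mem_ker.1 h, map_zero]
  · intro h
    exact eq_zero_of_pairForm fun p f => (tensorPair_gammaPrime g i _ f G).trans (h p f)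

/-! ## Multihomogeneous functions of several points -/

/-- The functions of `n` points which are homogeneous of degree `d j` in the `j`-th point. -/
def multiHom {n : ℕ} (d : Fin n → ℕ) : Submodule ℂ ((Fin n → Fin 2 → ℂ) → ℂ) :=
  Submodule.span ℂ (Set.range fun (v : ∀ j, Forms (d j)) (p : Fin n → Fin 2 → ℂ) =>
    ∏ j, evForm (d j) (p j) (v j))

variable {n : ℕ}

theorem prod_mem_multiHom {d : Fin n → ℕ} (v : ∀ j, Forms (d j)) :
    (fun p => ∏ j, evForm (d j) (p j) (v j)) ∈ multiHom d :=
  Submodule.subset_span ⟨v, rfl⟩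

theorem mul_mem_multiHom {d e : Fin n → ℕ} {f h : (Fin n → Fin 2 → ℂ) → ℂ} (hf : f ∈ multiHom d)
    (hh : h ∈ multiHom e) : f * h ∈ multiHom (d + e) := by
  induction hf using Submodule.span_induction with
  | mem f hf =>
    obtain ⟨v, rfl⟩ := hf
    induction hh using Submodule.span_induction with
    | mem h hh =>
      obtain ⟨w, rfl⟩ := hh
      convert prod_mem_multiHom (d := d + e) fun j =>
        ⟨(v j).1 * (w j).1, IsHomogeneous.mul (v j).2 (w j).2⟩ using 1
      funext p
      simp [evForm_apply, Finset.prod_mul_distrib]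
    | zero => rw [mul_zero]; exact Submodule.zero_mem _
    | add a b _ _ ha hb => rw [mul_add]; exact Submodule.add_mem _ ha hb
    | smul c a _ ha => rw [mul_smul_comm]; exact Submodule.smul_mem _ c ha
  | zero => rw [zero_mul]; exact Submodule.zero_mem _
  | add a b _ _ ha hb => rw [add_mul]; exact Submodule.add_mem _ ha hb
  | smul c a _ ha => rw [smul_mul_assoc]; exact Submodule.smul_mem _ c ha

theorem one_mem_multiHom : (1 : (Fin n → Fin 2 → ℂ) → ℂ) ∈ multiHom (0 : Fin n → ℕ) := by
  convert prod_mem_multiHom (d := (0 : Fin n → ℕ)) fun j =>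
    ⟨1, isHomogeneous_one (Fin 2) ℂ⟩ using 1
  funext p
  simp [evForm_apply]

/-- The bracket of two points. -/
def bracket (p q : Fin 2 → ℂ) : ℂ := p 0 * q 1 - p 1 * q 0

theorem coord_mem_multiHom (a : Fin n) (i : Fin 2) :
    (fun p : Fin n → Fin 2 → ℂ => p a i) ∈ multiHom (Pi.single a 1) := by
  have h : ∀ j, ∃ v : Forms ((Pi.single a 1 : Fin n → ℕ) j),
      ∀ q, eval q v.1 = if j = a then q i else 1 := by
    intro j
    by_cases hj : j = a
    · subst hj
      refine ⟨⟨X i, ?_⟩, fun q => by simp⟩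
      rw [Pi.single_eq_same]
      exact isHomogeneous_X ℂ i
    · refine ⟨⟨1, ?_⟩, fun q => by simp [hj]⟩
      rw [Pi.single_eq_of_ne hj]
      exact isHomogeneous_one (Fin 2) ℂ
  choose v hv using h
  convert prod_mem_multiHom v using 1
  funext p
  simp [evForm_apply, hv]

theorem bracket_mem_multiHom (a b : Fin n) :
    (fun p : Fin n → Fin 2 → ℂ => bracket (p a) (p b)) ∈ multiHom (Pi.single a 1 + Pi.single b 1) :=
  Submodule.sub_mem _ (mul_mem_multiHom (coord_mem_multiHom a 0) (coord_mem_multiHom b 1))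
    (mul_mem_multiHom (coord_mem_multiHom a 1) (coord_mem_multiHom b 0))

theorem linPoly_pow (k : ℕ) (p : Fin 2 → ℂ) : linPoly p ^ k =
    ∑ ab ∈ Finset.HasAntidiagonal.antidiagonal k,
      C (eval p (C (k.choose ab.1 : ℂ) * X 0 ^ ab.1 * X 1 ^ ab.2)) *
        (X 0 ^ ab.1 * X 1 ^ ab.2) := by
  rw [linPoly, Fin.sum_univ_two, (Commute.all _ _).add_pow']
  refine Finset.sum_congr rfl fun ab _ => ?_
  simp only [nsmul_eq_mul, map_mul, map_pow, eval_X, map_natCast]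
  ring

theorem prod_monomials_mem_forms {N : ℕ} {e : Fin n → ℕ} (h : ∑ j, e j = N) {s : Fin n → ℕ × ℕ}
    (hs : ∀ j, (s j).1 + (s j).2 = e j) :
    (∏ j, (X 0 ^ (s j).1 * X 1 ^ (s j).2 : BinPoly)) ∈ Forms N := by
  have := IsHomogeneous.prod Finset.univ
    (fun j => (X 0 ^ (s j).1 * X 1 ^ (s j).2 : BinPoly)) e fun j _ => by
      rw [← hs j]
      exact (isHomogeneous_X_pow _ _).mul (isHomogeneous_X_pow _ _)
  rwa [h] at this

/-- Expanding each power by the binomial theorem separates the points from the variables: finitely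
many fixed forms appear, with multihomogeneous coefficients. -/
theorem exists_powForm_eq_sum {N : ℕ} (e : Fin n → ℕ) (h : ∑ j, e j = N) :
    ∃ (S : Finset (Fin n → ℕ × ℕ)) (c : S → Forms N) (f : S → (Fin n → Fin 2 → ℂ) → ℂ),
      (∀ s, f s ∈ multiHom e) ∧ ∀ p, powForm e h p = ∑ s, f s p • c s := by
  have hS : ∀ s : {s // s ∈ Fintype.piFinset
      (fun j => Finset.HasAntidiagonal.antidiagonal (e j))}, ∀ j, (s.1 j).1 + (s.1 j).2 = e j :=
    fun s j => Finset.HasAntidiagonal.mem_antidiagonal.1 (Fintype.mem_piFinset.1 s.2 j)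
  refine ⟨Fintype.piFinset (fun j => Finset.HasAntidiagonal.antidiagonal (e j)),
    fun s => ⟨_, prod_monomials_mem_forms h (hS s)⟩, fun s p => ∏ j, eval (p j)
      (C ((e j).choose (s.1 j).1 : ℂ) * X 0 ^ (s.1 j).1 * X 1 ^ (s.1 j).2), fun s => ?_,
    fun p => ?_⟩
  · convert prod_mem_multiHom (d := e) fun j =>
      ⟨C ((e j).choose (s.1 j).1 : ℂ) * X 0 ^ (s.1 j).1 * X 1 ^ (s.1 j).2, by
        rw [mul_assoc, ← hS s j]
        exact ((isHomogeneous_X_pow _ _).mul (isHomogeneous_X_pow _ _)).C_mul _⟩ using 1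
    funext p
    simp only [evForm_apply]
  · apply Subtype.ext
    rw [AddSubmonoidClass.coe_finsetSum]
    simp only [Submodule.coe_smul, smul_eq_C_mul, map_prod]
    change ∏ j, linPoly (p j) ^ e j = _
    simp only [linPoly_pow]
    rw [Finset.prod_univ_sum, ← Finset.sum_coe_sort]
    simp only [Finset.prod_mul_distrib]

theorem powForm_mem_multiHom {N : ℕ} (e : Fin n → ℕ) (h : ∑ j, e j = N)
    (l : Module.Dual ℂ (Forms N)) : (fun p => l (powForm e h p)) ∈ multiHom e := by
  obtain ⟨S, c, f, hf, hS⟩ := exists_powForm_eq_sum e h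
  have : (fun p => l (powForm e h p)) = ∑ s, l (c s) • f s := by
    funext p
    rw [hS, map_sum, Finset.sum_apply]
    exact Finset.sum_congr rfl fun s _ => by rw [map_smul, smul_eq_mul, mul_comm]; rfl
  rw [this]
  exact Submodule.sum_mem _ fun s _ => Submodule.smul_mem _ _ (hf s)

/-- Symmetric algebra elements of degree `q` evaluated at products of linear forms. -/
theorem evalForm_mem_multiHom {q : ℕ} (x : symPowZ (Forms n) (Int.ofNat q)) :
    (fun p => evalForm (powForm (n := n) (fun _ => 1) (by simp) p) _ x) ∈
      multiHom (n := n) fun _ => q := by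
  obtain ⟨x, hx⟩ := x
  change (fun p => evalAt _ x) ∈ _
  change x ∈ symPow (Forms n) q at hx
  induction q generalizing x with
  | zero =>
    obtain ⟨a, rfl⟩ : ∃ a : ℂ, algebraMap ℂ _ a = x := by
      simpa [symPow, Submodule.mem_one] using hx
    have := Submodule.smul_mem _ a (one_mem_multiHom (n := n))
    convert this using 1
    · rfl
    · funext p
      simp [evalAt]
  | succ q ih =>
    rw [symPow, pow_succ] at hx
    induction hx using Submodule.mul_induction_on' with
    | mem_mul_mem y hy z hz =>
      obtain ⟨v, rfl⟩ := hz
      have h1 := ih y hy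
      have h2 := powForm_mem_multiHom (n := n) (fun _ => 1) (by simp) (apolar n v)
      have h3 := mul_mem_multiHom h1 h2
      convert h3 using 1
      · rfl
      · funext p
        simp only [evalAt, map_mul, SymmetricAlgebra.lift_ι_apply]
        rfl
    | add y _ z _ hy hz =>
      have h3 := Submodule.add_mem _ hy hz
      convert h3 using 1
      funext p
      simp [evalAt]

theorem evalForm_mem_multiHom_toNat {q : ℤ} (x : symPowZ (Forms n) q) :
    (fun p => evalForm (powForm (n := n) (fun _ => 1) (by simp) p) _ x) ∈
      multiHom (n := n) fun _ => q.toNat := by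
  cases q with
  | ofNat q => exact evalForm_mem_multiHom x
  | negSucc q =>
    obtain rfl : x = 0 := Subtype.ext x.2
    simp only [map_zero]
    exact Submodule.zero_mem (multiHom _)

theorem pairForm_mem_multiHom {a : ℕ} {q : ℤ} {e : Fin n → ℕ}
    {f : (Fin n → Fin 2 → ℂ) → Forms a}
    (hf : ∀ l : Module.Dual ℂ (Forms a), (fun p => l (f p)) ∈ multiHom e)
    (G : Forms a ⊗[ℂ] symPowZ (Forms n) q) :
    (fun p => pairForm (powForm (fun _ => 1) (by simp) p) (f p) G) ∈
      multiHom (e + fun _ => q.toNat) := by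
  induction G using TensorProduct.induction_on with
  | zero =>
    simp only [map_zero]
    exact Submodule.zero_mem (multiHom _)
  | add x y hx hy =>
    simp only [map_add]
    exact Submodule.add_mem _ hx hy
  | tmul F x =>
    simp only [pairForm_tmul]
    exact mul_mem_multiHom (hf (apolar a F)) (evalForm_mem_multiHom_toNat x)

/-! ### Restriction to the affine chart -/

/-- The points `(1, z_j)`. -/
def aff (z : Fin n → ℂ) (j : Fin n) : Fin 2 → ℂ := ![1, z j]

theorem bracket_aff (z : Fin n → ℂ) (a b : Fin n) : bracket (aff z a) (aff z b) = z b - z a := by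
  simp [bracket, aff]

theorem multiHom_update {d : Fin n → ℕ} {f : (Fin n → Fin 2 → ℂ) → ℂ} (hf : f ∈ multiHom d)
    (p : Fin n → Fin 2 → ℂ) (a : Fin n) :
    ∃ F : Forms (d a), ∀ q, f (Function.update p a q) = eval q F.1 := by
  induction hf using Submodule.span_induction with
  | mem f hf =>
    obtain ⟨v, rfl⟩ := hf
    refine ⟨(∏ j ∈ Finset.univ.erase a, evForm (d j) (p j) (v j)) • v a, fun q => ?_⟩
    simp only
    rw [← Finset.mul_prod_erase _ _ (Finset.mem_univ a), Function.update_self, evForm_apply,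
      Submodule.coe_smul, smul_eval, mul_comm]
    congr 1
    refine Finset.prod_congr rfl fun j hj => ?_
    rw [Function.update_of_ne (Finset.ne_of_mem_erase hj)]
  | zero => exact ⟨0, fun q => by simp⟩
  | add f h _ _ hf hh =>
    obtain ⟨F, hF⟩ := hf
    obtain ⟨H, hH⟩ := hh
    exact ⟨F + H, fun q => by simp [hF, hH]⟩
  | smul c f _ hf =>
    obtain ⟨F, hF⟩ := hf
    exact ⟨c • F, fun q => by simp [hF]⟩

/-- The points are released from the affine chart one at a time; as a function of one point, f is a
binary form, and a binary form vanishing at all (1, z) is zero. -/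
theorem multiHom_eq_zero_of_aff {d : Fin n → ℕ} {f : (Fin n → Fin 2 → ℂ) → ℂ}
    (hf : f ∈ multiHom d) (h : ∀ z, f (aff z) = 0) (p : Fin n → Fin 2 → ℂ) : f p = 0 := by
  have key : ∀ s : Finset (Fin n), ∀ p : Fin n → Fin 2 → ℂ, (∀ j ∉ s, p j 0 = 1) → f p = 0 := by
    intro s
    induction s using Finset.induction_on with
    | empty =>
      intro p hp
      rw [show p = aff fun j => p j 1 from funext fun j => funext fun i => by
        fin_cases i
        · simpa [aff] using hp j (Finset.notMem_empty j)
        · simp [aff]]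
      exact h _
    | insert a s ha ih =>
      intro p hp
      obtain ⟨F, hF⟩ := multiHom_update hf p a
      have h0 : F.1 = 0 := forms_eq_zero_of_affine F.2 fun z => by
        rw [← hF]
        refine ih _ fun j hj => ?_
        by_cases hja : j = a
        · subst hja
          simp
        · rw [Function.update_of_ne hja]
          exact hp j (by simp [hja, hj])
      rw [← Function.update_eq_self a p, hF, h0, map_zero]
  exact key Finset.univ p fun j hj => absurd (Finset.mem_univ j) hj

theorem exists_affine_poly {d : Fin n → ℕ} {f : (Fin n → Fin 2 → ℂ) → ℂ} (hf : f ∈ multiHom d) :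
    ∃ F : MvPolynomial (Fin n) ℂ, (∀ j, degreeOf j F ≤ d j) ∧ ∀ z, eval z F = f (aff z) := by
  induction hf using Submodule.span_induction with
  | mem f hf =>
    obtain ⟨v, rfl⟩ := hf
    let G : Fin n → MvPolynomial (Fin n) ℂ := fun j =>
      ∑ ab ∈ Finset.HasAntidiagonal.antidiagonal (d j), C (coeff (expo ab) (v j).1) * X j ^ ab.2
    refine ⟨∏ j, G j, fun j => ?_, fun z => ?_⟩
    · refine (degreeOf_prod_le j Finset.univ G).trans ?_
      rw [Finset.sum_eq_single j]
      · refine (degreeOf_sum_le j _ _).trans (Finset.sup_le fun ab hab => ?_)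
        refine (degreeOf_C_mul_le _ _ _).trans ?_
        rw [degreeOf_X_self_pow]
        have := Finset.HasAntidiagonal.mem_antidiagonal.1 hab
        omega
      · intro k _ hk
        rw [← Nat.le_zero]
        refine (degreeOf_sum_le j _ _).trans (Finset.sup_le fun ab hab => ?_)
        refine (degreeOf_C_mul_le _ _ _).trans ?_
        rw [degreeOf_X_pow_of_ne _ hk.symm]
      · simp
    · rw [map_prod]
      refine Finset.prod_congr rfl fun j _ => ?_
      rw [evForm_apply, eval_forms]
      simp [G, aff]
  | zero => exact ⟨0, fun j => by simp, fun z => by simp⟩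
  | add f h _ _ hf hh =>
    obtain ⟨F, hF1, hF2⟩ := hf
    obtain ⟨H, hH1, hH2⟩ := hh
    exact ⟨F + H, fun j => (degreeOf_add_le j F H).trans (max_le (hF1 j) (hH1 j)),
      fun z => by simp [hF2, hH2]⟩
  | smul c f _ hf =>
    obtain ⟨F, hF1, hF2⟩ := hf
    refine ⟨C c * F, fun j => (degreeOf_C_mul_le _ _ _).trans (hF1 j), fun z => by simp [hF2]⟩

/-- Multiplying by the product of all differences takes care of coinciding coordinates, and this
product is a nonzero polynomial. -/
theorem multiHom_eq_zero_of_injective {d : Fin n → ℕ} {f : (Fin n → Fin 2 → ℂ) → ℂ}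
    (hf : f ∈ multiHom d) (h : ∀ z, Function.Injective z → f (aff z) = 0)
    (p : Fin n → Fin 2 → ℂ) : f p = 0 := by
  refine multiHom_eq_zero_of_aff hf (fun z => ?_) p
  obtain ⟨F, -, hF⟩ := exists_affine_poly hf
  let D : MvPolynomial (Fin n) ℂ := ∏ i, ∏ j ∈ Finset.univ.erase i, (X i - X j)
  have hD : D ≠ 0 := by
    refine Finset.prod_ne_zero_iff.2 fun i _ => Finset.prod_ne_zero_iff.2 fun j hj => ?_
    rw [sub_ne_zero]
    exact fun h => Finset.ne_of_mem_erase hj (X_injective h).symm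
  have h0 : F * D = 0 := by
    refine MvPolynomial.funext fun z => ?_
    rw [map_mul, map_zero]
    by_cases hz : Function.Injective z
    · rw [hF, h z hz, zero_mul]
    · obtain ⟨i, j, hij, hne⟩ : ∃ i j, z i = z j ∧ i ≠ j := by
        simpa [Function.Injective] using hz
      have : eval z D = 0 := by
        simp only [D, map_prod]
        refine Finset.prod_eq_zero (Finset.mem_univ i) (Finset.prod_eq_zero
          (Finset.mem_erase.2 ⟨hne.symm, Finset.mem_univ j⟩) ?_)
        simp [hij]
      rw [this, mul_zero]
  rw [← hF, (mul_eq_zero.1 h0).resolve_right hD, map_zero]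

/-! ## Dehomogenization -/

/-- Dehomogenization of binary forms, by the substitution `(x, y) ↦ (r, -1)`. -/
def dehom : BinPoly →ₐ[ℂ] Polynomial ℂ := aeval ![Polynomial.X, -1]

theorem eval_dehom (F : BinPoly) (r : ℂ) : (dehom F).eval r = eval ![r, -1] F := by
  have : (Polynomial.aeval r).comp dehom = aeval (R := ℂ) ![r, -1] := by
    ext i
    fin_cases i <;> simp [dehom]
  simpa [aeval_eq_eval, Polynomial.coe_aeval_eq_eval] using DFunLike.congr_fun this F

theorem dehom_eq_zero {N : ℕ} {F : BinPoly} (hF : F.IsHomogeneous N) (h : dehom F = 0) : F = 0 := by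
  have h1 : F * X 1 = 0 := by
    refine MvPolynomial.funext fun p => ?_
    rw [map_mul, eval_X, map_zero]
    by_cases hp : p 1 = 0
    · rw [hp, mul_zero]
    · have e : p = (-p 1) • ![-(p 0 / p 1), -1] := by
        funext j
        fin_cases j
        · simp [mul_div_cancel₀ _ hp]
        · simp
      rw [e, eval_smul_of_isHomogeneous hF, ← eval_dehom, h, Polynomial.eval_zero, mul_zero,
        zero_mul]
  exact (mul_eq_zero.1 h1).resolve_right (X_ne_zero _)

theorem natDegree_dehom_le {N : ℕ} (F : Forms N) : (dehom F.1).natDegree ≤ N := by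
  rw [forms_eq_sum F, map_sum]
  refine Polynomial.natDegree_sum_le_of_forall_le _ _ fun ab hab => ?_
  have e : dehom (monomial (expo ab) (coeff (expo ab) F.1)) =
      Polynomial.C (coeff (expo ab) F.1 * (-1) ^ ab.2) * Polynomial.X ^ ab.1 := by
    rw [dehom, aeval_monomial, expo, Finsupp.prod_add_index' (by simp) (by intros; rw [pow_add])]
    simp
    ring
  rw [e]
  refine (Polynomial.natDegree_C_mul_X_pow_le _ _).trans ?_
  have := Finset.HasAntidiagonal.mem_antidiagonal.1 hab
  omega

theorem exists_dehom_eq {N : ℕ} {f : Polynomial ℂ} (hf : f.natDegree ≤ N) :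
    ∃ F : Forms N, dehom F.1 = f := by
  refine ⟨∑ k : Fin (N + 1), (f.coeff k * (-1) ^ (N - k : ℕ)) • ⟨X 0 ^ (k : ℕ) * X 1 ^ (N - k : ℕ),
    by
    have := (isHomogeneous_X_pow (R := ℂ) (0 : Fin 2) (k : ℕ)).mul
      (isHomogeneous_X_pow (R := ℂ) (1 : Fin 2) (N - k : ℕ))
    rwa [Nat.add_sub_cancel' (Nat.le_of_lt_succ k.2)] at this⟩, ?_⟩
  conv_rhs => rw [f.as_sum_range' (N + 1) (Nat.lt_succ_of_le hf)]
  rw [AddSubmonoidClass.coe_finsetSum, map_sum,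
    ← Fin.sum_univ_eq_sum_range (fun k => Polynomial.monomial k (f.coeff k)) (N + 1)]
  refine Finset.sum_congr rfl fun k _ => ?_
  rw [Submodule.coe_smul, map_smul, map_mul, map_pow, map_pow]
  simp only [dehom, aeval_X, Matrix.cons_val_zero, Matrix.cons_val_one]
  rw [← Polynomial.C_mul_X_pow_eq_monomial, Polynomial.smul_eq_C_mul, map_mul, map_pow, map_neg,
    Polynomial.C_1]
  have h : ((-1 : Polynomial ℂ) ^ (N - k : ℕ)) * (-1) ^ (N - k : ℕ) = 1 := by
    rw [← mul_pow]
    simp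
  linear_combination Polynomial.C (f.coeff k) * Polynomial.X ^ (k : ℕ) * h

theorem derivative_dehom (F : BinPoly) :
    Polynomial.derivative (dehom F) = dehom (pderiv 0 F) := by
  induction F using MvPolynomial.induction_on with
  | C a => simp [dehom]
  | add F G hF hG => simp only [map_add, hF, hG]
  | mul_X F j hF =>
    rw [map_mul, Polynomial.derivative_mul, hF, Derivation.leibniz, smul_eq_mul, smul_eq_mul,
      map_add, map_mul, map_mul]
    fin_cases j
    · simp [dehom]
      ring
    · simp [dehom]

theorem dehom_pderiv_one {N : ℕ} (F : Forms N) :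
    dehom (pderiv 1 F.1) =
      Polynomial.X * Polynomial.derivative (dehom F.1) - (N : Polynomial ℂ) * dehom F.1 := by
  have h := congrArg dehom (F.2 : F.1.IsHomogeneous N).sum_X_mul_pderiv
  simp only [Fin.sum_univ_two, map_add, map_mul, nsmul_eq_mul, map_natCast] at h
  have e0 : dehom (X 0) = Polynomial.X := by simp [dehom]
  have e1 : dehom (X 1) = -1 := by simp [dehom]
  rw [e0, e1] at h
  rw [derivative_dehom]
  linear_combination -h

/-- Euler's relation eliminates the second partial derivatives. What remains is (N + 1) P² (f / P)',
which is why Jacobians with P have no residues after division by P². -/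
theorem dehom_jacobian {N : ℕ} (P F : Forms (N + 1)) :
    dehom (jacobian N P F).1 = (N + 1 : Polynomial ℂ) *
      (dehom P.1 * Polynomial.derivative (dehom F.1) -
        Polynomial.derivative (dehom P.1) * dehom F.1) := by
  change dehom (pderiv 0 P.1 * pderiv 1 F.1 - pderiv 1 P.1 * pderiv 0 F.1) = _
  rw [map_sub, map_mul, map_mul, dehom_pderiv_one, dehom_pderiv_one, ← derivative_dehom,
    ← derivative_dehom]
  push_cast
  ring

/-- The sign in the substitution (r, -1) is chosen so that the linear form of the point (1, z) gets
the root z. -/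
theorem dehom_linPoly {n : ℕ} (z : Fin n → ℂ) (j : Fin n) :
    dehom (linPoly (aff z j)) = Polynomial.X - Polynomial.C (z j) := by
  simp [linPoly, aff, dehom, Fin.sum_univ_two, sub_eq_add_neg]

theorem dehom_powForm {n N : ℕ} (e : Fin n → ℕ) (h : ∑ j, e j = N) (z : Fin n → ℂ) :
    dehom (powForm e h (aff z)).1 = ∏ j, (Polynomial.X - Polynomial.C (z j)) ^ e j := by
  change dehom (∏ j, linPoly (aff z j) ^ e j) = _
  simp [map_prod, dehom_linPoly]

/-! ## Test forms -/

/-- The exponents of the test forms `ℓ_a ℓ_b ∏ ℓ_l ^ 2`. -/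
def testExp {n : ℕ} (a b l : Fin n) : ℕ := 2 - (if l = a then 1 else 0) - (if l = b then 1 else 0)

theorem testExp_add {n : ℕ} (a b l : Fin n) :
    testExp a b l + ((if l = a then 1 else 0) + (if l = b then 1 else 0)) = 2 := by
  unfold testExp
  split_ifs <;> rfl

theorem sum_testExp {m : ℕ} (a b : Fin (m + 2)) : ∑ l, testExp a b l = 2 * (m + 1) := by
  have h := Finset.sum_congr (s₁ := Finset.univ) rfl fun l _ => testExp_add a b l
  rw [Finset.sum_add_distrib, Finset.sum_add_distrib] at h
  simp at h
  omega

/-- The form `ℓ_a ℓ_b ∏_{l ≠ a, b} ℓ_l ^ 2` attached to points `p`. -/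
def testForm {m : ℕ} (a b : Fin (m + 2)) (p : Fin (m + 2) → Fin 2 → ℂ) : Forms (2 * (m + 1)) :=
  powForm (testExp a b) (sum_testExp a b) p

/-- The product of the linear forms attached to points. -/
def prodForm {n : ℕ} (p : Fin n → Fin 2 → ℂ) : Forms n := powForm (fun _ => 1) (by simp) p

theorem prodForm_comp {n : ℕ} (p : Fin n → Fin 2 → ℂ) (π : Equiv.Perm (Fin n)) :
    prodForm (p ∘ π) = prodForm p :=
  Subtype.ext (Equiv.prod_comp π fun j => linPoly (p j) ^ 1)

theorem testForm_comp {m : ℕ} (a b : Fin (m + 2)) (p : Fin (m + 2) → Fin 2 → ℂ)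
    (π : Equiv.Perm (Fin (m + 2))) : testForm a b (p ∘ π) = testForm (π a) (π b) p := by
  apply Subtype.ext
  change ∏ j, linPoly (p (π j)) ^ testExp a b j = ∏ j, linPoly (p j) ^ testExp (π a) (π b) j
  conv_rhs => rw [← Equiv.prod_comp π]
  simp [testExp]

theorem testForm_comm {m : ℕ} (a b : Fin (m + 2)) (p : Fin (m + 2) → Fin 2 → ℂ) :
    testForm a b p = testForm b a p := by
  apply Subtype.ext
  change ∏ j, linPoly (p j) ^ testExp a b j = ∏ j, linPoly (p j) ^ testExp b a j
  simp [testExp, Nat.sub_right_comm]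

theorem dehom_testForm {m : ℕ} {a b : Fin (m + 2)} (hab : a ≠ b) (z : Fin (m + 2) → ℂ) :
    dehom (testForm a b (aff z)).1 = (Polynomial.X - Polynomial.C (z a)) *
      ((Polynomial.X - Polynomial.C (z b)) *
        ∏ l ∈ (Finset.univ.erase a).erase b, (Polynomial.X - Polynomial.C (z l)) ^ 2) := by
  rw [testForm, dehom_powForm, ← Finset.mul_prod_erase _ _ (Finset.mem_univ a),
    ← Finset.mul_prod_erase _ _ (Finset.mem_erase.2 ⟨hab.symm, Finset.mem_univ b⟩)]
  congr 1
  · simp [testExp, hab]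
  congr 1
  · simp [testExp, hab.symm]
  refine Finset.prod_congr rfl fun l hl => ?_
  have h1 := Finset.ne_of_mem_erase hl
  have h2 := Finset.ne_of_mem_erase (Finset.mem_of_mem_erase hl)
  simp [testExp, h1, h2]

theorem eval_derivative_X_sub_C_mul (z : ℂ) (f : Polynomial ℂ) :
    (Polynomial.derivative ((Polynomial.X - Polynomial.C z) * f)).eval z = f.eval z := by
  simp

theorem X_sub_C_sq_dvd {z : ℂ} {f : Polynomial ℂ} (h : f.eval z = 0)
    (h' : (Polynomial.derivative f).eval z = 0) : (Polynomial.X - Polynomial.C z) ^ 2 ∣ f := by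
  obtain ⟨k, rfl⟩ := Polynomial.dvd_iff_isRoot.2 h
  rw [eval_derivative_X_sub_C_mul] at h'
  obtain ⟨k, rfl⟩ := Polynomial.dvd_iff_isRoot.2 h'
  exact ⟨k, by ring⟩

/-- A linear form on `S^{2i} U*` which vanishes at the test forms of distinct points, and at the
Jacobians with the product of the corresponding linear forms, is zero. -/
theorem dual_eq_zero_of_test {m : ℕ} {z : Fin (m + 2) → ℂ} (hz : Function.Injective z)
    {l : Module.Dual ℂ (Forms (2 * (m + 1)))} (a : Fin (m + 2))
    (h1 : ∀ c, c ≠ a → l (testForm c a (aff z)) = 0)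
    (h2 : ∀ f : Forms (m + 2), l (jacobian (m + 1) (prodForm (aff z)) f) = 0) : l = 0 := by
  ext h
  rw [LinearMap.zero_apply]
  have hz' : ∀ c d, d ≠ c → z c - z d ≠ 0 := fun c d hcd => sub_ne_zero.2 fun e => hcd (hz e).symm
  -- make the values vanish
  have hP : ∀ c, dehom (prodForm (aff z)).1 = (Polynomial.X - Polynomial.C (z c)) *
      ∏ d ∈ Finset.univ.erase c, (Polynomial.X - Polynomial.C (z d)) := by
    intro c
    rw [prodForm, dehom_powForm]
    simp only [pow_one]
    exact (Finset.mul_prod_erase _ (fun d => Polynomial.X - Polynomial.C (z d))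
      (Finset.mem_univ c)).symm
  have hP0 : ∀ c,
      (∏ d ∈ Finset.univ.erase c, (Polynomial.X - Polynomial.C (z d))).eval (z c) ≠ 0 := by
    intro c
    rw [Polynomial.eval_prod]
    refine Finset.prod_ne_zero_iff.2 fun d hd => ?_
    simpa using hz' c d (Finset.ne_of_mem_erase hd)
  -- At a root z_c of P the Jacobian takes the value -(m + 2) P'(z_c) f(z_c), and P'(z_c) ≠ 0, so
  -- Lagrange interpolation of f adjusts all values of h at once.
  obtain ⟨f, hf⟩ : ∃ f : Forms (m + 2), ∀ c,
      (dehom (h - jacobian (m + 1) (prodForm (aff z)) f).1).eval (z c) = 0 := by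
    let r : Fin (m + 2) → ℂ := fun c => -(dehom h.1).eval (z c) / ((m + 2) *
      (∏ d ∈ Finset.univ.erase c, (Polynomial.X - Polynomial.C (z d))).eval (z c))
    have hdeg : (Lagrange.interpolate Finset.univ z r).natDegree ≤ m + 2 := by
      refine Polynomial.natDegree_le_of_degree_le ?_
      refine (Lagrange.degree_interpolate_lt r hz.injOn).le.trans ?_
      simp
    obtain ⟨f, hf⟩ := exists_dehom_eq hdeg
    refine ⟨f, fun c => ?_⟩
    have hm : (m : ℂ) + 2 ≠ 0 := by norm_cast
    rw [AddSubgroupClass.coe_sub, map_sub, dehom_jacobian, hf, hP c]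
    simp only [Polynomial.eval_sub, Polynomial.eval_mul, Polynomial.eval_add, Polynomial.eval_one,
      Polynomial.eval_X, Polynomial.eval_C, sub_self, zero_mul, eval_derivative_X_sub_C_mul,
      Lagrange.eval_interpolate_at_node r hz.injOn (Finset.mem_univ c), zero_sub,
      Polynomial.eval_natCast]
    simp only [r]
    have := hP0 c
    push_cast
    field_simp
    ring
  set k := h - jacobian (m + 1) (prodForm (aff z)) f with hk
  -- make all but one of the derivatives vanish
  have hT : ∀ c, c ≠ a →
      (Polynomial.derivative (dehom (testForm c a (aff z)).1)).eval (z c) ≠ 0 := by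
    intro c hc
    rw [dehom_testForm hc, eval_derivative_X_sub_C_mul, Polynomial.eval_mul, Polynomial.eval_prod]
    refine mul_ne_zero (by simpa using hz' c a hc.symm) (Finset.prod_ne_zero_iff.2 fun d hd => ?_)
    have := hz' c d (Finset.ne_of_mem_erase (Finset.mem_of_mem_erase hd))
    simpa using this
  have hT0 : ∀ c d, c ≠ a → d ≠ a → d ≠ c →
      (Polynomial.derivative (dehom (testForm c a (aff z)).1)).eval (z d) = 0 := by
    intro c d hc hd hdc
    rw [dehom_testForm hc, ← Finset.mul_prod_erase _ _ (Finset.mem_erase.2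
      ⟨hd, Finset.mem_erase.2 ⟨hdc, Finset.mem_univ d⟩⟩)]
    simp [Polynomial.derivative_pow]
  have hT1 : ∀ c d, c ≠ a → (dehom (testForm c a (aff z)).1).eval (z d) = 0 := by
    intro c d hc
    rw [dehom_testForm hc]
    by_cases hd : d = c
    · simp [hd]
    by_cases hd' : d = a
    · simp [hd']
    rw [← Finset.mul_prod_erase _ _ (Finset.mem_erase.2
      ⟨hd', Finset.mem_erase.2 ⟨hd, Finset.mem_univ d⟩⟩)]
    simp
  -- The test form of c and a has simple zeros at z_c and z_a and double zeros at the other points.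
  -- Subtracting a multiple of it corrects the derivative at z_c and disturbs no other derivative
  -- except the one at z_a.
  let s : Fin (m + 2) → ℂ := fun c => (Polynomial.derivative (dehom k.1)).eval (z c) /
    (Polynomial.derivative (dehom (testForm c a (aff z)).1)).eval (z c)
  set k' := k - ∑ c ∈ Finset.univ.erase a, s c • testForm c a (aff z) with hk'
  have hdk' : dehom k'.1 = dehom k.1 - ∑ c ∈ Finset.univ.erase a,
      Polynomial.C (s c) * dehom (testForm c a (aff z)).1 := by
    rw [hk', AddSubgroupClass.coe_sub, map_sub, AddSubmonoidClass.coe_finsetSum, map_sum]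
    simp [Polynomial.smul_eq_C_mul]
  have v1 : ∀ d, (dehom k'.1).eval (z d) = 0 := by
    intro d
    rw [hdk', Polynomial.eval_sub, hf, Polynomial.eval_finsetSum, Finset.sum_eq_zero, sub_zero]
    intro c hc
    rw [Polynomial.eval_mul, hT1 c d (Finset.ne_of_mem_erase hc), mul_zero]
  have v2 : ∀ d, d ≠ a → (Polynomial.derivative (dehom k'.1)).eval (z d) = 0 := by
    intro d hd
    rw [hdk', map_sub, map_sum, Polynomial.eval_sub, Polynomial.eval_finsetSum,
      Finset.sum_eq_single d]
    · rw [Polynomial.derivative_C_mul, Polynomial.eval_mul, Polynomial.eval_C]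
      simp only [s]
      rw [div_mul_cancel₀ _ (hT d hd), sub_self]
    · intro c hc hcd
      rw [Polynomial.derivative_C_mul, Polynomial.eval_mul,
        hT0 c d (Finset.ne_of_mem_erase hc) hd hcd.symm, mul_zero]
    · intro h
      exact absurd (Finset.mem_erase.2 ⟨hd, Finset.mem_univ d⟩) h
  have hdvd : ∏ d, (Polynomial.X - Polynomial.C (z d)) ^ (if d = a then 1 else 2) ∣ dehom k'.1 := by
    refine Finset.prod_dvd_of_coprime (fun c _ d _ hcd => ?_) fun d _ => ?_
    · exact (Polynomial.isCoprime_X_sub_C_of_isUnit_sub (isUnit_iff_ne_zero.2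
        (hz' c d hcd.symm))).pow
    · split_ifs with hd
      · rw [pow_one]
        exact Polynomial.dvd_iff_isRoot.2 (v1 d)
      · exact X_sub_C_sq_dvd (v1 d) (v2 d hd)
  -- With double zeros everywhere except for a simple one at z_a, there are 2(m + 1) + 1 zeros, one
  -- more than the degree allows.
  have hk0 : dehom k'.1 = 0 := by
    by_contra hne
    have h3 := Polynomial.natDegree_le_of_dvd hdvd hne
    have h4 : (∏ d, (Polynomial.X - Polynomial.C (z d)) ^ (if d = a then 1 else 2)).natDegree =
        2 * (m + 1) + 1 := by
      rw [Polynomial.natDegree_prod_of_monic _ _ fun d _ => (Polynomial.monic_X_sub_C _).pow _]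
      simp only [Polynomial.natDegree_pow, Polynomial.natDegree_X_sub_C, mul_one]
      rw [← Finset.add_sum_erase _ _ (Finset.mem_univ a), if_pos rfl,
        Finset.sum_congr rfl fun d hd => if_neg (Finset.ne_of_mem_erase hd)]
      simp
      ring
    have h5 := natDegree_dehom_le k'
    omega
  have hk0' : k' = 0 := Subtype.ext (dehom_eq_zero k'.2 hk0)
  have h6 : l k' = l h := by
    rw [hk', hk, map_sub, map_sub, h2, map_sum, Finset.sum_eq_zero, sub_zero, sub_zero]
    intro c hc
    rw [map_smul, h1 c (Finset.ne_of_mem_erase hc), smul_zero]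
  rw [← h6, hk0', map_zero]

/-! ## Discriminants -/

theorem bracket_self (p : Fin 2 → ℂ) : bracket p p = 0 := by
  unfold bracket
  ring

theorem bracket_symm (p q : Fin 2 → ℂ) : bracket p q = -bracket q p := by
  unfold bracket
  ring

theorem bracket_vecMul (p q : Fin 2 → ℂ) (A : SL2) :
    bracket (Matrix.vecMul p A.1) (Matrix.vecMul q A.1) = bracket p q := by
  have h := A.2
  rw [Matrix.det_fin_two] at h
  simp only [bracket, Matrix.vecMul, dotProduct, Fin.sum_univ_two]
  linear_combination (p 0 * q 1 - p 1 * q 0) * h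

/-- The product of the brackets of all pairs of points. -/
def disc {n : ℕ} (p : Fin n → Fin 2 → ℂ) : ℂ := ∏ i, ∏ j ∈ Finset.Ioi i, bracket (p i) (p j)

theorem disc_eq_det {n : ℕ} (p : Fin n → Fin 2 → ℂ) :
    disc p = (Matrix.projVandermonde (fun j => p j 1) fun j => p j 0).det := by
  rw [Matrix.det_projVandermonde, disc]
  refine Finset.prod_congr rfl fun i _ => Finset.prod_congr rfl fun j _ => ?_
  unfold bracket
  ring

theorem disc_comp {n : ℕ} (p : Fin n → Fin 2 → ℂ) (π : Equiv.Perm (Fin n)) :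
    disc (p ∘ π) = (Equiv.Perm.sign π : ℤ) * disc p := by
  rw [disc_eq_det, disc_eq_det, ← Matrix.det_permute]
  rfl

theorem disc_vecMul {n : ℕ} (p : Fin n → Fin 2 → ℂ) (A : SL2) :
    (disc fun j => Matrix.vecMul (p j) A.1) = disc p := by
  simp only [disc, bracket_vecMul]

theorem disc_eq_zero {n : ℕ} (p : Fin n → Fin 2 → ℂ) {a b : Fin n} (hab : a ≠ b)
    (h : bracket (p a) (p b) = 0) : disc p = 0 := by
  wlog hlt : a < b generalizing a b
  · exact this hab.symm (by rw [bracket_symm, h, neg_zero]) (lt_of_le_of_ne (not_lt.1 hlt) hab.symm)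
  exact Finset.prod_eq_zero (Finset.mem_univ a) (Finset.prod_eq_zero (Finset.mem_Ioi.2 hlt) h)

theorem disc_aff_ne_zero {n : ℕ} {z : Fin n → ℂ} (hz : Function.Injective z) :
    disc (aff z) ≠ 0 := by
  refine Finset.prod_ne_zero_iff.2 fun i _ => Finset.prod_ne_zero_iff.2 fun j hj => ?_
  rw [bracket_aff, sub_ne_zero]
  exact fun h => (Finset.mem_Ioi.1 hj).ne' (hz h)

/-- The discriminant is a Vandermonde determinant, and each term of its Leibniz expansion is a
product of monomials of degree n, one for each point. -/
theorem disc_mem_multiHom (n : ℕ) :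
    (disc : (Fin (n + 1) → Fin 2 → ℂ) → ℂ) ∈ multiHom fun _ : Fin (n + 1) => n := by
  have : (disc : (Fin (n + 1) → Fin 2 → ℂ) → ℂ) = ∑ σ : Equiv.Perm (Fin (n + 1)),
      ((Equiv.Perm.sign σ : ℤ) : ℂ) • fun p : Fin (n + 1) → Fin 2 → ℂ =>
        ∏ j, evForm n (p j) ⟨X 1 ^ (σ j : ℕ) * X 0 ^ ((σ j).rev : ℕ), by
          have := (isHomogeneous_X_pow (R := ℂ) (1 : Fin 2) (σ j : ℕ)).mul
            (isHomogeneous_X_pow (R := ℂ) (0 : Fin 2) ((σ j).rev : ℕ))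
          rwa [show (σ j : ℕ) + ((σ j).rev : ℕ) = n by rw [Fin.val_rev]; omega] at this⟩ := by
    funext p
    rw [disc_eq_det, ← Matrix.det_transpose, Matrix.det_apply', Finset.sum_apply]
    refine Finset.sum_congr rfl fun σ _ => ?_
    simp [evForm_apply, Matrix.projVandermonde_apply]
  rw [this]
  exact Submodule.sum_mem _ fun σ _ => Submodule.smul_mem _ _ (prod_mem_multiHom _)

theorem exists_perm_zero_one {m : ℕ} {a b : Fin (m + 2)} (hab : a ≠ b) :
    ∃ π : Equiv.Perm (Fin (m + 2)), π 0 = a ∧ π 1 = b := by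
  have h : Equiv.swap 0 a b ≠ 0 := by
    intro h
    rw [Equiv.swap_apply_eq_iff, Equiv.swap_apply_left] at h
    exact hab h.symm
  refine ⟨Equiv.swap 0 a * Equiv.swap 1 (Equiv.swap 0 a b), ?_, ?_⟩
  · rw [Equiv.Perm.mul_apply, Equiv.swap_apply_of_ne_of_ne (by simp) h.symm, Equiv.swap_apply_left]
  · rw [Equiv.Perm.mul_apply, Equiv.swap_apply_left, Equiv.swap_apply_self]

/-! ## The functions attached to elements of the source of `γ'` -/

/-- The function of `m + 2` points attached to an element of `S^{2i} U ⊗ S^q S^{i+1} U`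
(where `i = m + 1`) and two indices. -/
def testEval {m : ℕ} {q : ℤ} (a b : Fin (m + 2))
    (G : Forms (2 * (m + 1)) ⊗[ℂ] symPowZ (Forms (m + 2)) q) (p : Fin (m + 2) → Fin 2 → ℂ) : ℂ :=
  disc p * bracket (p a) (p b) * pairForm (prodForm p) (testForm a b p) G

section testEval

variable {m : ℕ} {q : ℤ} (a b c : Fin (m + 2))
  (G : Forms (2 * (m + 1)) ⊗[ℂ] symPowZ (Forms (m + 2)) q) (p : Fin (m + 2) → Fin 2 → ℂ)

theorem testEval_self : testEval a a G p = 0 := by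
  rw [testEval, bracket_self, mul_zero, zero_mul]

theorem testEval_symm : testEval a b G p = -testEval b a G p := by
  rw [testEval, testEval, testForm_comm, bracket_symm]
  ring

theorem testEval_comp (π : Equiv.Perm (Fin (m + 2))) :
    testEval a b G (p ∘ π) = (Equiv.Perm.sign π : ℤ) * testEval (π a) (π b) G p := by
  rw [testEval, testEval, disc_comp, prodForm_comp, testForm_comp]
  simp only [Function.comp_apply]
  ring

theorem testEval_vecMul (A : SL2) :
    testEval a b (TensorProduct.map (formAct A _) (symPowMap (formAct A _) q) G) p =
      testEval a b G fun j => Matrix.vecMul (p j) A.1 := by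
  rw [testEval, testEval, pairForm_map, disc_vecMul, bracket_vecMul, prodForm, prodForm,
    testForm, testForm, formAct_powForm, formAct_powForm]

/-- In each point the discriminant has degree m + 1, the bracket and the test form together have
degree 2, and the symmetric power contributes q. For q = g - i - 2 ≥ 0 the sum is g. -/
theorem testEval_mem_multiHom : testEval a b G ∈ multiHom fun _ => m + 3 + q.toNat := by
  have h := mul_mem_multiHom (mul_mem_multiHom (disc_mem_multiHom (m + 1))
    (bracket_mem_multiHom a b)) (pairForm_mem_multiHom (q := q) (f := testForm a b)
      (fun l => powForm_mem_multiHom _ (sum_testExp a b) l) G)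
  have e : ((fun _ : Fin (m + 2) => m + 1) + (Pi.single a 1 + Pi.single b 1) +
      (testExp a b + fun _ => q.toNat)) = fun _ => m + 3 + q.toNat := by
    funext l
    have := testExp_add a b l
    simp only [Pi.add_apply, Pi.single_apply]
    omega
  rw [e] at h
  exact h

/-- After removal of the common factor this is the identity [a b] ℓ_c + [b c] ℓ_a = [a c] ℓ_b
between linear forms. -/
theorem pluecker_testForm (hab : a ≠ b) (hbc : b ≠ c) (hac : a ≠ c) :
    bracket (p a) (p b) • testForm a b p + bracket (p b) (p c) • testForm b c p =
      bracket (p a) (p c) • testForm a c p := by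
  let e : Fin (m + 2) → ℕ := fun l => 2 - (if l = a then 1 else 0) - (if l = b then 1 else 0) -
    (if l = c then 1 else 0)
  have key : ∀ u v w : Fin (m + 2), u ≠ v → v ≠ w → u ≠ w →
      (∀ l, e l = 2 - (if l = u then 1 else 0) - (if l = v then 1 else 0) -
        (if l = w then 1 else 0)) →
      (testForm u v p).1 = (∏ l, linPoly (p l) ^ e l) * linPoly (p w) := by
    intro u v w huv hvw huw he
    have h : linPoly (p w) = ∏ l, linPoly (p l) ^ (if l = w then 1 else 0) := by
      simp
    change ∏ l, linPoly (p l) ^ testExp u v l = _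
    rw [h, ← Finset.prod_mul_distrib]
    refine Finset.prod_congr rfl fun l _ => ?_
    rw [← pow_add, he, testExp]
    congr 1
    split_ifs <;> simp_all
  apply Subtype.ext
  simp only [Submodule.coe_add, Submodule.coe_smul, smul_eq_C_mul]
  rw [key a b c hab hbc hac fun _ => rfl, key b c a hbc hac.symm hab.symm fun l => by
    simp only [e]; omega, key a c b hac hbc.symm hab fun l => by simp only [e]; omega]
  simp only [linPoly, Fin.sum_univ_two, bracket, C_sub, C_mul]
  ring

/-- This cocycle relation makes `testEval a b` a difference of a term depending on a and one
depending on b, as the values of a Koszul cycle require. -/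
theorem testEval_add : testEval a b G p + testEval b c G p = testEval a c G p := by
  by_cases hab : a = b
  · rw [hab, testEval_self, zero_add]
  by_cases hbc : b = c
  · rw [hbc, testEval_self, add_zero]
  by_cases hac : a = c
  · rw [hac, testEval_self, testEval_symm, neg_add_cancel]
  have h := congrArg (pairFormLin G (prodForm p)) (pluecker_testForm a b c p hab hbc hac)
  simp only [map_add, map_smul, pairFormLin_apply, smul_eq_mul] at h
  simp only [testEval]
  linear_combination disc p * h

end testEval

/-- The linear map attaching functions of `m + 2` points to the elements of
`S^{2i} U ⊗ S^q S^{i+1} U`, where `i = m + 1`. -/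
def formEval (m : ℕ) (q : ℤ) : Forms (2 * (m + 1)) ⊗[ℂ] symPowZ (Forms (m + 2)) q →ₗ[ℂ]
    ((Fin (m + 2) → Fin 2 → ℂ) → ℂ) where
  toFun G := testEval 0 1 G
  map_add' x y := by
    funext p
    simp [testEval, mul_add]
  map_smul' c x := by
    funext p
    simp [testEval, mul_left_comm]

theorem formEval_apply {m : ℕ} {q : ℤ} (G : Forms (2 * (m + 1)) ⊗[ℂ] symPowZ (Forms (m + 2)) q)
    (p : Fin (m + 2) → Fin 2 → ℂ) : formEval m q G p = testEval 0 1 G p := rfl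

/-! ### Equivariance of the Jacobian, and injectivity of `formEval` on the kernel -/

theorem jacobian_formAct (A : SL2) (n : ℕ) (P f : Forms (n + 1)) :
    jacobian n (formAct A _ P) (formAct A _ f) = formAct A _ (jacobian n P f) := by
  apply Subtype.ext
  refine MvPolynomial.funext fun p => ?_
  change eval p (pderiv 0 (binSubst A P.1) * pderiv 1 (binSubst A f.1) -
    pderiv 1 (binSubst A P.1) * pderiv 0 (binSubst A f.1)) =
      eval p (binSubst A (pderiv 0 P.1 * pderiv 1 f.1 - pderiv 1 P.1 * pderiv 0 f.1))
  have h0 := fun F => deriv_binSubst A p ![1, 0] F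
  have h1 := fun F => deriv_binSubst A p ![0, 1] F
  have he := fun F => eval_binSubst A p F
  simp only [aeval_eq_eval, Fin.sum_univ_two, Matrix.vecMul, dotProduct,
    Matrix.cons_val_zero, Matrix.cons_val_one, one_mul, zero_mul, add_zero, zero_add] at h0 h1 he
  have hd := A.2
  rw [Matrix.det_fin_two] at hd
  rw [he]
  simp only [map_sub, map_mul, h0, h1]
  generalize eval _ (pderiv 0 P.1) = x
  generalize eval _ (pderiv 1 P.1) = y
  generalize eval _ (pderiv 0 f.1) = z
  generalize eval _ (pderiv 1 f.1) = w
  linear_combination (x * w - y * z) * hd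

theorem sourceAct_mem_ker (A : SL2) (g m : ℕ)
    {G : Forms (2 * (m + 1)) ⊗[ℂ] symPowZ (Forms (m + 1 + 1)) ((g : ℤ) - (m + 1 : ℕ) - 2)}
    (hG : G ∈ LinearMap.ker (gammaPrime g (m + 1))) :
    sourceAct A g (m + 1) G ∈ LinearMap.ker (gammaPrime g (m + 1)) := by
  rw [mem_ker_gammaPrime_iff] at hG ⊢
  intro p f
  rw [sourceAct, pairForm_map, ← jacobian_formAct, formAct_powForm]
  exact hG _ _

/-- Permuting the points turns the vanishing of `testEval 0 1` into the vanishing of the functional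
at all test forms of distinct points. It kills Jacobians as well, so `dual_eq_zero_of_test` applies;
distinct points are dense. -/
theorem eq_zero_of_formEval {g m : ℕ}
    {G : Forms (2 * (m + 1)) ⊗[ℂ] symPowZ (Forms (m + 1 + 1)) ((g : ℤ) - (m + 1 : ℕ) - 2)}
    (hG : G ∈ LinearMap.ker (gammaPrime g (m + 1))) (h : formEval m _ G = 0) : G = 0 := by
  rw [mem_ker_gammaPrime_iff] at hG
  refine eq_zero_of_pairForm fun p k => ?_
  refine multiHom_eq_zero_of_injective
    (d := (fun _ => 0) + fun _ => ((g : ℤ) - (m + 1 : ℕ) - 2).toNat)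
    (pairForm_mem_multiHom (f := fun _ => k) (fun l => ?_) G) (fun z hz => ?_) p
  · convert Submodule.smul_mem _ (l k) (one_mem_multiHom (n := m + 1 + 1)) using 1
    · rfl
    · funext p
      simp
  · have h0 : pairFormLin G (prodForm (aff z)) = 0 := by
      refine dual_eq_zero_of_test hz 0 (fun c hc => ?_) fun f => hG (aff z) f
      obtain ⟨π, h0, h1⟩ := exists_perm_zero_one hc
      have e := testEval_comp 0 1 G (aff z) π
      rw [← formEval_apply, h, h0, h1, testEval, Pi.zero_apply] at e
      have hs : ((Equiv.Perm.sign π : ℤ) : ℂ) ≠ 0 := by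
        rcases Int.units_eq_one_or (Equiv.Perm.sign π) with h | h <;> simp [h]
      rw [zero_eq_mul, or_iff_right hs, mul_eq_zero, mul_eq_zero,
        or_iff_right (disc_aff_ne_zero hz), bracket_aff, sub_eq_zero] at e
      exact e.resolve_left fun h => hc (hz h).symm
    exact LinearMap.congr_fun h0 k

/-! ## From the kernel of `γ'` to Koszul cycles -/

/-- The values at points of the rational normal curve of a suitable element of `Λ^{m+1} V ⊗ V`
are the antisymmetrization of a given multihomogeneous function. -/
theorem exists_wedgeEval_eq_sum {g m : ℕ} {Θ : (Fin (m + 2) → Fin 2 → ℂ) → ℂ}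
    (hΘ : Θ ∈ multiHom fun _ => g) : ∃ ω : (⋀[ℂ]^(m + 1) (Forms g)) ⊗[ℂ] Forms g,
      ∀ p, wedgeEval ω (fun j => evForm g (p j)) = ∑ π : Equiv.Perm (Fin (m + 1)),
        (Equiv.Perm.sign π : ℤ) * Θ (p ∘ Equiv.Perm.decomposeFin.symm (0, π)) := by
  induction hΘ using Submodule.span_induction with
  | mem Θ hΘ =>
    obtain ⟨v, rfl⟩ := hΘ
    refine ⟨exteriorPower.ιMulti ℂ (m + 1) (Fin.tail v) ⊗ₜ v 0, fun p => ?_⟩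
    rw [wedgeEval, tensorPair_tmul, wedgePair_ιMulti, ← Matrix.det_transpose, Matrix.det_apply',
      Finset.sum_mul]
    refine Finset.sum_congr rfl fun π _ => ?_
    beta_reduce
    rw [Fin.prod_univ_succ fun j => evForm g ((p ∘ Equiv.Perm.decomposeFin.symm (0, π)) j) (v j)]
    simp only [Matrix.transpose_apply, Matrix.of_apply, Function.comp_apply,
      Equiv.Perm.decomposeFin_symm_apply_zero, Equiv.Perm.decomposeFin_symm_apply_succ,
      Equiv.swap_self, Equiv.refl_apply, Fin.tail]
    ring
  | zero => exact ⟨0, fun p => by simp [wedgeEval]⟩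
  | add a b _ _ ha hb =>
    obtain ⟨x, hx⟩ := ha
    obtain ⟨y, hy⟩ := hb
    refine ⟨x + y, fun p => ?_⟩
    have : wedgeEval (x + y) (fun j => evForm g (p j)) =
        wedgeEval x (fun j => evForm g (p j)) + wedgeEval y (fun j => evForm g (p j)) :=
      map_add _ _ _
    rw [this, hx, hy, ← Finset.sum_add_distrib]
    exact Finset.sum_congr rfl fun π _ => by rw [Pi.add_apply, mul_add]
  | smul c a _ ha =>
    obtain ⟨x, hx⟩ := ha
    refine ⟨c • x, fun p => ?_⟩
    have : wedgeEval (c • x) (fun j => evForm g (p j)) =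
        c * wedgeEval x (fun j => evForm g (p j)) := map_smul _ _ _
    rw [this, hx, Finset.mul_sum]
    exact Finset.sum_congr rfl fun π _ => by rw [Pi.smul_apply, smul_eq_mul]; ring

/-- On a function that is already antisymmetric in the last m + 1 points, antisymmetrization is
multiplication by (m + 1)!. -/
theorem exists_wedgeEval_eq {g m : ℕ} {Θ : (Fin (m + 2) → Fin 2 → ℂ) → ℂ}
    (hΘ : Θ ∈ multiHom fun _ => g)
    (h : ∀ (π : Equiv.Perm (Fin (m + 1))) p, Θ (p ∘ Equiv.Perm.decomposeFin.symm (0, π)) =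
      (Equiv.Perm.sign π : ℤ) * Θ p) :
    ∃ ω : (⋀[ℂ]^(m + 1) (Forms g)) ⊗[ℂ] Forms g,
      ∀ p, wedgeEval ω (fun j => evForm g (p j)) = Θ p := by
  have hf : ((m + 1).factorial : ℂ) ≠ 0 := by exact_mod_cast (m + 1).factorial_ne_zero
  obtain ⟨ω, hω⟩ := exists_wedgeEval_eq_sum
    (Submodule.smul_mem _ ((m + 1).factorial : ℂ)⁻¹ hΘ)
  refine ⟨ω, fun p => ?_⟩
  have hs : ∀ π : Equiv.Perm (Fin (m + 1)),
      ((Equiv.Perm.sign π : ℤ) : ℂ) * ((Equiv.Perm.sign π : ℤ) : ℂ) = 1 := by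
    intro π
    rcases Int.units_eq_one_or (Equiv.Perm.sign π) with h | h <;> simp [h]
  rw [hω]
  simp only [Pi.smul_apply, h, smul_eq_mul]
  rw [Finset.sum_congr rfl fun π _ => show _ = ((m + 1).factorial : ℂ)⁻¹ * Θ p by
    linear_combination (((m + 1).factorial : ℂ)⁻¹ * Θ p) * hs π]
  rw [Finset.sum_const, Finset.card_univ, Fintype.card_perm, Fintype.card_fin, nsmul_eq_mul,
    mul_inv_cancel_left₀ hf]

/-- The cocycle is the coboundary of its averages Θ_a = (m + 2)⁻¹ Σ_c `testEval a c`. The function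
Θ_0 is antisymmetric in the other points and hence comes from some ω. Swapping the first two points
turns it into -Θ_1 because of the sign of the discriminant, so its symmetrization is Θ_0 - Θ_1 =
`testEval 0 1`. -/
theorem exists_symEval_eq {g m : ℕ} {q : ℤ} (hq : m + 3 + q.toNat = g)
    (G : Forms (2 * (m + 1)) ⊗[ℂ] symPowZ (Forms (m + 2)) q) :
    ∃ ω : (⋀[ℂ]^(m + 1) (Forms g)) ⊗[ℂ] Forms g, symEval g m ω = formEval m q G := by
  have hm : (m + 2 : ℂ) ≠ 0 := by norm_cast
  let Θ : (Fin (m + 2) → Fin 2 → ℂ) → ℂ := (m + 2 : ℂ)⁻¹ • ∑ c, testEval 0 c G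
  have hΘ : Θ ∈ multiHom fun _ => g := by
    subst hq
    exact Submodule.smul_mem _ _ (Submodule.sum_mem _ fun c _ => testEval_mem_multiHom 0 c G)
  have hp : ∀ p, Θ p = (m + 2 : ℂ)⁻¹ * ∑ c, testEval 0 c G p := fun p => by
    simp [Θ]
  have hπ : ∀ (π : Equiv.Perm (Fin (m + 2))) p, Θ (p ∘ π) =
      (Equiv.Perm.sign π : ℤ) * ((m + 2 : ℂ)⁻¹ * ∑ c, testEval (π 0) c G p) := by
    intro π p
    simp only [hp, testEval_comp]
    rw [← Finset.mul_sum, Equiv.sum_comp π fun c => testEval (π 0) c G p]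
    ring
  obtain ⟨ω, hω⟩ := exists_wedgeEval_eq hΘ fun π p => by
    rw [hπ, Equiv.Perm.decomposeFin.symm_sign, if_pos rfl, hp,
      Equiv.Perm.decomposeFin_symm_apply_zero, one_mul]
  refine ⟨ω, funext fun p => ?_⟩
  change wedgeEval ω (fun j => evForm g (p j)) +
    wedgeEval ω (fun j => evForm g ((p ∘ Equiv.swap 0 1) j)) = testEval 0 1 G p
  rw [hω, hω, hπ, Equiv.swap_apply_left, hp, Equiv.Perm.sign_swap (by simp)]
  have e : ∑ c, testEval 0 c G p = (m + 2) * testEval 0 1 G p + ∑ c, testEval 1 c G p := by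
    rw [Finset.sum_congr rfl fun c _ => (testEval_add 0 1 c G p).symm, Finset.sum_add_distrib]
    simp
  rw [e]
  push_cast
  field_simp
  ring

/-! ### The cycle condition -/

theorem symEval_apply {g m : ℕ} (ω : (⋀[ℂ]^(m + 1) (Forms g)) ⊗[ℂ] Forms g)
    (p : Fin (m + 2) → Fin 2 → ℂ) :
    symEval g m ω p = wedgeEval ω (fun j => evForm g (p j)) +
      wedgeEval ω (fun j => evForm g (p (Equiv.swap 0 1 j))) := rfl

/-- By Euler's relation for A, two forms with common factor A have a Jacobian proportional to A².
This is the form taken by the test form when its two special points coincide. -/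
theorem jacobian_mul {n : ℕ} (A P f : BinPoly) (hA : A.IsHomogeneous n) (p w : Fin 2 → ℂ)
    (hP : P = A * linPoly p) (hf : f = A * linPoly w) :
    pderiv 0 P * pderiv 1 f - pderiv 1 P * pderiv 0 f =
      C ((n + 1) * bracket p w) * A ^ 2 := by
  have h := hA.sum_X_mul_pderiv
  simp only [Fin.sum_univ_two, nsmul_eq_mul] at h
  subst hP hf
  simp only [linPoly, Fin.sum_univ_two, Derivation.leibniz, map_add, smul_eq_mul, pderiv_X,
    pderiv_C, bracket, map_mul, map_sub, Pi.single_apply, C_1, map_natCast]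
  simp
  linear_combination (C (p 0) * C (w 1) - C (p 1) * C (w 0)) * A * h

/-- The test forms of points which are not distinct are Jacobians. -/
theorem pairForm_testForm_eq_zero {g m : ℕ}
    {G : Forms (2 * (m + 1)) ⊗[ℂ] symPowZ (Forms (m + 1 + 1)) ((g : ℤ) - (m + 1 : ℕ) - 2)}
    (hG : G ∈ LinearMap.ker (gammaPrime g (m + 1))) (p : Fin (m + 2) → Fin 2 → ℂ)
    (h01 : p 0 = p 1) : pairForm (prodForm p) (testForm 0 1 p) G = 0 := by
  rw [mem_ker_gammaPrime_iff] at hG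
  by_cases hp0 : p 0 = 0
  · have : testForm 0 1 p = 0 := by
      apply Subtype.ext
      change ∏ j, linPoly (p j) ^ testExp 0 1 j = 0
      refine Finset.prod_eq_zero (Finset.mem_univ 0) ?_
      rw [hp0]
      simp [linPoly, testExp]
    rw [this, ← pairFormLin_apply, map_zero]
  -- With P = A ℓ_0 and f = A ℓ_w, the Jacobian is a multiple of A², and A² is the test form because
  -- p 0 = p 1. The multiple is nonzero thanks to the choice of w.
  obtain ⟨w, hw⟩ : ∃ w, bracket (p 0) w ≠ 0 := by
    by_contra! h
    apply hp0
    have h1 := h ![0, 1]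
    have h2 := h ![1, 0]
    simp [bracket] at h1 h2
    funext j
    fin_cases j
    · exact h1
    · exact h2
  let A : BinPoly := ∏ j : Fin (m + 1), linPoly (p j.succ)
  have hA : A.IsHomogeneous (m + 1) := by
    have := IsHomogeneous.prod Finset.univ (fun j : Fin (m + 1) => linPoly (p j.succ)) (fun _ => 1)
      fun j _ => linPoly_isHomogeneous _
    simpa using this
  have hP : (prodForm p).1 = A * linPoly (p 0) := by
    change ∏ j, linPoly (p j) ^ 1 = _
    rw [Fin.prod_univ_succ, mul_comm]
    simp [A]
  have hT : (testForm 0 1 p).1 = A ^ 2 := by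
    change ∏ j, linPoly (p j) ^ testExp 0 1 j = _
    have e : ∀ j : Fin m, testExp (0 : Fin (m + 2)) 1 j.succ.succ = 2 := fun j => by
      simp [testExp, Fin.succ_ne_zero, Fin.succ_succ_ne_one]
    simp only [A]
    rw [Fin.prod_univ_succ, Fin.prod_univ_succ, Fin.prod_univ_succ]
    simp only [Fin.succ_zero_eq_one, e, h01, mul_pow, ← Finset.prod_pow]
    simp [testExp]
    ring
  let f : Forms (m + 1 + 1) := ⟨A * linPoly w, hA.mul (linPoly_isHomogeneous w)⟩
  have hj : jacobian (m + 1) (prodForm p) f = (((m + 1 : ℕ) + 1) * bracket (p 0) w : ℂ) •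
      testForm 0 1 p := by
    apply Subtype.ext
    rw [Submodule.coe_smul, smul_eq_C_mul, hT]
    exact jacobian_mul A _ _ hA (p 0) w hP rfl
  have h : pairForm (prodForm p) (jacobian (m + 1) (prodForm p) f) G = 0 := hG p f
  rw [hj, ← pairFormLin_apply, map_smul, smul_eq_mul, mul_eq_zero, pairFormLin_apply] at h
  refine h.resolve_left (mul_ne_zero ?_ hw)
  norm_cast

/-- In coordinates the value of the bilinear form is a polynomial in the entries of the functional,
so pointwise convergence is enough. -/
theorem tendsto_bilin {V : Type*} [AddCommGroup V] [Module ℂ V] [FiniteDimensional ℂ V]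
    {F : Filter ℂ} {d : ℂ → Module.Dual ℂ V} {t : Module.Dual ℂ V}
    (hd : ∀ v, Filter.Tendsto (fun z => d z v) F (nhds (t v)))
    (β : Module.Dual ℂ V →ₗ[ℂ] Module.Dual ℂ V →ₗ[ℂ] ℂ) :
    Filter.Tendsto (fun z => β (d z) (d z)) F (nhds (β t t)) := by
  let b := Module.finBasis ℂ V
  have e : ∀ x : Module.Dual ℂ V,
      β x x = ∑ k, ∑ l, x (b k) * x (b l) * β (b.coord k) (b.coord l) := by
    intro x
    have hx := b.sum_dual_apply_smul_coord x
    conv_lhs => rw [← hx]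
    simp only [map_sum, map_smul, LinearMap.sum_apply, LinearMap.smul_apply, smul_eq_mul,
      Finset.mul_sum]
    rw [Finset.sum_comm]
    exact Finset.sum_congr rfl fun k _ => Finset.sum_congr rfl fun l _ => by ring
  simp only [e]
  exact tendsto_finsetSum _ fun k _ => tendsto_finsetSum _ fun l _ =>
    ((hd (b k)).mul (hd (b l))).mul_const _

theorem hasDerivAt_evForm (g : ℕ) (p w : Fin 2 → ℂ) (F : Forms g) :
    HasDerivAt (fun z : ℂ => evForm g (p + z • w) F) (tangentPoint g p w F) 0 := by
  have h := hasDerivAt_eval F.1 (fun z : ℂ => p + z • w) w 0 fun s => by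
    simpa using ((hasDerivAt_id (0 : ℂ)).mul_const (w s)).const_add (p s)
  simp only [zero_smul, add_zero] at h
  simpa only [evForm_apply, tangentPoint_apply] using h

/-- `wedgeEval` as a bilinear form in its first two arguments. -/
def wedgeBilin {V : Type*} [AddCommGroup V] [Module ℂ V] {m : ℕ} (ω : (⋀[ℂ]^(m + 1) V) ⊗[ℂ] V)
    (φ : Fin m → Module.Dual ℂ V) : Module.Dual ℂ V →ₗ[ℂ] Module.Dual ℂ V →ₗ[ℂ] ℂ :=
  LinearMap.mk₂ ℂ (fun x y => wedgeEvalAlt ω x (Fin.cons y φ)) (fun _ _ _ => by simp)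
    (fun _ _ _ => by simp)
    (fun x y y' => by
      have := (wedgeEvalAlt ω x).map_update_add (Fin.cons 0 φ) 0 y y'
      simpa only [Fin.update_cons_zero] using this)
    (fun c x y => by
      have := (wedgeEvalAlt ω x).map_update_smul (Fin.cons 0 φ) 0 c y
      simpa only [Fin.update_cons_zero] using this)

/-- The symmetrized form S satisfies S(ev_x, ev_y) = `testEval 0 1`, a product of three factors
vanishing at x = y. Let d_z be the difference quotient of evaluation at p in the direction w. Then
S(d_z, d_z) = -2 z⁻² S(ev_p, ev_{p+zw}), which tends to 0, while d_z tends to the tangent point. -/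
theorem mem_koszulCycles_of_symEval_eq {g m : ℕ} (hg : 2 ≤ g)
    {G : Forms (2 * (m + 1)) ⊗[ℂ] symPowZ (Forms (m + 1 + 1)) ((g : ℤ) - (m + 1 : ℕ) - 2)}
    (hG : G ∈ LinearMap.ker (gammaPrime g (m + 1)))
    {ω : (⋀[ℂ]^(m + 1) (Forms g)) ⊗[ℂ] Forms g} (hω : symEval g m ω = formEval m _ G) :
    wedgeLinEquiv hg (m + 1) ω ∈ koszulCycles (sectionsMul g 1) (m + 1) := by
  rw [mem_koszulCycles_iff]
  intro p w _ _ r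
  let β := wedgeBilin ω fun j => evForm g (r j)
  let S := β + β.flip
  let P : (Fin 2 → ℂ) → (Fin 2 → ℂ) → Fin (m + 2) → Fin 2 → ℂ :=
    fun x y => Fin.cons x (Fin.cons y r)
  have hβ : ∀ x y, β (evForm g x) (evForm g y) = wedgeEval ω (fun j => evForm g (P x y j)) := by
    intro x y
    change wedgeEvalAlt ω _ _ = _
    rw [wedgeEvalAlt_apply]
    congr 1
    funext j
    refine Fin.cases rfl (fun j => ?_) j
    refine Fin.cases rfl (fun j => rfl) j
  have hSβ : ∀ x y, S x y = β x y + β y x := fun _ _ => rfl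
  have hsw : ∀ x y j, P x y (Equiv.swap 0 1 j) = P y x j := by
    intro x y j
    refine Fin.cases ?_ (fun j => ?_) j
    · rw [Equiv.swap_apply_left]
      rfl
    refine Fin.cases ?_ (fun j => ?_) j
    · rw [Fin.succ_zero_eq_one, Equiv.swap_apply_right]
      rfl
    · rw [Equiv.swap_apply_of_ne_of_ne (Fin.succ_ne_zero _) (Fin.succ_succ_ne_one j)]
      rfl
  have hS : ∀ x y, S (evForm g x) (evForm g y) = testEval 0 1 G (P x y) := by
    intro x y
    rw [← formEval_apply, ← hω, hSβ, hβ, hβ, symEval_apply]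
    rw [show (fun j => evForm g (P x y (Equiv.swap 0 1 j))) = fun j => evForm g (P y x j) from
      funext fun j => congrArg _ (hsw x y j)]
  have hSd : ∀ x, S (evForm g x) (evForm g x) = 0 := by
    intro x
    rw [hS, testEval, show bracket (P x x 0) (P x x 1) = 0 from bracket_self x, mul_zero, zero_mul]
  have hPu : ∀ y, P p y = Function.update (P p p) 1 y := by
    intro y
    funext j
    refine Fin.cases ?_ (fun j => ?_) j
    · rw [Function.update_of_ne (by simp)]
      rfl
    refine Fin.cases ?_ (fun j => ?_) j
    · rw [Fin.succ_zero_eq_one, Function.update_self]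
      rfl
    · rw [Function.update_of_ne (Fin.succ_succ_ne_one j)]
      rfl
  obtain ⟨D, hD⟩ := multiHom_update (disc_mem_multiHom (m + 1)) (P p p) 1
  obtain ⟨M, hM⟩ := multiHom_update (pairForm_mem_multiHom (f := testForm 0 1)
      (fun l => powForm_mem_multiHom _ (sum_testExp 0 1) l) G) (P p p) 1
  have hD0 : evForm _ p D = 0 := by
    rw [evForm_apply, ← hD, ← hPu]
    exact disc_eq_zero _ (a := 0) (b := 1) (by simp) (bracket_self p)
  have hM0 : evForm _ p M = 0 := by
    rw [evForm_apply, ← hM, ← hPu]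
    exact pairForm_testForm_eq_zero hG _ rfl
  have hT : ∀ y, testEval 0 1 G (P p y) = evForm _ y D * bracket p y * evForm _ y M := by
    intro y
    rw [evForm_apply, evForm_apply, ← hD, ← hM, ← hPu]
    rfl
  let d : ℂ → Module.Dual ℂ (Forms g) := fun z => z⁻¹ • (evForm g (p + z • w) - evForm g p)
  have hd : ∀ v, Filter.Tendsto (fun z => d z v) (nhdsWithin 0 {0}ᶜ)
      (nhds (tangentPoint g p w v)) := by
    intro v
    have := (hasDerivAt_evForm g p w v).tendsto_slope_zero
    simpa [d] using this
  have l1 : Filter.Tendsto (fun z => S (d z) (d z)) (nhdsWithin 0 {0}ᶜ)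
      (nhds (S (tangentPoint g p w) (tangentPoint g p w))) := tendsto_bilin hd S
  -- The bracket supplies one factor z exactly, the discriminant factor `D` divided by z converges,
  -- and the factor `M` tends to 0.
  have l2 : Filter.Tendsto (fun z : ℂ => -2 * bracket p w * (z⁻¹ * evForm _ (p + z • w) D) *
      evForm _ (p + z • w) M) (nhdsWithin 0 {0}ᶜ) (nhds 0) := by
    have h1 := (hasDerivAt_evForm _ p w D).tendsto_slope_zero
    simp only [zero_add, zero_smul, add_zero, hD0, sub_zero, smul_eq_mul] at h1
    have h2 := (hasDerivAt_evForm _ p w M).continuousAt.tendsto.mono_left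
      (nhdsWithin_le_nhds (s := {0}ᶜ))
    simp only [zero_smul, add_zero, hM0] at h2
    simpa using (h1.const_mul (-2 * bracket p w)).mul h2
  have h3 : S (tangentPoint g p w) (tangentPoint g p w) = 0 := by
    refine tendsto_nhds_unique l1 (l2.congr' ?_)
    filter_upwards [self_mem_nhdsWithin] with z hz
    have hz' : z ≠ 0 := hz
    have hb : bracket p (p + z • w) = z * bracket p w := by
      simp only [bracket, Pi.add_apply, Pi.smul_apply, smul_eq_mul]
      ring
    have hsymm : S (evForm g (p + z • w)) (evForm g p) = S (evForm g p) (evForm g (p + z • w)) := by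
      rw [hSβ, hSβ, add_comm]
    simp only [d, map_smul, map_sub, LinearMap.smul_apply, LinearMap.sub_apply, smul_eq_mul, hSd,
      hsymm, hS p, hT, hb]
    field_simp
    ring
  have h4 : (2 : ℂ) * β (tangentPoint g p w) (tangentPoint g p w) = 0 := by
    rw [two_mul, ← hSβ]
    exact h3
  have h5 := (mul_eq_zero.1 h4).resolve_left two_ne_zero
  rw [← wedgeEvalAlt_apply]
  exact h5

theorem subsingleton_symPowZ {n : ℕ} {q : ℤ} (hq : q < 0) :
    Subsingleton (symPowZ (Forms n) q) := by
  cases q with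
  | ofNat q => exact absurd hq (by simp)
  | negSucc q => exact inferInstanceAs (Subsingleton (⊥ : Submodule ℂ _))

theorem exists_cycle_of_mem_ker {g m : ℕ} (hg : 2 ≤ g)
    {G : Forms (2 * (m + 1)) ⊗[ℂ] symPowZ (Forms (m + 1 + 1)) ((g : ℤ) - (m + 1 : ℕ) - 2)}
    (hG : G ∈ LinearMap.ker (gammaPrime g (m + 1))) :
    ∃ ω, wedgeLinEquiv hg (m + 1) ω ∈ koszulCycles (sectionsMul g 1) (m + 1) ∧
      symEval g m ω = formEval m _ G := by
  suffices h : ∃ ω, symEval g m ω = formEval m _ G from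
    h.imp fun ω hω => ⟨mem_koszulCycles_of_symEval_eq hg hG hω, hω⟩
  by_cases hq : 0 ≤ (g : ℤ) - (m + 1 : ℕ) - 2
  · exact exists_symEval_eq (by omega) G
  -- For a negative exponent the symmetric power vanishes, so G = 0 and the zero cycle serves.
  · have h0 : formEval m _ G = 0 := by
      have := subsingleton_symPowZ (n := m + 1 + 1) (not_le.1 hq)
      rw [Subsingleton.elim G 0, map_zero]
    exact ⟨0, by rw [map_zero, h0]⟩

/-! ## Divisibility by differences of variables -/

section Divisibility

variable {ι : Type*} [DecidableEq ι]

/-- Modulo X a - X b, replacing X b by X a changes nothing. So the multiples of X a - X b form the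
kernel of a ring homomorphism into a domain, which also gives primality below. -/
theorem X_sub_X_dvd_iff (a b : ι) (f : MvPolynomial ι ℂ) :
    X a - X b ∣ f ↔ rename (Function.update id b a) f = 0 := by
  have hba : Function.update (id : ι → ι) b a b = a := Function.update_self _ _ _
  have haa : Function.update (id : ι → ι) b a a = a := by
    by_cases h : a = b
    · rw [h, Function.update_self]
    · rw [Function.update_of_ne h, id]
  have key : ∀ f : MvPolynomial ι ℂ, X a - X b ∣ f - rename (Function.update id b a) f := by
    intro f
    induction f using MvPolynomial.induction_on with
    | C c => simp
    | add f g hf hg =>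
      rw [map_add, add_sub_add_comm]
      exact dvd_add hf hg
    | mul_X f j hf =>
      rw [map_mul, rename_X]
      have e : f * X j - rename (Function.update id b a) f * X (Function.update id b a j) =
          (f - rename (Function.update id b a) f) * X j +
            rename (Function.update id b a) f * (X j - X (Function.update id b a j)) := by ring
      rw [e]
      refine dvd_add (hf.mul_right _) (Dvd.dvd.mul_left ?_ _)
      by_cases hj : j = b
      · rw [hj, hba]
        exact ⟨-1, by ring⟩
      · rw [Function.update_of_ne hj, id, sub_self]
        exact dvd_zero _
  constructor
  · rintro ⟨h, rfl⟩
    rw [map_mul, map_sub, rename_X, rename_X, hba, haa, sub_self, zero_mul]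
  · intro h
    simpa [h] using key f

theorem X_sub_X_dvd_of_eval {a b : ι} {f : MvPolynomial ι ℂ}
    (h : ∀ z : ι → ℂ, z a = z b → eval z f = 0) : X a - X b ∣ f := by
  rw [X_sub_X_dvd_iff]
  refine MvPolynomial.funext_iff.2 fun z => ?_
  rw [eval_rename, map_zero]
  refine h _ ?_
  rw [Function.comp_apply, Function.comp_apply, Function.update_self]
  by_cases hab : a = b
  · rw [hab, Function.update_self]
  · rw [Function.update_of_ne hab, id]

theorem X_sub_X_dvd_X_sub_X_iff (a b c d : ι) : (X a - X b : MvPolynomial ι ℂ) ∣ X c - X d ↔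
    Function.update id b a c = Function.update id b a d := by
  rw [X_sub_X_dvd_iff, map_sub, rename_X, rename_X, sub_eq_zero]
  exact X_injective.eq_iff

theorem prime_X_sub_X {a b : ι} (hab : a ≠ b) : Prime (X a - X b : MvPolynomial ι ℂ) := by
  refine ⟨sub_ne_zero.2 fun h => hab (X_injective h), fun h => ?_, fun f g h => ?_⟩
  · have := h.map (eval (0 : ι → ℂ))
    simp at this
  · rw [X_sub_X_dvd_iff, map_mul, mul_eq_zero] at h
    rwa [X_sub_X_dvd_iff, X_sub_X_dvd_iff]

theorem degreeOf_X_sub_X {a b : ι} (hab : a ≠ b) (j : ι) :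
    degreeOf j (X a - X b : MvPolynomial ι ℂ) =
      (if j = a then 1 else 0) + (if j = b then 1 else 0) := by
  have h : ∀ a b : ι, a ≠ b → degreeOf a (X a - X b : MvPolynomial ι ℂ) = 1 := by
    intro a b hab
    rw [sub_eq_add_neg, degreeOf_add_eq_of_degreeOf_lt, degreeOf_X_self]
    rw [degreeOf_neg, degreeOf_X_of_ne hab, degreeOf_X_self]
    exact one_pos
  by_cases ha : j = a
  · subst ha
    rw [h j b hab, if_pos rfl, if_neg hab]
  by_cases hb : j = b
  · subst hb
    rw [← degreeOf_neg, neg_sub, h j a hab.symm, if_pos rfl, if_neg hab.symm]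
  rw [if_neg ha, if_neg hb]
  refine Nat.le_zero.1 ((degreeOf_sub_le _ _ _).trans ?_)
  rw [degreeOf_X_of_ne ha, degreeOf_X_of_ne hb, max_self]

end Divisibility

/-! ## The Vandermonde polynomial -/

/-- The pairs `i < j`. -/
def ltPairs (n : ℕ) : Finset (Σ _ : Fin n, Fin n) := Finset.univ.sigma fun i => Finset.Ioi i

theorem mem_ltPairs {n : ℕ} {x : Σ _ : Fin n, Fin n} : x ∈ ltPairs n ↔ x.1 < x.2 := by
  simp [ltPairs]

/-- The Vandermonde polynomial. -/
def vandPoly (n : ℕ) : MvPolynomial (Fin n) ℂ := ∏ x ∈ ltPairs n, (X x.2 - X x.1)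

theorem eval_vandPoly {n : ℕ} (z : Fin n → ℂ) : eval z (vandPoly n) = disc (aff z) := by
  rw [vandPoly, ltPairs, Finset.prod_sigma, disc, map_prod]
  simp [bracket_aff]

theorem vandPoly_ne_zero (n : ℕ) : vandPoly n ≠ 0 :=
  Finset.prod_ne_zero_iff.2 fun _ hx => (prime_X_sub_X (mem_ltPairs.1 hx).ne').ne_zero

theorem eq_of_eval_injective {n : ℕ} {f h : MvPolynomial (Fin n) ℂ}
    (H : ∀ z, Function.Injective z → eval z f = eval z h) : f = h := by
  refine mul_left_cancel₀ (vandPoly_ne_zero n) (MvPolynomial.funext fun z => ?_)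
  rw [map_mul, map_mul]
  by_cases hz : Function.Injective z
  · rw [H z hz]
  · obtain ⟨i, j, hij, hne⟩ : ∃ i j, z i = z j ∧ i ≠ j := by
      simpa [Function.Injective] using hz
    rw [eval_vandPoly, disc_eq_zero _ hne (by rw [bracket_aff, hij, sub_self]), zero_mul, zero_mul]

theorem degreeOf_vandPoly {n : ℕ} (a : Fin (n + 1)) : degreeOf a (vandPoly (n + 1)) = n := by
  rw [vandPoly, degreeOf_prod_eq _ _ fun x hx => (prime_X_sub_X (mem_ltPairs.1 hx).ne').ne_zero,
    Finset.sum_congr rfl fun x hx => degreeOf_X_sub_X (mem_ltPairs.1 hx).ne' a, ltPairs,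
    Finset.sum_sigma]
  have h : ∀ i, ∑ j ∈ Finset.Ioi i, ((if a = j then 1 else 0) + (if a = i then 1 else 0)) =
      (if i < a then 1 else 0) + (if a = i then n - (a : ℕ) else 0) := by
    intro i
    rw [Finset.sum_add_distrib, Finset.sum_ite_eq, Finset.sum_const, Fin.card_Ioi]
    simp only [Finset.mem_Ioi]
    by_cases h : a = i
    · subst h
      simp
    · simp [h]
  rw [Finset.sum_congr rfl fun i _ => h i, Finset.sum_add_distrib, Finset.sum_ite_eq]
  simp only [Finset.mem_univ, if_true, Finset.sum_boole]
  have : (Finset.univ.filter fun i => i < a) = Finset.Iio a := by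
    ext
    simp
  rw [this, Fin.card_Iio]
  simp
  omega

theorem ltPairs_coprime {n : ℕ} {x y : Σ _ : Fin n, Fin n} (hx : x ∈ ltPairs n)
    (hy : y ∈ ltPairs n) (hxy : x ≠ y) :
    ¬ (X x.2 - X x.1 : MvPolynomial (Fin n) ℂ) ∣ X y.2 - X y.1 := by
  obtain ⟨a, b⟩ := x
  obtain ⟨c, d⟩ := y
  rw [mem_ltPairs] at hx hy
  simp only at hx hy ⊢
  rw [X_sub_X_dvd_X_sub_X_iff]
  intro h
  by_cases hd : d = a
  · rw [hd, Function.update_self, Function.update_of_ne (by omega), id] at h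
    omega
  · rw [Function.update_of_ne hd, id] at h
    by_cases hc : c = a
    · rw [hc, Function.update_self] at h
      exact hxy (by rw [hc, h])
    · rw [Function.update_of_ne hc, id] at h
      omega

theorem vandPoly_dvd {n : ℕ} {f : MvPolynomial (Fin n) ℂ}
    (h : ∀ (a b : Fin n), a < b → ∀ z, z a = z b → eval z f = 0) : vandPoly n ∣ f := by
  refine Finset.prod_dvd_of_isRelPrime (fun x hx y hy hxy => ?_) fun x hx =>
    X_sub_X_dvd_of_eval fun z hz => h x.1 x.2 (mem_ltPairs.1 hx) z hz.symm
  exact ((prime_X_sub_X (mem_ltPairs.1 hx).ne').irreducible.isRelPrime_iff_not_dvd).2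
    (ltPairs_coprime hx hy hxy)

/-- The factor X 1 - X 0 occurs exactly once in the Vandermonde product, so exactly one power is
lost when the product is cancelled from a divisibility. -/
theorem exists_vandPoly_eq (m : ℕ) : ∃ V', vandPoly (m + 2) = (X 1 - X 0) * V' ∧
    ¬ (X 1 - X 0 : MvPolynomial (Fin (m + 2)) ℂ) ∣ V' := by
  have h : (⟨0, 1⟩ : Σ _ : Fin (m + 2), Fin (m + 2)) ∈ ltPairs (m + 2) := mem_ltPairs.2 (by simp)
  refine ⟨_, (Finset.mul_prod_erase _ _ h).symm, fun hd => ?_⟩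
  obtain ⟨y, hy, hdy⟩ := (prime_X_sub_X (by simp)).dvd_finsetProd_iff _ |>.1 hd
  exact ltPairs_coprime h (Finset.mem_of_mem_erase hy) (Finset.ne_of_mem_erase hy).symm hdy

/-! ## Values of Koszul cycles at points of the rational normal curve -/

theorem wedgeEval_mem_multiHom {g m : ℕ} (ω : (⋀[ℂ]^(m + 1) (Forms g)) ⊗[ℂ] Forms g) :
    (fun p : Fin (m + 2) → Fin 2 → ℂ => wedgeEval ω fun j => evForm g (p j)) ∈
      multiHom fun _ => g := by
  induction ω using TensorProduct.induction_on with
  | zero =>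
    simp only [wedgeEval, map_zero]
    exact Submodule.zero_mem (multiHom _)
  | add x y hx hy =>
    simp only [wedgeEval, map_add] at hx hy ⊢
    exact Submodule.add_mem _ hx hy
  | tmul x w =>
    have hx : x ∈ Submodule.span ℂ (Set.range (exteriorPower.ιMulti ℂ (m + 1) (M := Forms g))) := by
      rw [exteriorPower.ιMulti_span]
      exact Submodule.mem_top
    simp only [wedgeEval, tensorPair_tmul]
    induction hx using Submodule.span_induction with
    | mem x hx =>
      obtain ⟨v, rfl⟩ := hx
      have : (fun p : Fin (m + 2) → Fin 2 → ℂ =>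
          wedgePair (Fin.tail fun j => evForm g (p j)) (exteriorPower.ιMulti ℂ (m + 1) v) *
            evForm g (p 0) w) = ∑ π : Equiv.Perm (Fin (m + 1)), ((Equiv.Perm.sign π : ℤ) : ℂ) •
              fun p : Fin (m + 2) → Fin 2 → ℂ => ∏ j, evForm g (p j)
                ((Fin.cons w (v ∘ π) : Fin (m + 2) → Forms g) j) := by
        funext p
        rw [wedgePair_ιMulti, Matrix.det_apply', Finset.sum_mul, Finset.sum_apply]
        refine Finset.sum_congr rfl fun π _ => ?_
        rw [Pi.smul_apply, Fin.prod_univ_succ fun j => evForm g (p j)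
          ((Fin.cons w (v ∘ π) : Fin (m + 2) → Forms g) j)]
        simp only [Matrix.of_apply, Fin.cons_zero, Fin.cons_succ, Fin.tail, Function.comp_apply,
          smul_eq_mul]
        ring
      rw [this]
      exact Submodule.sum_mem _ fun π _ => Submodule.smul_mem _ _
        (prod_mem_multiHom (d := fun _ => g) _)
    | zero =>
      simp only [map_zero, zero_mul]
      exact Submodule.zero_mem (multiHom _)
    | add a b _ _ ha hb =>
      simp only [map_add, add_mul]
      exact Submodule.add_mem _ ha hb
    | smul c a _ ha =>
      simp only [map_smul, smul_eq_mul, mul_assoc]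
      exact Submodule.smul_mem _ c ha

theorem wedgeEval_comp {V : Type*} [AddCommGroup V] [Module ℂ V] {p : ℕ}
    (ω : (⋀[ℂ]^p V) ⊗[ℂ] V) (φ : Fin (p + 1) → Module.Dual ℂ V) {π : Equiv.Perm (Fin (p + 1))}
    (hπ : π 0 = 0) : wedgeEval ω (φ ∘ π) = (Equiv.Perm.sign π : ℤ) * wedgeEval ω φ := by
  obtain ⟨⟨a, ρ⟩, rfl⟩ := Equiv.Perm.decomposeFin.symm.surjective π
  obtain rfl : a = 0 := by simpa using hπ
  have h := (wedgeEvalAlt ω (φ 0)).map_perm (Fin.tail φ) ρ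
  rw [wedgeEvalAlt_apply, wedgeEvalAlt_apply, Fin.cons_self_tail] at h
  rw [Equiv.Perm.decomposeFin.symm_sign, if_pos rfl, one_mul, ← zsmul_eq_mul]
  refine Eq.trans (congrArg (wedgeEval ω) (funext fun k => ?_)) h
  refine Fin.cases ?_ (fun k => ?_) k
  · simp
  · simp [Fin.tail]

/-! ### The cycle condition in the affine chart -/

theorem eval_pderiv_eq {n : ℕ} (T : MvPolynomial (Fin n) ℂ) (j : Fin n) (z : Fin n → ℂ) {D : ℂ}
    (h : HasDerivAt (fun t => eval (Function.update z j (z j + t)) T) D 0) :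
    eval z (pderiv j T) = D := by
  have h1 := hasDerivAt_eval T (fun t => Function.update z j (z j + t)) (Pi.single j 1) 0
    fun s => by
    by_cases hs : s = j
    · subst hs
      simpa using (hasDerivAt_id (0 : ℂ)).const_add (z s)
    · simpa [Function.update_of_ne hs, hs] using hasDerivAt_const (0 : ℂ) (z s)
  simp only [add_zero, Function.update_eq_self, Pi.single_apply, ite_mul, one_mul, zero_mul,
    Finset.sum_ite_eq', Finset.mem_univ, if_true] at h1
  exact h1.unique h

theorem hasDerivAt_dual_evForm (g : ℕ) (p w : Fin 2 → ℂ)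
    (Λ : Module.Dual ℂ (Module.Dual ℂ (Forms g))) :
    HasDerivAt (fun t : ℂ => Λ (evForm g (p + t • w))) (Λ (tangentPoint g p w)) 0 := by
  obtain ⟨F, rfl⟩ := (Module.evalEquiv ℂ (Forms g)).surjective Λ
  exact hasDerivAt_evForm g p w F

/-- If T = (X a - X b) T', then ∂_b T equals -T' on the diagonal; if T = (X a - X b)² T', then ∂_a
∂_b T equals -2 T' there. -/
theorem X_sub_X_pow_three_dvd {n : ℕ} {a b : Fin n} (hab : a ≠ b) {T : MvPolynomial (Fin n) ℂ}
    (h0 : ∀ z, z a = z b → eval z T = 0) (h1 : ∀ z, z a = z b → eval z (pderiv b T) = 0)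
    (h2 : ∀ z, z a = z b → eval z (pderiv a (pderiv b T)) = 0) : (X a - X b) ^ 3 ∣ T := by
  obtain ⟨T, rfl⟩ := X_sub_X_dvd_of_eval h0
  have e1 : pderiv b (X a - X b : MvPolynomial (Fin n) ℂ) = -1 := by
    simp [pderiv_X, hab]
  have e2 : pderiv a (X a - X b : MvPolynomial (Fin n) ℂ) = 1 := by
    simp [pderiv_X, hab.symm]
  obtain ⟨T, rfl⟩ : X a - X b ∣ T := X_sub_X_dvd_of_eval fun z hz => by
    have := h1 z hz
    rw [Derivation.leibniz, e1] at this
    simpa [hz] using this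
  obtain ⟨T, rfl⟩ : X a - X b ∣ T := X_sub_X_dvd_of_eval fun z hz => by
    have := h2 z hz
    simp only [Derivation.leibniz, e1, e2, map_add, smul_eq_mul, map_neg, map_mul, map_one,
      Derivation.map_one_eq_zero, neg_zero, mul_zero] at this
    simpa [hz] using this
  exact ⟨T, by ring⟩

theorem aff_comp {n : ℕ} (z : Fin n → ℂ) (π : Fin n → Fin n) : aff (z ∘ π) = aff z ∘ π := rfl

theorem aff_update {n : ℕ} (z : Fin n → ℂ) (j : Fin n) (t : ℂ) :
    aff (Function.update z j (z j + t)) j = aff z j + t • ![0, 1] := by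
  funext i
  fin_cases i <;> simp [aff]

theorem aff_update_of_ne {n : ℕ} (z : Fin n → ℂ) {j k : Fin n} (h : k ≠ j) (t : ℂ) :
    aff (Function.update z j t) k = aff z k := by
  simp [aff, Function.update_of_ne h]

theorem tangentPoint_add (g : ℕ) (p w w' : Fin 2 → ℂ) :
    tangentPoint g p (w + w') = tangentPoint g p w + tangentPoint g p w' := by
  ext F
  simp only [tangentPoint_apply, LinearMap.add_apply, Pi.add_apply, add_mul, Finset.sum_add_distrib]

/-- Let e be the curve point and t the tangent vector at it. On the diagonal, the value, the first
derivative and the mixed second derivative of T are S(e, e), S(e, t) and S(t, t). The cycle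
condition makes the quadratic form of S vanish on the plane spanned by e and t, and polarization
then kills S(e, t). -/
theorem symEval_pow_dvd {g m : ℕ} (hg : 2 ≤ g) {ω : (⋀[ℂ]^(m + 1) (Forms g)) ⊗[ℂ] Forms g}
    (hω : wedgeLinEquiv hg (m + 1) ω ∈ koszulCycles (sectionsMul g 1) (m + 1))
    {T : MvPolynomial (Fin (m + 2)) ℂ} (hT : ∀ z, eval z T = symEval g m ω (aff z)) :
    (X 0 - X 1) ^ 3 ∣ T := by
  rw [mem_koszulCycles_iff] at hω
  let β : (Fin (m + 2) → ℂ) → Module.Dual ℂ (Forms g) →ₗ[ℂ] Module.Dual ℂ (Forms g) →ₗ[ℂ] ℂ :=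
    fun z => wedgeBilin ω fun j : Fin m => evForm g (aff z j.succ.succ)
  let S : (Fin (m + 2) → ℂ) → Module.Dual ℂ (Forms g) →ₗ[ℂ] Module.Dual ℂ (Forms g) →ₗ[ℂ] ℂ :=
    fun z => β z + (β z).flip
  have hSβ : ∀ z x y, S z x y = β z x y + β z y x := fun _ _ _ => rfl
  have hβ : ∀ z x y, β z x y = wedgeEval ω (Fin.cons x (Fin.cons y fun j : Fin m =>
      evForm g (aff z j.succ.succ))) := fun z x y => wedgeEvalAlt_apply _ _ _
  have hTS : ∀ z, eval z T = S z (evForm g (aff z 0)) (evForm g (aff z 1)) := by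
    intro z
    rw [hT, symEval_apply, hSβ, hβ, hβ]
    congr 2
    · funext j
      refine Fin.cases rfl (fun j => ?_) j
      exact Fin.cases rfl (fun j => rfl) j
    · funext j
      refine Fin.cases ?_ (fun j => ?_) j
      · rw [Equiv.swap_apply_left]
        rfl
      refine Fin.cases ?_ (fun j => ?_) j
      · rw [Fin.succ_zero_eq_one, Equiv.swap_apply_right]
        rfl
      · rw [Equiv.swap_apply_of_ne_of_ne (Fin.succ_ne_zero _) (Fin.succ_succ_ne_one j)]
        rfl
  have hβu : ∀ z t, β (Function.update z 0 t) = β z ∧ β (Function.update z 1 t) = β z := by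
    intro z t
    constructor
    · simp only [β]
      congr 1
    · simp only [β]
      congr 1
  have hSu0 : ∀ z t, S (Function.update z 0 t) = S z := fun z t => by
    simp only [S, (hβu z t).1]
  have hSu1 : ∀ z t, S (Function.update z 1 t) = S z := fun z t => by
    simp only [S, (hβu z t).2]
  have h01 : (0 : Fin (m + 2)) ≠ 1 := by simp
  have hT1 : ∀ z, eval z (pderiv 1 T) =
      S z (evForm g (aff z 0)) (tangentPoint g (aff z 1) ![0, 1]) := by
    intro z
    refine eval_pderiv_eq T 1 z ?_
    simp only [hTS, hSu1, aff_update, aff_update_of_ne z h01]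
    exact hasDerivAt_dual_evForm g _ _ (S z (evForm g (aff z 0)))
  have hT01 : ∀ z, eval z (pderiv 0 (pderiv 1 T)) =
      S z (tangentPoint g (aff z 0) ![0, 1]) (tangentPoint g (aff z 1) ![0, 1]) := by
    intro z
    refine eval_pderiv_eq _ 0 z ?_
    simp only [hT1, hSu0, aff_update, aff_update_of_ne z h01.symm]
    exact hasDerivAt_dual_evForm g _ _ ((S z).flip (tangentPoint g (aff z 1) ![0, 1]))
  have hQ : ∀ z w, w ≠ 0 → S z (tangentPoint g (aff z 0) w) (tangentPoint g (aff z 0) w) = 0 := by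
    intro z w hw
    rw [hSβ, hβ, hω _ _ (fun h => by simpa [aff] using congrFun h 0) hw, add_zero]
  have haff : ∀ z : Fin (m + 2) → ℂ, aff z 0 ≠ 0 := fun z h => by simpa [aff] using congrFun h 0
  have he : (![0, 1] : Fin 2 → ℂ) ≠ 0 := fun h => by simpa using congrFun h 1
  have hg0 : (g : ℂ) ≠ 0 := by norm_cast; omega
  have q1 : ∀ z, S z (evForm g (aff z 0)) (evForm g (aff z 0)) = 0 := by
    intro z
    have := hQ z _ (haff z)
    rw [tangentPoint_self] at this
    simpa [hg0] using this
  have q3 : ∀ z, S z (evForm g (aff z 0)) (tangentPoint g (aff z 0) ![0, 1]) = 0 := by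
    intro z
    have h1 := hQ z (aff z 0 + ![0, 1]) fun h => by simpa [aff] using congrFun h 0
    have h2 := hQ z _ he
    have h3 : S z (tangentPoint g (aff z 0) ![0, 1]) (evForm g (aff z 0)) =
        S z (evForm g (aff z 0)) (tangentPoint g (aff z 0) ![0, 1]) := by
      rw [hSβ, hSβ, add_comm]
    rw [tangentPoint_add, tangentPoint_self] at h1
    simp only [map_add, map_smul, LinearMap.add_apply, LinearMap.smul_apply, q1, h2, h3,
      smul_eq_mul, mul_zero, zero_add, add_zero] at h1
    refine (mul_eq_zero.1 (?_ : (2 * (g : ℂ)) * _ = 0)).resolve_left (by simp [hg0])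
    linear_combination h1
  have hz01 : ∀ z : Fin (m + 2) → ℂ, z 0 = z 1 → aff z 1 = aff z 0 := fun z hz => by
    simp [aff, hz]
  refine X_sub_X_pow_three_dvd h01 (fun z hz => ?_) (fun z hz => ?_) fun z hz => ?_
  · rw [hTS, hz01 z hz, q1]
  · rw [hT1, hz01 z hz, q3]
  · rw [hT01, hz01 z hz, hQ z _ he]

/-- The values of a cycle vanish whenever two points coincide, so the Vandermonde product splits
off; its degree m + 1 in each variable is the gain in the degree bound. Antisymmetry in the last
points becomes symmetry of σ. -/
theorem exists_quotient_vandPoly {g m : ℕ} (hg : 2 ≤ g)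
    {ω : (⋀[ℂ]^(m + 1) (Forms g)) ⊗[ℂ] Forms g}
    (hω : wedgeLinEquiv hg (m + 1) ω ∈ koszulCycles (sectionsMul g 1) (m + 1)) :
    ∃ σ : MvPolynomial (Fin (m + 2)) ℂ,
      (∀ z, wedgeEval ω (fun j => evForm g (aff z j)) = disc (aff z) * eval z σ) ∧
      (σ = 0 ∨ ∀ j, degreeOf j σ + (m + 1) ≤ g) ∧
      (∀ π : Equiv.Perm (Fin (m + 2)), π 0 = 0 → rename π σ = σ) ∧
      (X 0 - X 1) ^ 3 ∣ σ - rename (Equiv.swap 0 1) σ := by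
  obtain ⟨F, hF1, hF2⟩ := exists_affine_poly (wedgeEval_mem_multiHom ω)
  have hFπ : ∀ π : Equiv.Perm (Fin (m + 2)), π 0 = 0 → ∀ z, eval (z ∘ π) F =
      (Equiv.Perm.sign π : ℤ) * eval z F := by
    intro π hπ z
    rw [hF2, hF2, ← wedgeEval_comp ω _ hπ]
    rfl
  have hT : ∀ z, eval z (F + rename (Equiv.swap 0 1) F) = symEval g m ω (aff z) := by
    intro z
    rw [map_add, eval_rename, hF2, hF2]
    rfl
  have hdvd := symEval_pow_dvd hg hω hT
  -- On this diagonal the symmetrized function is twice F, and it vanishes by the cycle condition.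
  -- The other diagonals follow from antisymmetry in the last points.
  have h01 : ∀ z : Fin (m + 2) → ℂ, z 0 = z 1 → eval z F = 0 := by
    intro z hz
    obtain ⟨K, hK⟩ := hdvd
    have h1 := congrArg (eval z) hK
    have h2 : z ∘ Equiv.swap 0 1 = z := by
      funext j
      by_cases h0 : j = 0
      · simp [h0, hz]
      by_cases h1 : j = 1
      · simp [h1, hz]
      rw [Function.comp_apply, Equiv.swap_apply_of_ne_of_ne h0 h1]
    rw [map_add, eval_rename, h2] at h1
    simp [hz] at h1
    exact h1
  obtain ⟨σ, hσ⟩ : vandPoly (m + 2) ∣ F := by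
    refine vandPoly_dvd fun a b hab z hz => ?_
    by_cases ha : a = 0
    · subst ha
      have h1 := hFπ (Equiv.swap 1 b) (Equiv.swap_apply_of_ne_of_ne (by simp) hab.ne) z
      rw [h01 _ (by
        rw [Function.comp_apply, Function.comp_apply, Equiv.swap_apply_left,
          Equiv.swap_apply_of_ne_of_ne (by simp) hab.ne, hz]), zero_eq_mul] at h1
      refine h1.resolve_left ?_
      rcases Int.units_eq_one_or (Equiv.Perm.sign (Equiv.swap 1 b)) with h | h <;> simp [h]
    · have hb : b ≠ 0 := fun h => by
        subst h
        exact absurd hab (Fin.not_lt_zero a)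
      have h1 := hFπ (Equiv.swap a b) (Equiv.swap_apply_of_ne_of_ne (Ne.symm ha) hb.symm) z
      have h2 : z ∘ Equiv.swap a b = z := by
        funext j
        by_cases h0 : j = a
        · simp [h0, hz]
        by_cases h1 : j = b
        · simp [h1, hz]
        rw [Function.comp_apply, Equiv.swap_apply_of_ne_of_ne h0 h1]
      rw [h2, Equiv.Perm.sign_swap hab.ne] at h1
      simp at h1
      exact self_eq_neg.1 h1
  have hFσ : ∀ z, eval z F = disc (aff z) * eval z σ := fun z => by
    rw [hσ, map_mul, eval_vandPoly]
  refine ⟨σ, fun z => by rw [← hFσ, hF2], ?_, fun π hπ => ?_, ?_⟩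
  · by_cases h0 : σ = 0
    · exact Or.inl h0
    refine Or.inr fun j => ?_
    have := hF1 j
    rw [hσ, degreeOf_mul_eq (vandPoly_ne_zero _) h0, degreeOf_vandPoly, add_comm] at this
    exact this
  · refine eq_of_eval_injective fun z hz => ?_
    have h1 := hFπ π hπ z
    rw [hFσ, hFσ, aff_comp, disc_comp] at h1
    have hs : ((Equiv.Perm.sign π : ℤ) : ℂ) ≠ 0 := by
      rcases Int.units_eq_one_or (Equiv.Perm.sign π) with h | h <;> simp [h]
    rw [eval_rename]
    exact mul_left_cancel₀ (mul_ne_zero hs (disc_aff_ne_zero hz)) (by linear_combination h1)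
  -- The symmetrized function is the Vandermonde product times σ minus its swap. One of its three
  -- factors X 1 - X 0 is used up by the product, leaving a square.
  · obtain ⟨V', hV, hV'⟩ := exists_vandPoly_eq m
    have e : F + rename (Equiv.swap 0 1) F =
        vandPoly (m + 2) * (σ - rename (Equiv.swap 0 1) σ) := by
      refine MvPolynomial.funext fun z => ?_
      rw [map_add, eval_rename, hFσ, hFσ, map_mul, map_sub, eval_rename, eval_vandPoly, aff_comp,
        disc_comp, Equiv.Perm.sign_swap (by simp)]
      push_cast
      ring
    rw [e, hV, ← neg_sub (X 1), Odd.neg_pow (by decide), neg_dvd, pow_succ', mul_assoc] at hdvd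
    have hp : Prime (X 1 - X 0 : MvPolynomial (Fin (m + 2)) ℂ) := prime_X_sub_X (by simp)
    have h2 := (mul_dvd_mul_iff_left hp.ne_zero).1 hdvd
    obtain ⟨κ, hκ⟩ := hp.pow_dvd_of_dvd_mul_left 2 hV' h2
    -- The quotient by the square is antisymmetric under the swap, hence vanishes on the diagonal;
    -- this restores the third factor.
    have h3 : ∀ z, z 1 = z 0 → eval z κ = 0 := by
      have h4 : rename (Equiv.swap 0 1) κ = -κ := by
        have h5 := congrArg (rename (Equiv.swap (0 : Fin (m + 2)) 1)) hκ
        have h6 : rename (Equiv.swap (0 : Fin (m + 2)) 1) (rename (Equiv.swap 0 1) σ) = σ := by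
          rw [rename_rename, ← Equiv.Perm.coe_mul, Equiv.swap_mul_self, Equiv.Perm.coe_one,
            rename_id_apply]
        rw [map_sub, h6, map_mul, map_pow, map_sub, rename_X, rename_X, Equiv.swap_apply_left,
          Equiv.swap_apply_right] at h5
        refine mul_left_cancel₀ (pow_ne_zero 2 hp.ne_zero) ?_
        linear_combination -h5 - hκ
      intro z hz
      have h5 := congrArg (eval z) h4
      have h2 : z ∘ Equiv.swap 0 1 = z := by
        funext j
        by_cases h0 : j = 0
        · simp [h0, hz]
        by_cases h1 : j = 1
        · simp [h1, hz]
        rw [Function.comp_apply, Equiv.swap_apply_of_ne_of_ne h0 h1]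
      rw [eval_rename, h2, map_neg] at h5
      exact self_eq_neg.1 h5
    obtain ⟨κ', rfl⟩ := X_sub_X_dvd_of_eval h3
    exact ⟨-κ', by rw [hκ]; ring⟩

/-! ## Symmetric polynomials as symmetric powers of binary forms -/

/-- Ryser's formula for permanents. -/
theorem sum_perm_prod {n : ℕ} (a : Fin n → Fin n → ℂ) :
    ∑ π : Equiv.Perm (Fin n), ∏ j, a (π j) j =
      ∑ T : Finset (Fin n), (-1) ^ T.card * ∏ j, ∑ s ∈ Tᶜ, a s j := by
  have h1 : ∀ T : Finset (Fin n), ∏ j, ∑ s ∈ Tᶜ, a s j =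
      ∑ f : Fin n → Fin n, if T ⊆ (Finset.univ.image f)ᶜ then ∏ j, a (f j) j else 0 := by
    intro T
    rw [Finset.prod_univ_sum, ← Finset.sum_filter]
    refine Finset.sum_congr (Finset.ext fun f => ?_) fun _ _ => rfl
    rw [Fintype.mem_piFinset, Finset.mem_filter, Finset.subset_compl_comm]
    simp [Finset.subset_iff]
  -- Inclusion–exclusion: the alternating sum over the sets T disjoint from the image of f vanishes
  -- unless f is surjective, that is, a permutation.
  have h2 : ∀ f : Fin n → Fin n, ∑ T : Finset (Fin n), (-1 : ℂ) ^ T.card *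
      (if T ⊆ (Finset.univ.image f)ᶜ then ∏ j, a (f j) j else 0) =
        if Function.Bijective f then ∏ j, a (f j) j else 0 := by
    intro f
    have h3 := Finset.sum_powerset_neg_one_pow_card (x := (Finset.univ.image f)ᶜ)
    have h4 : (∑ T ∈ (Finset.univ.image f)ᶜ.powerset, (-1 : ℂ) ^ T.card) =
        if (Finset.univ.image f)ᶜ = ∅ then 1 else 0 := by exact_mod_cast h3
    simp only [mul_ite, mul_zero]
    rw [← Finset.sum_filter, ← Finset.sum_mul,
      show Finset.univ.filter (fun T => T ⊆ (Finset.univ.image f)ᶜ) =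
        (Finset.univ.image f)ᶜ.powerset by ext; simp, h4]
    have h5 : (Finset.univ.image f)ᶜ = ∅ ↔ Function.Bijective f := by
      rw [Finset.compl_eq_empty_iff, ← Finite.surjective_iff_bijective, Finset.eq_univ_iff_forall]
      simp [Function.Surjective]
    by_cases hf : Function.Bijective f
    · rw [if_pos (h5.2 hf), if_pos hf, one_mul]
    · rw [if_neg fun h => hf (h5.1 h), if_neg hf, zero_mul]
  simp only [h1, Finset.mul_sum]
  rw [Finset.sum_comm]
  simp only [h2]
  rw [← Finset.sum_filter]
  refine Finset.sum_bij (fun π _ => (π : Fin n → Fin n)) (fun π _ => ?_) (fun π _ ρ _ h => ?_)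
    (fun f hf => ?_) fun _ _ => rfl
  · exact Finset.mem_filter.2 ⟨Finset.mem_univ _, π.bijective⟩
  · exact DFunLike.coe_injective h
  · exact ⟨Equiv.ofBijective f (Finset.mem_filter.1 hf).2, Finset.mem_univ _, rfl⟩

theorem prod_ι_mem_symPow {V : Type*} [AddCommGroup V] [Module ℂ V] {q : ℕ} (v : Fin q → V) :
    ∏ k, SymmetricAlgebra.ι ℂ V (v k) ∈ symPow V q := by
  induction q with
  | zero => simp [symPow, Submodule.one_le.1 le_rfl]
  | succ q ih =>
    rw [Fin.prod_univ_succ]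
    exact ι_mul_mem_symPow _ (ih _)

theorem apolar_linPow_prodForm {n : ℕ} (p : Fin 2 → ℂ) (z : Fin n → ℂ) :
    apolar n (linPow n p) (prodForm (aff z)) = n.factorial * ∏ j, (p 0 + p 1 * z j) := by
  rw [apolar_comm, apolar_linPow]
  congr 1
  change eval p (∏ j, linPoly (aff z j) ^ 1) = _
  simp only [map_prod, pow_one, eval_linPoly, Fin.sum_univ_two]
  refine Finset.prod_congr rfl fun j _ => ?_
  simp [aff]
  ring

/-- Factor W into q linear polynomials. For each factor, the product of its values at the z_j is
1/n! times the pairing of an n-th power of a linear form with the product form. A product of q such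
powers therefore works up to a scalar. -/
theorem exists_evalForm_eq_prod {n q : ℕ} {W : Polynomial ℂ} (hW : W.natDegree ≤ q) :
    ∃ x : symPowZ (Forms n) q, ∀ z, evalForm (prodForm (aff z)) _ x = ∏ j, W.eval (z j) := by
  obtain ⟨c, p, hp⟩ := exists_eq_prod_linear hW
  have hf : (n.factorial : ℂ) ≠ 0 := by exact_mod_cast n.factorial_ne_zero
  refine ⟨(c ^ n * ((n.factorial : ℂ)⁻¹) ^ q) •
    ⟨∏ k, SymmetricAlgebra.ι ℂ (Forms n) (linPow n (p k)), prod_ι_mem_symPow _⟩, fun z => ?_⟩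
  have h : evalForm (prodForm (aff z)) (q : ℤ)
      ⟨∏ k, SymmetricAlgebra.ι ℂ (Forms n) (linPow n (p k)), prod_ι_mem_symPow _⟩ =
        ∏ k, (n.factorial * ∏ j, (p k 0 + p k 1 * z j)) := by
    rw [evalForm_apply, evalAt, map_prod]
    refine Finset.prod_congr rfl fun k _ => ?_
    rw [SymmetricAlgebra.lift_ι_apply, LinearMap.flip_apply, apolar_linPow_prodForm]
  rw [map_smul, h, smul_eq_mul]
  simp only [hp, Finset.prod_mul_distrib, Finset.prod_const, Finset.card_univ, Fintype.card_fin]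
  rw [Finset.prod_comm, inv_pow]
  field_simp

/-- A symmetric polynomial of degree at most `q` in each of its `n` variables comes from an element
of `S^q S^n U`. -/
theorem exists_evalForm_eq {n q : ℕ} {ρ : MvPolynomial (Fin n) ℂ} (hq : ∀ j, degreeOf j ρ ≤ q)
    (hρ : ∀ π : Equiv.Perm (Fin n), rename π ρ = ρ) :
    ∃ x : symPowZ (Forms n) q, ∀ z, evalForm (prodForm (aff z)) _ x = eval z ρ := by
  -- A symmetric polynomial is the average of its permutations, so each monomial contributes the
  -- permanent of the matrix with entries z_j^{d_s}. Ryser's formula rewrites it as a combination of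
  -- products over j of W(z_j), where W is the sum of r^{d_s} over s outside T.
  have hW : ∀ (d : ρ.support) (T : Finset (Fin n)),
      (∑ s ∈ Tᶜ, (Polynomial.X : Polynomial ℂ) ^ d.1 s).natDegree ≤ q := by
    intro d T
    refine Polynomial.natDegree_sum_le_of_forall_le _ _ fun s _ => ?_
    rw [Polynomial.natDegree_X_pow]
    exact (monomial_le_degreeOf s d.2).trans (hq s)
  choose x hx using fun d T => exists_evalForm_eq_prod (n := n) (hW d T)
  have hf : (n.factorial : ℂ) ≠ 0 := by exact_mod_cast n.factorial_ne_zero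
  refine ⟨(n.factorial : ℂ)⁻¹ • ∑ d : ρ.support, coeff d.1 ρ • ∑ T : Finset (Fin n),
    (-1 : ℂ) ^ T.card • x d T, fun z => ?_⟩
  simp only [map_smul, map_sum, hx, smul_eq_mul, Polynomial.eval_finsetSum, Polynomial.eval_pow,
    Polynomial.eval_X]
  simp only [← sum_perm_prod fun s j => z j ^ _]
  rw [Finset.sum_congr rfl fun d _ => Finset.mul_sum _ _ _, Finset.sum_comm]
  have h : ∀ π : Equiv.Perm (Fin n),
      ∑ d : ρ.support, coeff d.1 ρ * ∏ j, z j ^ d.1 (π j) = eval z ρ := by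
    intro π
    conv_rhs => rw [← hρ π.symm, eval_rename, eval_eq', ← Finset.sum_coe_sort]
    refine Finset.sum_congr rfl fun d _ => ?_
    congr 1
    rw [← Equiv.prod_comp π fun j => (z ∘ π.symm) j ^ d.1 j]
    simp
  rw [Finset.sum_congr rfl fun π _ => h π, Finset.sum_const, Finset.card_univ, Fintype.card_perm,
    Fintype.card_fin, nsmul_eq_mul, inv_mul_cancel_left₀ hf]

/-! ## Residues -/

/-- The polynomial `∏_{d ≠ c} (r - z_d)`. -/
def nodalErase {n : ℕ} (z : Fin n → ℂ) (c : Fin n) : Polynomial ℂ :=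
  ∏ d ∈ Finset.univ.erase c, (Polynomial.X - Polynomial.C (z d))

theorem eval_nodalErase_ne_zero {n : ℕ} {z : Fin n → ℂ} (hz : Function.Injective z) (c : Fin n) :
    (nodalErase z c).eval (z c) ≠ 0 := by
  rw [nodalErase, Polynomial.eval_prod]
  refine Finset.prod_ne_zero_iff.2 fun d hd => ?_
  rw [Polynomial.eval_sub, Polynomial.eval_X, Polynomial.eval_C, sub_ne_zero]
  exact fun h => Finset.ne_of_mem_erase hd (hz h).symm

/-- The numerator of the residue at `z_c` of `h / ∏ (r - z_d)²`, as a linear form in `h`. -/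
def resNum {n N : ℕ} (z : Fin n → ℂ) (c : Fin n) : Module.Dual ℂ (Forms N) where
  toFun h := (Polynomial.derivative (dehom h.1)).eval (z c) * (nodalErase z c).eval (z c) -
    2 * (dehom h.1).eval (z c) * (Polynomial.derivative (nodalErase z c)).eval (z c)
  map_add' h k := by
    simp only [Submodule.coe_add, map_add, Polynomial.eval_add]
    ring
  map_smul' a h := by
    simp only [Submodule.coe_smul, map_smul, Polynomial.eval_smul, smul_eq_mul, RingHom.id_apply]
    ring

theorem resNum_apply {n N : ℕ} (z : Fin n → ℂ) (c : Fin n) (h : Forms N) :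
    resNum z c h = (Polynomial.derivative (dehom h.1)).eval (z c) * (nodalErase z c).eval (z c) -
      2 * (dehom h.1).eval (z c) * (Polynomial.derivative (nodalErase z c)).eval (z c) := rfl

theorem dehom_prodForm {n : ℕ} (z : Fin n → ℂ) (c : Fin n) :
    dehom (prodForm (aff z)).1 = (Polynomial.X - Polynomial.C (z c)) * nodalErase z c := by
  rw [prodForm, dehom_powForm]
  simp only [pow_one]
  exact (Finset.mul_prod_erase _ (fun d => Polynomial.X - Polynomial.C (z d))
    (Finset.mem_univ c)).symm

/-- After division by P² the Jacobian is a multiple of the derivative of f / P, and derivatives of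
rational functions have no residues. -/
theorem resNum_jacobian {N : ℕ} (z : Fin (N + 1) → ℂ) (c : Fin (N + 1)) (f : Forms (N + 1)) :
    resNum z c (jacobian N (prodForm (aff z)) f) = 0 := by
  rw [resNum_apply, dehom_jacobian, dehom_prodForm z c]
  simp only [Polynomial.derivative_mul, Polynomial.derivative_sub, Polynomial.derivative_X,
    Polynomial.derivative_C, Polynomial.derivative_add, Polynomial.derivative_natCast,
    Polynomial.derivative_one, Polynomial.eval_mul, Polynomial.eval_add, Polynomial.eval_sub,
    Polynomial.eval_X, Polynomial.eval_C, Polynomial.eval_one, Polynomial.eval_zero, sub_self,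
    sub_zero, Polynomial.eval_natCast]
  ring

/-- The test form divided by P² is 1 / ((r - z_b)(r - z_d)), with residue 1 / (z_b - z_d) at z_b and
no pole at the other points. The cube is the denominator omitted in `resNum`. -/
theorem resNum_testForm_self {m : ℕ} (z : Fin (m + 2) → ℂ) {b d : Fin (m + 2)} (hbd : b ≠ d) :
    (z b - z d) * resNum z b (testForm b d (aff z)) = (nodalErase z b).eval (z b) ^ 3 := by
  have hN : nodalErase z b = (Polynomial.X - Polynomial.C (z d)) *
      ∏ l ∈ (Finset.univ.erase b).erase d, (Polynomial.X - Polynomial.C (z l)) :=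
    (Finset.mul_prod_erase _ _ (Finset.mem_erase.2 ⟨hbd.symm, Finset.mem_univ d⟩)).symm
  rw [resNum_apply, dehom_testForm hbd, eval_derivative_X_sub_C_mul]
  rw [hN, Finset.prod_pow]
  simp only [Polynomial.eval_mul, Polynomial.eval_sub, Polynomial.eval_X, Polynomial.eval_C,
    Polynomial.eval_pow, sub_self]
  ring

theorem resNum_testForm_of_ne {m : ℕ} (z : Fin (m + 2) → ℂ) {b d c : Fin (m + 2)} (hbd : b ≠ d)
    (hcb : c ≠ b) (hcd : c ≠ d) : resNum z c (testForm b d (aff z)) = 0 := by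
  rw [resNum_apply, dehom_testForm hbd, ← Finset.mul_prod_erase _ _ (Finset.mem_erase.2
      ⟨hcd, Finset.mem_erase.2 ⟨hcb, Finset.mem_univ c⟩⟩)]
  simp [Polynomial.derivative_pow]

/-- Functionals on `S^{2i} U*` with prescribed values at test forms, which vanish at the relevant
Jacobians. -/
def IsInterp {m : ℕ} (σ : Fin (m + 2) → MvPolynomial (Fin (m + 2)) ℂ) (z : Fin (m + 2) → ℂ)
    (l : Module.Dual ℂ (Forms (2 * (m + 1)))) : Prop :=
  (∀ f, l (jacobian (m + 1) (prodForm (aff z)) f) = 0) ∧ ∀ b d, b ≠ d →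
    (z d - z b) * l (testForm b d (aff z)) = eval z (σ b - σ d)

theorem IsInterp.unique {m : ℕ} {σ : Fin (m + 2) → MvPolynomial (Fin (m + 2)) ℂ}
    {z : Fin (m + 2) → ℂ} (hz : Function.Injective z) {l l' : Module.Dual ℂ (Forms (2 * (m + 1)))}
    (h : IsInterp σ z l) (h' : IsInterp σ z l') : l = l' := by
  rw [← sub_eq_zero]
  refine dual_eq_zero_of_test hz 0 (fun c hc => ?_) fun f => ?_
  · have := (h.2 c 0 hc).trans (h'.2 c 0 hc).symm
    rw [LinearMap.sub_apply, sub_eq_zero]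
    exact mul_left_cancel₀ (sub_ne_zero.2 fun e => hc (hz e).symm) this
  · rw [LinearMap.sub_apply, h.1, h'.1, sub_zero]

/-- The interpolating functional, as a combination of residues. -/
def interp {m : ℕ} (σ : Fin (m + 2) → MvPolynomial (Fin (m + 2)) ℂ) (z : Fin (m + 2) → ℂ)
    (a : Fin (m + 2)) : Module.Dual ℂ (Forms (2 * (m + 1))) :=
  ∑ c, (eval z (σ a - σ c) * ((nodalErase z c).eval (z c) ^ 3)⁻¹) • resNum z c

/-- On the test form of b and d only the residues at z_b and z_d survive. They contribute ((σ_a -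
σ_d) - (σ_a - σ_b)) / (z_d - z_b), in which σ_a cancels. -/
theorem isInterp_interp {m : ℕ} (σ : Fin (m + 2) → MvPolynomial (Fin (m + 2)) ℂ)
    {z : Fin (m + 2) → ℂ} (hz : Function.Injective z) (a : Fin (m + 2)) :
    IsInterp σ z (interp σ z a) := by
  constructor
  · intro f
    simp [interp, resNum_jacobian]
  · intro b d hbd
    have hb := pow_ne_zero 3 (eval_nodalErase_ne_zero hz b)
    have hd := pow_ne_zero 3 (eval_nodalErase_ne_zero hz d)
    have e1 := resNum_testForm_self z hbd
    have e2 := resNum_testForm_self z hbd.symm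
    rw [testForm_comm] at e2
    rw [interp, LinearMap.sum_apply, Finset.sum_eq_add_of_mem b d (Finset.mem_univ b)
      (Finset.mem_univ d) hbd fun c _ hc => by
        rw [LinearMap.smul_apply, resNum_testForm_of_ne z hbd hc.1 hc.2, smul_zero]]
    simp only [LinearMap.smul_apply, smul_eq_mul, map_sub]
    generalize (nodalErase z b).eval (z b) ^ 3 = u at *
    generalize (nodalErase z d).eval (z d) ^ 3 = v at *
    have k1 : u⁻¹ * ((z b - z d) * resNum z b (testForm b d (aff z))) = 1 := by
      rw [e1, inv_mul_cancel₀ hb]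
    have k2 : v⁻¹ * ((z d - z b) * resNum z d (testForm b d (aff z))) = 1 := by
      rw [e2, inv_mul_cancel₀ hd]
    linear_combination (eval z (σ a) - eval z (σ d)) * k2 - (eval z (σ a) - eval z (σ b)) * k1

/-- Together with uniqueness, this makes the interpolating functional a symmetric function of the
points. -/
theorem IsInterp.of_comp {m : ℕ} {σ : Fin (m + 2) → MvPolynomial (Fin (m + 2)) ℂ}
    (hσ : ∀ (π : Equiv.Perm (Fin (m + 2))) a, rename π (σ a) = σ (π a)) {z : Fin (m + 2) → ℂ}
    {l : Module.Dual ℂ (Forms (2 * (m + 1)))} (π : Equiv.Perm (Fin (m + 2)))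
    (h : IsInterp σ (z ∘ π) l) : IsInterp σ z l := by
  constructor
  · intro f
    have := h.1 f
    rwa [aff_comp, prodForm_comp] at this
  · intro b d hbd
    have := h.2 (π.symm b) (π.symm d) (fun e => hbd (π.symm.injective e))
    rw [aff_comp, testForm_comp, ← eval_rename, map_sub, hσ, hσ] at this
    simpa using this

/-! ### Polynomial dependence on the points -/

/-- The polynomial with values `∏_{d ≠ c} (z_c - z_d)` for `d` in a set of indices. -/
def diffProd {n : ℕ} (s : Finset (Fin n)) (c : Fin n) : MvPolynomial (Fin n) ℂ :=
  ∏ d ∈ s, (X c - X d)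

theorem degreeOf_diffProd_le {n : ℕ} {s : Finset (Fin n)} {c j : Fin n} (hc : c ∉ s) (hj : j ≠ c) :
    degreeOf j (diffProd s c) ≤ if j ∈ s then 1 else 0 := by
  refine (degreeOf_prod_le _ _ _).trans ?_
  rw [Finset.sum_congr rfl fun d hd => degreeOf_X_sub_X (ne_of_mem_of_not_mem hd hc).symm j]
  simp [hj]

theorem diffProd_ne_zero {n : ℕ} {s : Finset (Fin n)} {c : Fin n} (hc : c ∉ s) :
    diffProd s c ≠ 0 :=
  Finset.prod_ne_zero_iff.2 fun _ hd => (prime_X_sub_X (ne_of_mem_of_not_mem hd hc).symm).ne_zero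

theorem eval_diffProd_erase {n : ℕ} (z : Fin n → ℂ) (c : Fin n) :
    eval z (diffProd (Finset.univ.erase c) c) = (nodalErase z c).eval (z c) := by
  rw [nodalErase, Polynomial.eval_prod, diffProd, map_prod]
  simp

/-- A variable z_j with j ≠ c enters only through the nodal product at c and its derivative, and
linearly in both. -/
theorem exists_resNum_eq {n N : ℕ} (c : Fin n) (h : Forms N) : ∃ R : MvPolynomial (Fin n) ℂ,
    (∀ z, eval z R = resNum z c h) ∧ ∀ j, j ≠ c → degreeOf j R ≤ 1 := by
  have hp : ∀ f : Polynomial ℂ, ∃ F : MvPolynomial (Fin n) ℂ,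
      (∀ z, eval z F = f.eval (z c)) ∧ ∀ j, j ≠ c → degreeOf j F = 0 := by
    intro f
    refine ⟨∑ i ∈ Finset.range (f.natDegree + 1), C (f.coeff i) * X c ^ i, fun z => ?_,
      fun j hj => ?_⟩
    · rw [Polynomial.eval_eq_sum_range]
      simp
    · refine Nat.le_zero.1 ((degreeOf_sum_le _ _ _).trans (Finset.sup_le fun i _ => ?_))
      refine (degreeOf_C_mul_le _ _ _).trans ?_
      rw [degreeOf_X_pow_of_ne _ hj]
  obtain ⟨F, hF, hF'⟩ := hp (dehom h.1)
  obtain ⟨D, hD, hD'⟩ := hp (Polynomial.derivative (dehom h.1))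
  refine ⟨D * diffProd (Finset.univ.erase c) c -
    C 2 * F * ∑ d ∈ Finset.univ.erase c, diffProd ((Finset.univ.erase c).erase d) c,
    fun z => ?_, fun j hj => ?_⟩
  · rw [resNum_apply, map_sub, map_mul, map_mul, map_mul, hF, hD, eval_diffProd_erase, eval_C]
    congr 2
    rw [nodalErase, Polynomial.derivative_prod_finset, Polynomial.eval_finsetSum, map_sum]
    refine Finset.sum_congr rfl fun d _ => ?_
    rw [diffProd, map_prod]
    simp [Polynomial.eval_prod]
  · have h1 : ∀ s : Finset (Fin n), c ∉ s → degreeOf j (diffProd s c) ≤ 1 := fun s hs =>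
      (degreeOf_diffProd_le hs hj).trans (by split_ifs <;> simp)
    refine (degreeOf_sub_le _ _ _).trans (max_le ?_ ?_)
    · refine (degreeOf_mul_le _ _ _).trans ?_
      rw [hD' j hj, zero_add]
      exact h1 _ (Finset.notMem_erase c _)
    · refine (degreeOf_mul_le _ _ _).trans ?_
      have h2 := degreeOf_C_mul_le F j 2
      rw [hF' j hj] at h2
      have h3 : degreeOf j (∑ d ∈ Finset.univ.erase c,
          diffProd ((Finset.univ.erase c).erase d) c) ≤ 1 :=
        (degreeOf_sum_le _ _ _).trans (Finset.sup_le fun d _ => h1 _ fun hc =>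
          Finset.notMem_erase c _ (Finset.mem_of_mem_erase hc))
      omega

/-- In a factorial domain, `D` divides `N` as soon as it does so up to factors which are prime to
the prime factors of `D`. -/
theorem dvd_of_dvd_mul_of_prime {R : Type*} [CommRing R] [IsDomain R] [UniqueFactorizationMonoid R]
    {D N : R} (hD : D ≠ 0) (h : ∀ p, Prime p → p ∣ D → ∃ E, ¬ p ∣ E ∧ D ∣ E * N) : D ∣ N := by
  obtain ⟨u, v, c, huv, rfl, rfl⟩ := UniqueFactorizationMonoid.exists_reduced_factors' N D hD
  refine mul_dvd_mul_left c (IsUnit.dvd ?_)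
  by_contra hv
  obtain ⟨p, hp, hpv⟩ := WfDvdMonoid.exists_irreducible_factor hv (right_ne_zero_of_mul hD)
  obtain ⟨E, hE, hdE⟩ := h p hp.prime (hpv.mul_left c)
  rw [mul_left_comm, mul_dvd_mul_iff_left (left_ne_zero_of_mul hD)] at hdE
  refine hE (hpv.trans ?_)
  exact (huv.symm.dvd_of_dvd_mul_right hdE)

/-- The common denominator of the interpolating functionals attached to the index `a`. -/
def interpDen {n : ℕ} (a : Fin n) : MvPolynomial (Fin n) ℂ :=
  ∏ e ∈ Finset.univ.erase a, diffProd ((Finset.univ.erase a).erase e) e ^ 3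

theorem interpDen_ne_zero {n : ℕ} (a : Fin n) : interpDen a ≠ 0 :=
  Finset.prod_ne_zero_iff.2 fun e _ => pow_ne_zero 3 (diffProd_ne_zero (Finset.notMem_erase e _))

theorem Prime.exists_of_dvd_interpDen {n : ℕ} {a : Fin n} {p : MvPolynomial (Fin n) ℂ}
    (hp : Prime p) (h : p ∣ interpDen a) : ∃ c d, c ≠ a ∧ d ≠ a ∧ c ≠ d ∧ p ∣ X c - X d := by
  obtain ⟨c, hc, h⟩ := (hp.dvd_finsetProd_iff _).1 h
  obtain ⟨d, hd, h⟩ := (hp.dvd_finsetProd_iff _).1 (hp.dvd_of_dvd_pow h)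
  exact ⟨c, d, Finset.ne_of_mem_erase hc, Finset.ne_of_mem_erase (Finset.mem_of_mem_erase hd),
    (Finset.ne_of_mem_erase hd).symm, h⟩

/-- A prime factor of `interpDen a` is associated to some X c - X d, whereas no factor of `interpDen
c` involves X c. -/
theorem exists_not_dvd_interpDen {n : ℕ} {a : Fin n} {p : MvPolynomial (Fin n) ℂ}
    (hp : Prime p) (h : p ∣ interpDen a) : ∃ c, ¬ p ∣ interpDen c := by
  obtain ⟨c, d, -, -, hcd, hpd⟩ := Prime.exists_of_dvd_interpDen hp h
  refine ⟨c, fun h' => ?_⟩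
  obtain ⟨e, f, hec, hfc, hef, hpe⟩ := Prime.exists_of_dvd_interpDen hp h'
  have h1 := (hp.irreducible.dvd_symm (prime_X_sub_X hcd).irreducible hpd).trans hpe
  rw [X_sub_X_dvd_X_sub_X_iff] at h1
  by_cases he : e = d
  · rw [he, Function.update_self, Function.update_of_ne (fun hf => hef (he.trans hf.symm)), id]
        at h1
    exact hfc h1.symm
  · rw [Function.update_of_ne he, id] at h1
    by_cases hf : f = d
    · rw [hf, Function.update_self] at h1
      exact hec h1
    · rw [Function.update_of_ne hf, id] at h1
      exact hef h1

section Interpolation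

variable {m q : ℕ} {σ : Fin (m + 2) → MvPolynomial (Fin (m + 2)) ℂ}

/-- The interpolating functionals, multiplied by their denominators, depend polynomially on the
points. -/
theorem exists_interpNum (hσ : ∀ a b, a ≠ b → (X a - X b) ^ 3 ∣ σ a - σ b)
    (hd : ∀ a j, degreeOf j (σ a) ≤ q + 2) (hq : 1 ≤ q) (h : Forms (2 * (m + 1)))
    (a : Fin (m + 2)) : ∃ N : MvPolynomial (Fin (m + 2)) ℂ,
      (∀ z, Function.Injective z → eval z N = eval z (interpDen a) * interp σ z a h) ∧
        degreeOf a N ≤ q := by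
  -- The cube of X c - X a in the numerator cancels the same cube in the denominator of the residue
  -- at z_c. This is why no factor of `interpDen a` involves X a.
  have hκ : ∀ c, ∃ κ, c ≠ a → σ a - σ c = (X c - X a) ^ 3 * κ := fun c => by
    by_cases hc : c = a
    · exact ⟨0, fun h => absurd hc h⟩
    · obtain ⟨κ, hκ⟩ := hσ a c (Ne.symm hc)
      exact ⟨-κ, fun _ => by rw [hκ]; ring⟩
  choose κ hκ using hκ
  choose R hR hR' using fun c => exists_resNum_eq (n := m + 2) c h
  refine ⟨∑ c ∈ Finset.univ.erase a, κ c * R c * ∏ e ∈ (Finset.univ.erase a).erase c,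
    diffProd ((Finset.univ.erase a).erase e) e ^ 3, fun z hz => ?_, ?_⟩
  · rw [interp, LinearMap.sum_apply, ← Finset.sum_erase (s := Finset.univ) (a := a)
      (f := fun c => ((eval z (σ a - σ c) * ((nodalErase z c).eval (z c) ^ 3)⁻¹) •
        (resNum z c : Module.Dual ℂ (Forms (2 * (m + 1))))) h) (by simp), Finset.mul_sum, map_sum]
    refine Finset.sum_congr rfl fun c hc => ?_
    have hca := Finset.ne_of_mem_erase hc
    have hn : (nodalErase z c).eval (z c) =
        (z c - z a) * eval z (diffProd ((Finset.univ.erase a).erase c) c) := by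
      rw [← eval_diffProd_erase, Finset.erase_right_comm, diffProd, diffProd,
        ← Finset.mul_prod_erase _ _ (Finset.mem_erase.2 ⟨hca.symm, Finset.mem_univ a⟩), map_mul]
      simp
    have hn0 := eval_nodalErase_ne_zero hz c
    rw [interpDen, ← Finset.mul_prod_erase _ _ hc, hκ c hca]
    simp only [map_mul, map_pow, map_sub, eval_X, LinearMap.smul_apply, smul_eq_mul, hR]
    rw [hn] at hn0 ⊢
    have h1 := left_ne_zero_of_mul hn0
    have h2 := right_ne_zero_of_mul hn0
    field_simp
  · refine (degreeOf_sum_le _ _ _).trans (Finset.sup_le fun c hc => ?_)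
    have hca := Finset.ne_of_mem_erase hc
    -- The difference of the σ's has degree at most q + 2 in z_a, and removing the cube leaves at
    -- most q - 1. The residue numerator adds at most 1, and the remaining denominators do not
    -- involve z_a.
    have h1 : degreeOf a (κ c) + 1 ≤ q := by
      by_cases h0 : κ c = 0
      · rw [h0, degreeOf_zero]
        exact hq
      · have h2 : degreeOf a (σ a - σ c) ≤ q + 2 :=
          (degreeOf_sub_le _ _ _).trans (max_le (hd _ _) (hd _ _))
        have hp := (prime_X_sub_X hca).ne_zero
        rw [hκ c hca, degreeOf_mul_eq (pow_ne_zero 3 hp) h0, degreeOf_pow_eq _ _ _ hp,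
          degreeOf_X_sub_X hca] at h2
        simp [hca.symm] at h2
        omega
    have h3 : degreeOf a (∏ e ∈ (Finset.univ.erase a).erase c,
        diffProd ((Finset.univ.erase a).erase e) e ^ 3) = 0 := by
      refine Nat.le_zero.1 ((degreeOf_prod_le _ _ _).trans ?_)
      rw [Finset.sum_eq_zero]
      intro e he
      have hea := Finset.ne_of_mem_erase (Finset.mem_of_mem_erase he)
      have h4 := degreeOf_diffProd_le (Finset.notMem_erase e (Finset.univ.erase a)) hea.symm
      rw [if_neg fun h => Finset.notMem_erase a _ (Finset.mem_of_mem_erase h)] at h4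
      refine Nat.le_zero.1 ((degreeOf_pow_le _ _ _).trans ?_)
      rw [Nat.le_zero.1 h4, mul_zero]
    have h5 := hR' c a hca.symm
    have h6 := degreeOf_mul_le a (κ c) (R c)
    have h7 := degreeOf_mul_le a (κ c * R c) (∏ e ∈ (Finset.univ.erase a).erase c,
        diffProd ((Finset.univ.erase a).erase e) e ^ 3)
    omega

/-- This amounts to the residue theorem: the coefficients for a and b differ by the constant σ_a -
σ_b, and the residues of h / P² add up to zero. Uniqueness of interpolation gives it without
computation. -/
theorem interp_eq (z : Fin (m + 2) → ℂ) (hz : Function.Injective z) (a b : Fin (m + 2)) :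
    interp σ z a = interp σ z b :=
  (isInterp_interp σ hz a).unique hz (isInterp_interp σ hz b)

/-- The interpolating functionals depend polynomially on the points. -/
theorem exists_interpPoly (hσ : ∀ a b, a ≠ b → (X a - X b) ^ 3 ∣ σ a - σ b)
    (hd : ∀ a j, degreeOf j (σ a) ≤ q + 2) (hq : 1 ≤ q) (h : Forms (2 * (m + 1))) :
    ∃ ρ : MvPolynomial (Fin (m + 2)) ℂ,
      (∀ z, Function.Injective z → eval z ρ = interp σ z 0 h) ∧ ∀ j, degreeOf j ρ ≤ q := by
  choose N hN hN' using exists_interpNum hσ hd hq h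
  have hND : ∀ a b, interpDen b * N a = interpDen a * N b := by
    intro a b
    refine eq_of_eval_injective fun z hz => ?_
    rw [map_mul, map_mul, hN a z hz, hN b z hz, interp_eq z hz a b]
    ring
  -- All fractions N a / `interpDen a` agree. Each prime factor of `interpDen 0` fails to divide
  -- some `interpDen c`, while `interpDen 0` divides `interpDen c * N 0`; so no prime survives in
  -- the reduced denominator.
  obtain ⟨ρ, hρ⟩ : interpDen 0 ∣ N 0 := by
    refine dvd_of_dvd_mul_of_prime (interpDen_ne_zero 0) fun p hp hpd => ?_
    obtain ⟨c, hc⟩ := exists_not_dvd_interpDen hp hpd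
    exact ⟨_, hc, by rw [hND 0 c]; exact dvd_mul_right _ _⟩
  have hρ' : ∀ a, N a = interpDen a * ρ := fun a => by
    refine mul_left_cancel₀ (interpDen_ne_zero 0) ?_
    rw [hND a 0, hρ]
    ring
  refine ⟨ρ, fun z hz => ?_, fun j => ?_⟩
  · have hne : eval z (interpDen (0 : Fin (m + 2))) ≠ 0 := by
      simp only [interpDen, diffProd, map_prod, map_pow]
      refine Finset.prod_ne_zero_iff.2 fun e _ => pow_ne_zero 3 (Finset.prod_ne_zero_iff.2
        fun d hd => ?_)
      rw [map_sub, eval_X, eval_X, sub_ne_zero]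
      exact fun h => Finset.ne_of_mem_erase hd (hz h).symm
    refine mul_left_cancel₀ hne ?_
    rw [← hN 0 z hz, hρ, map_mul]
  · by_cases h0 : ρ = 0
    · rw [h0, degreeOf_zero]
      exact Nat.zero_le _
    -- The numerator bound controls only the variable of its own index, so the degree in z_j is read
    -- off from the presentation attached to j.
    · have h1 := hN' j
      rw [hρ', degreeOf_mul_eq (interpDen_ne_zero j) h0] at h1
      omega

/-- The interpolating functionals come from an element of `S^{2i} U ⊗ S^q S^{i+1} U`, where
`i = m + 1`. -/
theorem exists_pairForm_isInterp
    (hπ : ∀ (π : Equiv.Perm (Fin (m + 2))) a, rename π (σ a) = σ (π a))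
    (hσ : ∀ a b, a ≠ b → (X a - X b) ^ 3 ∣ σ a - σ b)
    (hd : ∀ a j, degreeOf j (σ a) ≤ q + 2) (hq : 1 ≤ q) :
    ∃ G : Forms (2 * (m + 1)) ⊗[ℂ] symPowZ (Forms (m + 2)) q,
      ∀ z, Function.Injective z → IsInterp σ z (pairFormLin G (prodForm (aff z))) := by
  let B := Module.finBasis ℂ (Forms (2 * (m + 1)))
  choose ρ hρ hρ' using fun h => exists_interpPoly hσ hd hq h
  have hρπ : ∀ h (π : Equiv.Perm (Fin (m + 2))), rename π (ρ h) = ρ h := by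
    intro h π
    refine eq_of_eval_injective fun z hz => ?_
    have hz' : Function.Injective (z ∘ π) := hz.comp π.injective
    rw [eval_rename, hρ h _ hz', hρ h z hz]
    congr 1
    exact ((isInterp_interp σ hz' 0).of_comp hπ π).unique hz (isInterp_interp σ hz 0)
  choose x hx using fun h => exists_evalForm_eq (hρ' h) (hρπ h)
  -- The functional is reassembled from its values on a basis: dual basis vectors, carried over by
  -- apolarity, are tensored with the elements representing these values.
  refine ⟨∑ k, (apolarEquiv _).symm (B.coord k) ⊗ₜ x (B k), fun z hz => ?_⟩
  convert isInterp_interp σ hz 0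
  ext h
  rw [pairFormLin_apply, map_sum]
  simp only [pairForm_tmul, hx, hρ _ z hz]
  have e : ∀ k, apolar _ ((apolarEquiv _).symm (B.coord k)) h = B.coord k h := fun k =>
    LinearMap.congr_fun ((apolarEquiv _).apply_symm_apply (B.coord k)) h
  conv_rhs => rw [← B.sum_repr h, map_sum]
  exact Finset.sum_congr rfl fun k _ => by rw [e, map_smul, smul_eq_mul, Module.Basis.coord_apply]

end Interpolation

/-! ## From Koszul cycles to the kernel of `γ'` -/

theorem mem_ker_of_isInterp {g m : ℕ} {σ : Fin (m + 2) → MvPolynomial (Fin (m + 2)) ℂ}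
    {G : Forms (2 * (m + 1)) ⊗[ℂ] symPowZ (Forms (m + 1 + 1)) ((g : ℤ) - (m + 1 : ℕ) - 2)}
    (hG : ∀ z, Function.Injective z → IsInterp σ z (pairFormLin G (prodForm (aff z)))) :
    G ∈ LinearMap.ker (gammaPrime g (m + 1)) := by
  rw [mem_ker_gammaPrime_iff]
  intro p f
  have h : ∀ l : Module.Dual ℂ (Forms (2 * (m + 1))),
      (fun p : Fin (m + 1 + 1) → Fin 2 → ℂ => l (jacobian (m + 1) (prodForm p) f)) ∈
        multiHom fun _ => 1 := by
    intro l
    have h1 : (fun p : Fin (m + 1 + 1) → Fin 2 → ℂ => l (jacobian (m + 1) (prodForm p) f)) =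
        fun p => (l ∘ₗ (jacobian (m + 1)).flip f) (prodForm p) := funext fun p => by
      rw [LinearMap.comp_apply, LinearMap.flip_apply]
    rw [h1]
    exact powForm_mem_multiHom (N := m + 1 + 1) (fun _ => 1) (by simp) _
  have h' := pairForm_mem_multiHom (f := fun p => jacobian (m + 1) (prodForm p) f) h G
  have h'' : ∀ z : Fin (m + 1 + 1) → ℂ, Function.Injective z →
      pairForm (powForm (fun _ => 1) (by simp) (aff z))
        (jacobian (m + 1) (prodForm (aff z)) f) G = 0 := fun z hz => (hG z hz).1 f
  exact multiHom_eq_zero_of_injective h' h'' p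

theorem comp_perm_mem_multiHom {n g : ℕ} {f : (Fin n → Fin 2 → ℂ) → ℂ}
    (hf : f ∈ multiHom fun _ => g) (π : Equiv.Perm (Fin n)) :
    (fun p => f (p ∘ π)) ∈ multiHom fun _ : Fin n => g := by
  induction hf using Submodule.span_induction with
  | mem f hf =>
    obtain ⟨v, rfl⟩ := hf
    let w : Fin n → Forms g := v
    convert prod_mem_multiHom (d := fun _ => g) fun j => w (π.symm j) using 1
    funext p
    rw [← Equiv.prod_comp π fun j => evForm g (p j) (w (π.symm j))]
    simp only [Equiv.symm_apply_apply]
    rfl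
  | zero => exact Submodule.zero_mem (multiHom _)
  | add a b _ _ ha hb => exact Submodule.add_mem _ ha hb
  | smul c a _ ha => exact Submodule.smul_mem _ c ha

/-- The polynomials τ a, obtained from σ by moving the distinguished variable, satisfy the cubic
divisibility for all pairs, so they can be interpolated. On distinct affine points `symEval` and
`formEval` are then both the discriminant times τ 0 - τ 1. -/
theorem exists_mem_ker_of_cycle {g m : ℕ} (hg : 2 ≤ g)
    {ω : (⋀[ℂ]^(m + 1) (Forms g)) ⊗[ℂ] Forms g}
    (hω : wedgeLinEquiv hg (m + 1) ω ∈ koszulCycles (sectionsMul g 1) (m + 1)) :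
    ∃ G ∈ LinearMap.ker (gammaPrime g (m + 1)), symEval g m ω = formEval m _ G := by
  obtain ⟨σ, h1, h2, h3, h4⟩ := exists_quotient_vandPoly hg hω
  have hev : ∀ z, symEval g m ω (aff z) =
      disc (aff z) * eval z (σ - rename (Equiv.swap 0 1) σ) := by
    intro z
    have e := h1 (z ∘ Equiv.swap 0 1)
    rw [aff_comp, disc_comp, Equiv.Perm.sign_swap (by simp)] at e
    rw [symEval_apply, h1, map_sub, eval_rename]
    simp only [Function.comp_apply] at e
    rw [e]
    push_cast
    ring
  have hmem : symEval g m ω ∈ multiHom fun _ => g :=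
    Submodule.add_mem _ (wedgeEval_mem_multiHom ω)
      (comp_perm_mem_multiHom (wedgeEval_mem_multiHom ω) (Equiv.swap 0 1))
  by_cases h0 : σ - rename (Equiv.swap 0 1) σ = 0
  · refine ⟨0, Submodule.zero_mem _, funext fun p => ?_⟩
    rw [map_zero, Pi.zero_apply]
    exact multiHom_eq_zero_of_injective hmem (fun z _ => by rw [hev, h0, map_zero, mul_zero]) p
  have hd : ∀ j, degreeOf j σ + (m + 1) ≤ g := h2.resolve_left fun h => h0 (by simp [h])
  -- Since σ is symmetric in the other variables, any permutation sending 0 to a gives the same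
  -- polynomial; hence the τ a are permuted equivariantly.
  let τ : Fin (m + 2) → MvPolynomial (Fin (m + 2)) ℂ := fun a => rename (Equiv.swap 0 a) σ
  have hτ : ∀ π : Equiv.Perm (Fin (m + 2)), rename π σ = τ (π 0) := by
    intro π
    have h5 := h3 (Equiv.swap 0 (π 0) * π) (by simp)
    have h6 := congrArg (rename (Equiv.swap 0 (π 0))) h5
    rw [rename_rename, ← Equiv.Perm.coe_mul, ← mul_assoc, Equiv.swap_mul_self, one_mul] at h6
    exact h6
  have hτ' : ∀ (π : Equiv.Perm (Fin (m + 2))) a, rename π (τ a) = τ (π a) := by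
    intro π a
    have h5 := hτ (π * Equiv.swap 0 a)
    rw [Equiv.Perm.mul_apply, Equiv.swap_apply_left] at h5
    rw [← h5, rename_rename, Equiv.Perm.coe_mul]
  have hτ0 : τ 0 = σ := by
    simp only [τ, Equiv.swap_self, Equiv.coe_refl, rename_id_apply]
  have hdvd : ∀ a b, a ≠ b → (X a - X b) ^ 3 ∣ τ a - τ b := by
    intro a b hab
    obtain ⟨π, rfl, rfl⟩ := exists_perm_zero_one hab
    have h5 := map_dvd (rename π) h4
    rw [map_pow, map_sub, map_sub, rename_X, rename_X] at h5
    rwa [← hτ' π 0, ← hτ' π 1, hτ0]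
  have hdeg : ∀ a j, degreeOf j (τ a) + (m + 1) ≤ g := by
    intro a j
    have h5 := degreeOf_rename_of_injective (p := σ) (Equiv.swap 0 a).injective (Equiv.swap 0 a j)
    rw [Equiv.swap_apply_self] at h5
    rw [h5]
    exact hd _
  -- A nonzero multiple of (X 0 - X 1)³ has degree at least 3 in the first variable, while the
  -- degree is at most g - (m + 1). So the exponent g - i - 2 is positive, as interpolation
  -- requires.
  have hgm : m + 4 ≤ g := by
    obtain ⟨K, hK⟩ := h4
    have hK0 : K ≠ 0 := fun h => h0 (by rw [hK, h, mul_zero])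
    have hp := (prime_X_sub_X (a := (0 : Fin (m + 2))) (b := 1) (by simp)).ne_zero
    have h5 := degreeOf_sub_le 0 (τ 0) (τ 1)
    rw [hτ0] at h5
    change degreeOf 0 (σ - rename (Equiv.swap 0 1) σ) ≤ _ at h5
    rw [hK, degreeOf_mul_eq (pow_ne_zero 3 hp) hK0, degreeOf_pow_eq _ _ _ hp,
      degreeOf_X_sub_X (by simp), ← hτ0] at h5
    have h6 := hdeg 0 0
    have h7 := hdeg 1 0
    simp at h5
    omega
  obtain ⟨q, rfl⟩ := Nat.exists_eq_add_of_le hgm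
  have hQ : ((m + 4 + q : ℕ) : ℤ) - (m + 1 : ℕ) - 2 = (q + 1 : ℕ) := by
    push_cast
    ring
  obtain ⟨G, hG⟩ : ∃ G : Forms (2 * (m + 1)) ⊗[ℂ]
      symPowZ (Forms (m + 1 + 1)) (((m + 4 + q : ℕ) : ℤ) - (m + 1 : ℕ) - 2),
        ∀ z, Function.Injective z → IsInterp τ z (pairFormLin G (prodForm (aff z))) := by
    rw [hQ]
    exact exists_pairForm_isInterp hτ' hdvd (fun a j => by have := hdeg a j; omega) (by omega)
  refine ⟨G, mem_ker_of_isInterp hG, ?_⟩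
  have hmem' : formEval m _ G ∈ multiHom fun _ : Fin (m + 2) => m + 4 + q := by
    have h5 := testEval_mem_multiHom 0 1 G
    have e : m + 3 + (((m + 4 + q : ℕ) : ℤ) - (m + 1 : ℕ) - 2).toNat = m + 4 + q := by
      rw [hQ, Int.toNat_natCast]
      omega
    rwa [e] at h5
  funext p
  rw [← sub_eq_zero]
  refine multiHom_eq_zero_of_injective (Submodule.sub_mem _ hmem hmem') (fun z hz => ?_) p
  have h5 := (hG z hz).2 0 1 (by simp)
  rw [Pi.sub_apply, hev, formEval_apply, testEval, bracket_aff, mul_assoc, ← pairFormLin_apply, h5,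
    hτ0, sub_self]

/-! ## The isomorphism -/

section Koszul

theorem subquotientClass_surjective {E : Type*} [AddCommGroup E] [Module ℂ E]
    (Z B : Submodule ℂ E) (x : Subquotient Z B) : ∃ z hz, subquotientClass Z B z hz = x := by
  obtain ⟨⟨z, hz⟩, h⟩ := Submodule.Quotient.mk_surjective _ x
  exact ⟨z, hz, h⟩

theorem subquotientMap_class {E : Type*} [AddCommGroup E] [Module ℂ E] (Z B : Submodule ℂ E)
    (f : E →ₗ[ℂ] E) (hZ : ∀ x ∈ Z, f x ∈ Z) (hB : ∀ x ∈ B, f x ∈ B) (z : E) (hz : z ∈ Z) :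
    Subquotient.map Z B f hZ hB (subquotientClass Z B z hz) =
      subquotientClass Z B (f z) (hZ z hz) := rfl

variable {V M N L : Type*} [AddCommGroup V] [Module ℂ V] [AddCommGroup M] [Module ℂ M]
  [AddCommGroup N] [Module ℂ N] [AddCommGroup L] [Module ℂ L]

/-- The class of a Koszul cycle in the Koszul group. -/
def koszulClass (ν : V →ₗ[ℂ] L →ₗ[ℂ] M) (μ : V →ₗ[ℂ] M →ₗ[ℂ] N) (i : ℕ)
    (z : (⋀[ℂ]^i V) ⊗[ℂ] M) (hz : z ∈ koszulCycles μ i) : KoszulGroup ν μ i :=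
  show Subquotient (E := (⋀[ℂ]^i V) ⊗[ℂ] M) (koszulCycles μ i) (koszulBoundaries ν i) from
    subquotientClass (koszulCycles μ i) (koszulBoundaries ν i) z hz

theorem koszulClass_surjective (ν : V →ₗ[ℂ] L →ₗ[ℂ] M) (μ : V →ₗ[ℂ] M →ₗ[ℂ] N) (i : ℕ)
    (x : KoszulGroup ν μ i) : ∃ z hz, koszulClass ν μ i z hz = x := by
  have h := subquotientClass_surjective (E := (⋀[ℂ]^i V) ⊗[ℂ] M) (koszulCycles μ i)
    (koszulBoundaries ν i)
  exact h x

theorem koszulGroupMap_koszulClass (ν : V →ₗ[ℂ] L →ₗ[ℂ] M) (μ : V →ₗ[ℂ] M →ₗ[ℂ] N) (i : ℕ)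
    (φ : V →ₗ[ℂ] V) (γ : L →ₗ[ℂ] L) (α : M →ₗ[ℂ] M) (β : N →ₗ[ℂ] N)
    (hν : ∀ v l, ν (φ v) (γ l) = α (ν v l)) (hμ : ∀ v m, μ (φ v) (α m) = β (μ v m))
    (z : (⋀[ℂ]^i V) ⊗[ℂ] M) (hz : z ∈ koszulCycles μ i) :
    koszulGroupMap ν μ i φ γ α β hν hμ (koszulClass ν μ i z hz) =
      koszulClass ν μ i (TensorProduct.map (exteriorPower.map i φ) α z)
        (koszulCycles_map μ i φ α β hμ z hz) := by
  have h := subquotientMap_class (E := (⋀[ℂ]^i V) ⊗[ℂ] M) (koszulCycles μ i) (koszulBoundaries ν i)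
    (TensorProduct.map (exteriorPower.map i φ) α)
  exact h _ _ z hz

theorem exists_koszulGroup_equiv (ν : V →ₗ[ℂ] L →ₗ[ℂ] M) (μ : V →ₗ[ℂ] M →ₗ[ℂ] N) (i : ℕ)
    {X W F : Type*} [AddCommGroup X] [Module ℂ X] [AddCommGroup W] [Module ℂ W] [AddCommGroup F]
    [Module ℂ F] (K : Submodule ℂ W) (θ : X ≃ₗ[ℂ] (⋀[ℂ]^i V) ⊗[ℂ] M) (a : X →ₗ[ℂ] F)
    (b : W →ₗ[ℂ] F) (ha : ∀ x, θ x ∈ koszulCycles μ i → (a x = 0 ↔ θ x ∈ koszulBoundaries ν i))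
    (hb : ∀ n ∈ K, b n = 0 → n = 0) (hab : ∀ x, θ x ∈ koszulCycles μ i → ∃ n ∈ K, a x = b n)
    (hba : ∀ n ∈ K, ∃ x, θ x ∈ koszulCycles μ i ∧ a x = b n) :
    ∃ e : KoszulGroup ν μ i ≃ₗ[ℂ] K, ∀ x hx, a x = b (e (koszulClass ν μ i (θ x) hx)) := by
  have h := exists_subquotient_equiv (E := (⋀[ℂ]^i V) ⊗[ℂ] M) (F := F) (koszulCycles μ i)
    (koszulBoundaries ν i) K
  have hθ : ∀ x, (a ∘ₗ θ.symm.toLinearMap) (θ x) = a x := fun x => by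
    rw [LinearMap.comp_apply, LinearEquiv.coe_coe, LinearEquiv.symm_apply_apply]
  have h1 := h (a ∘ₗ θ.symm.toLinearMap) b
    (θ.surjective.forall.2 fun x hx => by rw [hθ]; exact ha x hx) hb
    (θ.surjective.forall.2 fun x hx => by rw [hθ]; exact hab x hx)
    (fun n hn => θ.surjective.exists.2 ((hba n hn).imp fun x hx => by rw [hθ]; exact hx))
  obtain ⟨e, he⟩ := h1
  refine ⟨e, fun x hx => ?_⟩
  rw [← hθ x]
  exact he (θ x) hx

end Koszul

/-! ### The comparison isomorphism and its equivariance -/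

/-- The Koszul group `K_{i,1}` for `i = m + 1`, compared with the kernel of `γ'` through functions
of `m + 2` points of the rational normal curve. -/
theorem exists_equiv_ker_gammaPrime {g : ℕ} (hg : 2 ≤ g) (m : ℕ) :
    ∃ e : KT g (m + 1) ≃ₗ[ℂ] LinearMap.ker (gammaPrime g (m + 1)),
      ∀ ω hω, symEval g m ω = formEval m _
        (e (koszulClass (sectionsMul g 0) (sectionsMul g 1) (m + 1)
          (wedgeLinEquiv hg (m + 1) ω) hω)).1 := by
  have h := exists_koszulGroup_equiv (X := (⋀[ℂ]^(m + 1) (Forms g)) ⊗[ℂ] Forms g)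
    (W := Forms (2 * (m + 1)) ⊗[ℂ] symPowZ (Forms (m + 1 + 1)) ((g : ℤ) - (m + 1 : ℕ) - 2))
    (F := (Fin (m + 2) → Fin 2 → ℂ) → ℂ) (sectionsMul g 0) (sectionsMul g 1) (m + 1)
    (LinearMap.ker (gammaPrime g (m + 1))) (wedgeLinEquiv hg (m + 1)) (symEval g m)
  have h1 := h (formEval m _)
    (fun ω _ => _root_.funext_iff.trans (mem_koszulBoundaries_iff hg m ω).symm)
  have h2 := h1 fun _ hG h0 => eq_zero_of_formEval hG h0
  have h3 := h2 fun _ hω => exists_mem_ker_of_cycle hg hω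
  exact h3 fun _ hG => exists_cycle_of_mem_ker hg hG

theorem wedgeLinEquiv_map_mem_koszulCycles {g : ℕ} (hg : 2 ≤ g) (m : ℕ) (A : SL2)
    {ω : (⋀[ℂ]^(m + 1) (Forms g)) ⊗[ℂ] Forms g}
    (hω : wedgeLinEquiv hg (m + 1) ω ∈ koszulCycles (sectionsMul g 1) (m + 1)) :
    wedgeLinEquiv hg (m + 1)
        (TensorProduct.map (exteriorPower.map _ (formAct A g)) (formAct A g) ω) ∈
      koszulCycles (sectionsMul g 1) (m + 1) := by
  rw [← wedgeLinEquiv_map]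
  exact koszulCycles_map (sectionsMul g 1) (m + 1) (formAct A g) (sectionsAct A g 1)
    (sectionsAct A g 2) (sectionsMul_act A g 1) _ hω

theorem KTAct_koszulClass {g : ℕ} (hg : 2 ≤ g) (m : ℕ) (A : SL2)
    (ω : (⋀[ℂ]^(m + 1) (Forms g)) ⊗[ℂ] Forms g)
    (hω : wedgeLinEquiv hg (m + 1) ω ∈ koszulCycles (sectionsMul g 1) (m + 1)) :
    KTAct A g (m + 1) (koszulClass (sectionsMul g 0) (sectionsMul g 1) (m + 1)
        (wedgeLinEquiv hg (m + 1) ω) hω) =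
      koszulClass (sectionsMul g 0) (sectionsMul g 1) (m + 1)
        (wedgeLinEquiv hg (m + 1)
          (TensorProduct.map (exteriorPower.map _ (formAct A g)) (formAct A g) ω))
        (wedgeLinEquiv_map_mem_koszulCycles hg m A hω) := by
  have h := koszulGroupMap_koszulClass (sectionsMul g 0) (sectionsMul g 1) (m + 1) (formAct A g)
    (sectionsAct A g 0) (sectionsAct A g 1) (sectionsAct A g 2) (sectionsMul_act A g 0)
    (sectionsMul_act A g 1) (wedgeLinEquiv hg (m + 1) ω) hω
  have h' : ∀ z hz z' hz', z = z' → koszulClass (sectionsMul g 0) (sectionsMul g 1) (m + 1) z hz =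
      koszulClass (sectionsMul g 0) (sectionsMul g 1) (m + 1) z' hz' := by
    rintro z hz _ _ rfl
    rfl
  exact h.trans (h' _ _ _ _ (wedgeLinEquiv_map hg (m + 1) A ω))

theorem exists_koszulClass_eq {g : ℕ} (hg : 2 ≤ g) (m : ℕ) (x : KT g (m + 1)) :
    ∃ ω hω, koszulClass (sectionsMul g 0) (sectionsMul g 1) (m + 1)
      (wedgeLinEquiv hg (m + 1) ω) hω = x := by
  obtain ⟨z, hz, h⟩ := koszulClass_surjective (sectionsMul g 0) (sectionsMul g 1) (m + 1) x
  obtain ⟨ω, hω⟩ := (wedgeLinEquiv hg (m + 1)).surjective z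
  have h' : ∀ z' hz', z' = z →
      koszulClass (sectionsMul g 0) (sectionsMul g 1) (m + 1) z' hz' = x := by
    rintro z' hz' rfl
    exact h
  exact ⟨ω, hω ▸ hz, h' _ _ hω⟩

theorem eq_of_map_eq_on_submodule {W F : Type*} [AddCommGroup W] [Module ℂ W] [AddCommGroup F]
    [Module ℂ F] (K : Submodule ℂ W) (b : W →ₗ[ℂ] F) (hb : ∀ n ∈ K, b n = 0 → n = 0) {x y : W}
    (hx : x ∈ K) (hy : y ∈ K) (h : b x = b y) : x = y :=
  sub_eq_zero.1 (hb _ (K.sub_mem hx hy) (by rw [map_sub, h, sub_self]))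

/-- Both `symEval` and `formEval` turn the action of A into moving all points by A, and `formEval`
is injective on the kernel. -/
theorem eq_sourceAct_of_symEval_eq {g m : ℕ} (A : SL2)
    {ω : (⋀[ℂ]^(m + 1) (Forms g)) ⊗[ℂ] Forms g}
    {G G' : Forms (2 * (m + 1)) ⊗[ℂ] symPowZ (Forms (m + 1 + 1)) ((g : ℤ) - (m + 1 : ℕ) - 2)}
    (hG : G ∈ LinearMap.ker (gammaPrime g (m + 1)))
    (hG' : G' ∈ LinearMap.ker (gammaPrime g (m + 1))) (h : symEval g m ω = formEval m _ G)
    (h' : symEval g m (TensorProduct.map (exteriorPower.map _ (formAct A g)) (formAct A g) ω) =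
      formEval m _ G') : G' = sourceAct A g (m + 1) G := by
  have key := eq_of_map_eq_on_submodule
    (W := Forms (2 * (m + 1)) ⊗[ℂ] symPowZ (Forms (m + 1 + 1)) ((g : ℤ) - (m + 1 : ℕ) - 2))
    (F := (Fin (m + 2) → Fin 2 → ℂ) → ℂ) (LinearMap.ker (gammaPrime g (m + 1)))
  refine key (formEval m _) (fun _ hG h0 => eq_zero_of_formEval hG h0) hG'
    (sourceAct_mem_ker A g m hG) ?_
  rw [← h']
  funext p
  rw [symEval_map, h, formEval_apply, formEval_apply, sourceAct, testEval_vecMul]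

theorem exists_equivariant_equiv_ker_gammaPrime {g : ℕ} (hg : 2 ≤ g) (m : ℕ) :
    ∃ e : KT g (m + 1) ≃ₗ[ℂ] LinearMap.ker (gammaPrime g (m + 1)),
      ∀ (A : SL2) (x : KT g (m + 1)),
        (e (KTAct A g (m + 1) x)).1 = sourceAct A g (m + 1) (e x).1 := by
  obtain ⟨e, he⟩ := exists_equiv_ker_gammaPrime hg m
  have he' : ∀ ω hω x, koszulClass (sectionsMul g 0) (sectionsMul g 1) (m + 1)
      (wedgeLinEquiv hg (m + 1) ω) hω = x → symEval g m ω = formEval m _ (e x).1 :=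
    fun ω hω _ h => h ▸ he ω hω
  refine ⟨e, fun A x => ?_⟩
  obtain ⟨ω, hω, hx⟩ := exists_koszulClass_eq hg m x
  have hA := (KTAct_koszulClass hg m A ω hω).symm.trans (congrArg _ hx)
  exact eq_sourceAct_of_symEval_eq A (e x).2 (e (KTAct A g (m + 1) x)).2 (he' _ _ _ hx)
    (he' _ _ _ hA)

end TangentDevelopable

end

theorem mainTheorem5 (g i : ℕ) (hg : 3 ≤ g) (hi : 1 ≤ i) :
    ∃ e : TangentDevelopable.KT g i ≃ₗ[ℂ] LinearMap.ker (TangentDevelopable.gammaPrime g i),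
      ∀ (A : TangentDevelopable.SL2) (x : TangentDevelopable.KT g i),
        (e (TangentDevelopable.KTAct A g i x)).1 =
          TangentDevelopable.sourceAct A g i (e x).1 := by
  obtain ⟨m, rfl⟩ := Nat.exists_eq_add_of_le' hi
  exact TangentDevelopable.exists_equivariant_equiv_ker_gammaPrime (by omega) m
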